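/- Let $G=(V,E)$ be a finite simple graph with at least one vertex, let $p=|V|$, and suppose that $G$ is series-parallel, i.e. $G$ has no $K_4$ minor. Let $\mathbb{S}^p_{\succeq 0}(G)$ be the cone of real positive semidefinite matrices $X=(x_{ij})_{i,j\in V}$ with $x_{ij}=0$ whenever $i\neq j$ and $\{i,j\}\notin E$. A nonzero matrix $X$ is *extremal* if it generates an extreme ray of this cone; the *extremal ranks* are the ranks of the extremal matrices, and the *sparsity order* of $G$ is the maximum extremal rank. A *chordless $m$-cycle* ($m\geq 3$) is an induced subgraph of $G$ isomorphic to the cycle $C_m$. Let $\mathrm{CUT}^{\pm}(G)\subset\mathbb{R}^E$ be the convex hull of the vectors $x^U$, $U\subseteq V$, where $x^U_e=-1$ if exactly one endpoint of $e$ lies in $U$ and $x^U_e=1$ otherwise. Then: 1. The set of extremal ranks of $\mathbb{S}^p_{\succeq 0}(G)$ is $\{1\}\cup\{m-2 : G \text{ has a chordless } m\text{-cycle}\}$. 2. If $E\neq\emptyset$, this set equals the set of constant terms $b$ of the facet-defining inequalities $\langle\alpha,x\rangle\leq b$ of $\mathrm{CUT}^{\pm}(G)$, where each facet normal $\alpha$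 is scaled to be a primitive integer vector (integer entries with greatest common divisor $1$). 3. The sparsity order of $G$ is $p^*-2$, where $p^*$ is the length of a longest chordless cycle of $G$, if $G$ has a chordless cycle; it is $1$ if $G$ has none. -/

import Mathlib

open scoped Matrix

/-! ### Graphs: minors, series-parallel graphs, chordless cycles -/

/-- `H` is a minor of `G`: there are pairwise disjoint sets of vertices of `G` (the branch sets),
one for each vertex of `H`, each inducing a (nonempty) connected subgraph of `G`, such that `G` has
an edge between the branch sets of any two adjacent vertices of `H`. Contracting the branch sets to
single vertices and deleting the superfluous vertices and edges produces `H` from `G`. -/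
def GraphMinor {W V : Type*} (H : SimpleGraph W) (G : SimpleGraph V) : Prop :=
  ∃ B : W → Set V,
    (∀ w, (G.induce (B w)).Connected) ∧
    (∀ w w', w ≠ w' → Disjoint (B w) (B w')) ∧
    ∀ w w', H.Adj w w' → ∃ x ∈ B w, ∃ y ∈ B w', G.Adj x y

/-- A graph is series-parallel if it has no `K₄` minor. -/
def SeriesParallel {V : Type*} (G : SimpleGraph V) : Prop :=
  ¬ GraphMinor (⊤ : SimpleGraph (Fin 4)) G

/-- The set of lengths of the chordless cycles of `G`, that is, the set of all `m ≥ 3` such that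
the cycle `C_m` is an induced subgraph of `G`. -/
def chordlessCycleLengths {V : Type*} (G : SimpleGraph V) : Set ℕ :=
  {m | 3 ≤ m ∧ (SimpleGraph.cycleGraph m).IsIndContained G}

/-! ### The cone of positive semidefinite matrices with the sparsity pattern of `G` -/

/-- The cone of all real positive semidefinite matrices with zeros in all (off-diagonal) entries
corresponding to nonedges of `G`. -/
def psdCone {V : Type*} (G : SimpleGraph V) : Set (Matrix V V ℝ) :=
  {X | X.PosSemidef ∧ ∀ i j, i ≠ j → ¬ G.Adj i j → X i j = 0}

/-- `X` is an extremal matrix of the cone: it is nonzero and the ray it generates is an extreme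
set of the cone (in particular it is contained in the cone). -/
def IsExtremalMatrix {V : Type*} (G : SimpleGraph V) (X : Matrix V V ℝ) : Prop :=
  X ≠ 0 ∧ IsExtreme ℝ (psdCone G) {Y | ∃ t : ℝ, 0 ≤ t ∧ Y = t • X}

/-- The extremal ranks: the ranks of the extremal matrices. -/
def extremalRanks {V : Type*} [Fintype V] (G : SimpleGraph V) : Set ℕ :=
  {r | ∃ X : Matrix V V ℝ, IsExtremalMatrix G X ∧ X.rank = r}

/-- The sparsity order of `G`: the maximum of the extremal ranks. -/
noncomputable def sparsityOrder {V : Type*} [Fintype V] (G : SimpleGraph V) : ℕ :=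
  sSup (extremalRanks G)

/-! ### The cut polytope and its facets -/

/-- The cutset `δ(U)`: the edges of `G` with one endpoint in `U` and the other one outside. -/
def cutset {V : Type*} (G : SimpleGraph V) (U : Set V) : Set (Sym2 V) :=
  {e | e ∈ G.edgeSet ∧ ∃ a ∈ U, ∃ b ∉ U, e = s(a, b)}

open Classical in
/-- The `±1` vector in `ℝ^E` of the cut `(U, Uᶜ)`: it is `-1` exactly at the edges of `δ(U)`. -/
noncomputable def cutVector {V : Type*} (G : SimpleGraph V) (U : Set V) : G.edgeSet → ℝ :=
  fun e => if (e : Sym2 V) ∈ cutset G U then -1 else 1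

/-- The `±1` cut polytope: the convex hull of all cut vectors. -/
def cutPolytope {V : Type*} (G : SimpleGraph V) : Set (G.edgeSet → ℝ) :=
  convexHull ℝ (Set.range (cutVector G))

/-- The inequality `⟨α, x⟩ ≤ b` defines a facet of `P`: it is valid on `P`, and the face where it
holds with equality is nonempty and of dimension `dim P - 1`. -/
def IsFacetDefining {ι : Type*} [Fintype ι] (P : Set (ι → ℝ)) (α : ι → ℝ) (b : ℝ) : Prop :=
  (∀ x ∈ P, α ⬝ᵥ x ≤ b) ∧
  {x | x ∈ P ∧ α ⬝ᵥ x = b}.Nonempty ∧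
  Module.finrank ℝ (vectorSpan ℝ {x | x ∈ P ∧ α ⬝ᵥ x = b}) + 1 =
    Module.finrank ℝ (vectorSpan ℝ P)

/-- The constant terms `b` of the facet-defining inequalities `⟨α, x⟩ ≤ b` of the cut polytope.
The normal vector of a facet is determined only up to a positive factor; as usual it is scaled to
be a primitive integer vector (integer entries without a common divisor other than `±1`). -/
def facetConstantTerms {V : Type*} (G : SimpleGraph V) [Fintype G.edgeSet] : Set ℝ :=
  {b | ∃ a : G.edgeSet → ℤ, (∀ d : ℤ, (∀ e, d ∣ a e) → IsUnit d) ∧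
    IsFacetDefining (cutPolytope G) (fun e => (a e : ℝ)) b}

/-- The graph obtained by contracting `v` into `a`; the vertex `v` becomes isolated. -/
def contractInto {V : Type*} (G : SimpleGraph V) (v a : V) : SimpleGraph V where
  Adj x y := x ≠ y ∧ x ≠ v ∧ y ≠ v ∧ (G.Adj x y ∨ (x = a ∧ G.Adj v y) ∨ (y = a ∧ G.Adj v x))
  symm := ⟨by
    rintro x y ⟨h1, h2, h3, h4⟩
    refine ⟨h1.symm, h3, h2, ?_⟩
    rcases h4 with h | h | h
    · exact Or.inl h.symm
    · exact Or.inr (Or.inr h)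
    · exact Or.inr (Or.inl h)⟩
  loopless := ⟨fun x h => h.1 rfl⟩

theorem SeriesParallel.anti {V : Type*} {G H : SimpleGraph V} (h : G ≤ H)
    (hH : SeriesParallel H) : SeriesParallel G := by
  rintro ⟨B, h1, h2, h3⟩
  refine hH ⟨B, fun w => (h1 w).mono ?_, h2, fun w w' hw => ?_⟩
  · exact fun x y hxy => h hxy
  · obtain ⟨x, hx, y, hy, hxy⟩ := h3 w w' hw
    exact ⟨x, hx, y, hy, h hxy⟩

theorem SeriesParallel.contractInto {V : Type*} {G : SimpleGraph V} (hG : SeriesParallel G)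
    {v a : V} (hva : G.Adj v a) : SeriesParallel (contractInto G v a) := by
  classical
  rintro ⟨B, h1, h2, h3⟩
  have hav : a ≠ v := hva.ne'
  set f : V → V := fun z => if z = v then a else z with hf
  have fv : f v = a := by simp [hf]
  have fne : ∀ z, z ≠ v → f z = z := fun z hz => by simp [hf, hz]
  have ff : ∀ z, f (f z) = f z := by
    intro z
    by_cases hz : z = v
    · subst hz; rw [fv, fne a hav]
    · rw [fne z hz, fne z hz]
  have key : ∀ w, ∃ x ∈ B w, x ≠ v := by
    intro w
    obtain ⟨w', hw'⟩ : ∃ w' : Fin 4, w ≠ w' := (exists_ne w).imp fun _ h => h.symm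
    obtain ⟨x, hx, y, hy, hxy⟩ := h3 w w' hw'
    exact ⟨x, hx, hxy.2.1⟩
  refine hG ⟨fun w => {z | f z ∈ B w}, fun w => ?_, fun w w' hw => ?_, fun w w' hw => ?_⟩
  · have step : ∀ x y : B w, ((_root_.contractInto G v a).induce (B w)).Adj x y →
        ∀ (hx : f x ∈ B w) (hy : f y ∈ B w),
        (G.induce {z | f z ∈ B w}).Reachable ⟨x, hx⟩ ⟨y, hy⟩ := by
      rintro ⟨x, hx'⟩ ⟨y, hy'⟩ ⟨h1, h2, h3, h4⟩ hx hy
      simp only at h1 h2 h3 h4 hx hy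
      rcases h4 with h | ⟨rfl, h⟩ | ⟨rfl, h⟩
      · exact SimpleGraph.Adj.reachable h
      · have hv : f v ∈ B w := by rw [fv]; exact hx'
        have r1 : (G.induce {z | f z ∈ B w}).Adj ⟨x, hx⟩ ⟨v, hv⟩ := hva.symm
        have r2 : (G.induce {z | f z ∈ B w}).Adj ⟨v, hv⟩ ⟨y, hy⟩ := h
        exact r1.reachable.trans r2.reachable
      · have hv : f v ∈ B w := by rw [fv]; exact hy'
        have r1 : (G.induce {z | f z ∈ B w}).Adj ⟨y, hy⟩ ⟨v, hv⟩ := hva.symm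
        have r2 : (G.induce {z | f z ∈ B w}).Adj ⟨v, hv⟩ ⟨x, hx⟩ := h
        exact (r1.reachable.trans r2.reachable).symm
    have lift : ∀ x y : B w, ((_root_.contractInto G v a).induce (B w)).Reachable x y →
        ∀ (hx : f x ∈ B w) (hy : f y ∈ B w),
        (G.induce {z | f z ∈ B w}).Reachable ⟨x, hx⟩ ⟨y, hy⟩ := by
      rintro x y ⟨p⟩
      induction p with
      | nil => intro _ _; rfl
      | @cons x y z hxy p ih =>
        intro hx hz
        have hy : f y ∈ B w := by rw [fne y hxy.2.2.1]; exact y.2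
        exact (step x y hxy hx hy).trans (ih hy hz)
    have self : ∀ (z : V) (hz : f z ∈ B w) (hz' : f (f z) ∈ B w),
        (G.induce {z | f z ∈ B w}).Reachable ⟨z, hz⟩ ⟨f z, hz'⟩ := by
      intro z hz hz'
      by_cases hzv : z = v
      · have : (G.induce {z | f z ∈ B w}).Adj ⟨z, hz⟩ ⟨f z, hz'⟩ := by
          subst hzv
          change G.Adj z (f z)
          rw [fv]; exact hva
        exact this.reachable
      · have : (⟨z, hz⟩ : {z | f z ∈ B w}) = ⟨f z, hz'⟩ := by
          apply Subtype.ext; exact (fne z hzv).symm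
        rw [this]
    obtain ⟨x0, hx0, hx0v⟩ := key w
    have : Nonempty ({z | f z ∈ B w} : Set V) := ⟨⟨x0, by
      change f x0 ∈ B w
      rw [fne _ hx0v]; exact hx0⟩⟩
    refine SimpleGraph.Connected.mk ?_
    rintro ⟨x, hx⟩ ⟨y, hy⟩
    have hx' : f (f x) ∈ B w := by rw [ff]; exact hx
    have hy' : f (f y) ∈ B w := by rw [ff]; exact hy
    exact (self x hx hx').trans ((lift ⟨f x, hx⟩ ⟨f y, hy⟩ ((h1 w).preconnected _ _) hx' hy').trans
      (self y hy hy').symm)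
  · rw [Set.disjoint_left]
    intro z hz hz'
    exact Set.disjoint_left.1 (h2 w w' hw) hz hz'
  · obtain ⟨x, hx, y, hy, h1, h2, h3', h4⟩ := h3 w w' hw
    have mem : ∀ u w, u ∈ B w → u ≠ v → u ∈ {z | f z ∈ B w} := by
      intro u w hu huv
      change f u ∈ B w
      rw [fne u huv]; exact hu
    rcases h4 with h | ⟨rfl, h⟩ | ⟨rfl, h⟩
    · exact ⟨x, mem x w hx h2, y, mem y w' hy h3', h⟩
    · exact ⟨v, by change f v ∈ B w; rw [fv]; exact hx, y, mem y w' hy h3', h⟩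
    · exact ⟨x, mem x w hx h2, v, by change f v ∈ B w'; rw [fv]; exact hy, h.symm⟩

/-- Every vertex that is not isolated has at least three neighbours. -/
def MinDegreeThree {V : Type*} (G : SimpleGraph V) : Prop :=
  ∀ v u, G.Adj v u → ∀ a b, ∃ c, G.Adj v c ∧ c ≠ a ∧ c ≠ b

theorem graphMinor_of_clique {V : Type*} {G : SimpleGraph V} {x y z w : V} (h1 : G.Adj x y)
    (h2 : G.Adj x z) (h3 : G.Adj x w) (h4 : G.Adj y z) (h5 : G.Adj y w) (h6 : G.Adj z w) :
    GraphMinor (⊤ : SimpleGraph (Fin 4)) G := by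
  have hadj : ∀ i j : Fin 4, i ≠ j → G.Adj (![x, y, z, w] i) (![x, y, z, w] j) := by
    intro i j hij
    fin_cases i <;> fin_cases j <;> first | exact absurd rfl hij | skip
    all_goals simp
    all_goals first | assumption | (apply SimpleGraph.Adj.symm; assumption)
  refine ⟨fun i => {![x, y, z, w] i}, fun i => ?_, fun i j hij => ?_, fun i j hij => ?_⟩
  · have : Subsingleton ({![x, y, z, w] i} : Set V) := by infer_instance
    exact SimpleGraph.Connected.mk (fun a b => by rw [Subsingleton.elim a b])
  · simpa using (hadj i j hij).ne
  · exact ⟨_, rfl, _, rfl, hadj i j (by simpa using hij)⟩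

theorem exists_of_not_minDegreeThree_contractInto {V : Type*} {G : SimpleGraph V}
    (hG : MinDegreeThree G) {x y : V} (hxy : G.Adj y x)
    (h : ¬ MinDegreeThree (contractInto G y x)) :
    (∃ z w, G.Adj z x ∧ G.Adj z y ∧ ∀ c, G.Adj z c → c = x ∨ c = y ∨ c = w) ∨
    (∃ c d, (∀ t, G.Adj x t → t = y ∨ t = c ∨ t = d) ∧ (∀ t, G.Adj y t → t = x ∨ t = c ∨ t = d)) := by
  classical
  unfold MinDegreeThree at h
  push Not at h
  obtain ⟨v, u, hvu, a, b, hab⟩ := h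
  have hab' : ∀ c, (contractInto G y x).Adj v c → c = a ∨ c = b := by
    intro c hc
    by_contra hcon
    push Not at hcon
    exact hcon.2 (hab c hc hcon.1)
  obtain ⟨hne, hvy, huy, h4⟩ := hvu
  by_cases hvx : v = x
  · subst hvx
    right
    refine ⟨a, b, fun t ht => ?_, fun t ht => ?_⟩
    · by_cases hty : t = y
      · exact Or.inl hty
      · exact Or.inr (hab' t ⟨ht.ne, hvy, hty, Or.inl ht⟩)
    · by_cases htv : t = v
      · exact Or.inl htv
      · exact Or.inr (hab' t ⟨Ne.symm htv, hvy, ht.ne', Or.inr (Or.inl ⟨rfl, ht⟩)⟩)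
  · left
    have hcase : ∀ c, G.Adj v c → c ≠ y → c = a ∨ c = b := fun c hc hcy =>
      hab' c ⟨hc.ne, hvy, hcy, Or.inl hc⟩
    have hy : G.Adj v y → x = a ∨ x = b := fun hc =>
      hab' x ⟨hvx, hvy, hxy.ne', Or.inr (Or.inr ⟨rfl, hc.symm⟩)⟩
    by_cases hvy' : G.Adj v y
    · obtain ⟨c1, hc1, hc1y, hc1x⟩ := hG v y hvy' y x
      obtain ⟨c2, hc2, hc2y, hc2x⟩ := hG v y hvy' y c1
      have := hy hvy'
      have h1 := hcase c1 hc1 hc1y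
      have h2 := hcase c2 hc2 hc2y
      refine ⟨v, c1, ?_, hvy', ?_⟩
      · grind
      · intro c hc
        have := hcase c hc
        grind
    · exfalso
      have hvw : ∃ w, G.Adj v w := by
        by_contra hcon
        push Not at hcon
        rcases h4 with h | ⟨h, -⟩ | ⟨-, h⟩
        · exact hcon _ h
        · exact hvx h
        · exact hcon _ h.symm
      obtain ⟨w, hw⟩ := hvw
      obtain ⟨c, hc, hca, hcb⟩ := hG v w hw a b
      have := hcase c hc (by rintro rfl; exact hvy' hc)
      grind

theorem ncard_support_contractInto_lt {V : Type*} [Finite V] {G : SimpleGraph V} {v a : V}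
    (hva : G.Adj v a) : (contractInto G v a).support.ncard < G.support.ncard := by
  apply Set.ncard_lt_ncard _ (Set.toFinite _)
  refine Set.ssubset_iff_of_subset ?_ |>.2 ⟨v, ⟨a, hva⟩, ?_⟩
  · rintro x ⟨y, h1, h2, h3, h | ⟨rfl, h⟩ | ⟨rfl, h⟩⟩
    · exact ⟨y, h⟩
    · exact ⟨v, hva.symm⟩
    · exact ⟨v, h.symm⟩
  · rintro ⟨y, h1, h2, -⟩
    exact h2 rfl

theorem not_minDegreeThree_of_seriesParallel {V : Type*} [Finite V] :
    ∀ (n : ℕ) (G : SimpleGraph V), G.support.ncard = n → SeriesParallel G → G ≠ ⊥ →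
      ¬ MinDegreeThree G := by
  intro n
  induction n using Nat.strong_induction_on with
  | _ n ih =>
  intro G hn hG hbot hD
  have contr : ∀ x y, G.Adj y x → ¬ MinDegreeThree (contractInto G y x) := by
    intro x y hyx
    refine ih _ (hn ▸ ncard_support_contractInto_lt hyx) _ rfl (hG.contractInto hyx) ?_
    obtain ⟨c, hc, hcx, -⟩ := hD y x hyx x x
    intro hbot'
    have : (contractInto G y x).Adj x c :=
      ⟨hcx.symm, hyx.ne', hc.ne', Or.inr (Or.inl ⟨rfl, hc⟩)⟩
    rw [hbot'] at this
    exact this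
  have tri : ∀ x y, G.Adj y x → ∃ z, G.Adj z x ∧ G.Adj z y := by
    intro x y hyx
    rcases exists_of_not_minDegreeThree_contractInto hD hyx (contr x y hyx) with
      ⟨z, w, h1, h2, -⟩ | ⟨c, d, h1, h2⟩
    · exact ⟨z, h1, h2⟩
    · obtain ⟨t, ht, h3, h4⟩ := hD x y hyx.symm y c
      obtain ⟨t', ht', h3', h4'⟩ := hD y x hyx x c
      have e1 := h1 t ht
      have e2 := h2 t' ht'
      have : t = t' := by grind
      exact ⟨t, ht.symm, this ▸ ht'.symm⟩
  obtain ⟨x0, y0, hxy0⟩ := SimpleGraph.ne_bot_iff_exists_adj.1 hbot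
  -- a vertex of degree three in a triangle
  obtain ⟨z, x, y, w, hzx, hzy, hzw, hxy, hxw, hyw, hz⟩ : ∃ z x y w, G.Adj z x ∧ G.Adj z y ∧
      G.Adj z w ∧ G.Adj x y ∧ x ≠ w ∧ y ≠ w ∧ ∀ c, G.Adj z c → c = x ∨ c = y ∨ c = w := by
    rcases exists_of_not_minDegreeThree_contractInto hD hxy0 (contr y0 x0 hxy0) with
      ⟨z, w, h1, h2, h3⟩ | ⟨c, d, h1, h2⟩
    · obtain ⟨w', hw', e1, e2⟩ := hD z _ h1 y0 x0
      have : w' = w := by have := h3 w' hw'; grind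
      subst this
      exact ⟨z, y0, x0, w', h1, h2, hw', hxy0.symm, e1.symm, e2.symm, h3⟩
    · obtain ⟨t, ht, h3, h4⟩ := hD y0 x0 hxy0.symm x0 c
      obtain ⟨t', ht', h3', h4'⟩ := hD y0 x0 hxy0.symm x0 d
      obtain ⟨s, hs, h5, h6⟩ := hD x0 y0 hxy0 y0 c
      have e1 := h1 t ht
      have e2 := h1 t' ht'
      have e3 := h2 s hs
      have e4 : t = d := by grind
      have e5 : t' = c := by grind
      have e6 : s = d := by grind
      subst e4 e5
      subst e6
      exact ⟨y0, x0, s, t', hxy0.symm, ht, ht', hs, h3'.symm, by tauto, by grind⟩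
  obtain ⟨x, y, hzx, hzy, hxy, hxw, hyw, hz, hxw'⟩ : ∃ x y, G.Adj z x ∧ G.Adj z y ∧ G.Adj x y ∧
      x ≠ w ∧ y ≠ w ∧ (∀ c, G.Adj z c → c = x ∨ c = y ∨ c = w) ∧ G.Adj x w := by
    obtain ⟨t, h1, h2⟩ := tri w z hzw
    rcases hz t h2.symm with rfl | rfl | rfl
    · exact ⟨t, y, hzx, hzy, hxy, hxw, hyw, hz, h1⟩
    · exact ⟨t, x, hzy, hzx, hxy.symm, hyw, hxw, fun c hc => by have := hz c hc; tauto, h1⟩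
    · exact absurd h1 (G.loopless.irrefl _)
  by_cases hyw' : G.Adj y w
  · exact hG (graphMinor_of_clique hxy hzx.symm hxw' hzy.symm hyw' hzw)
  have hx : ∀ c, G.Adj x c → c = y ∨ c = z ∨ c = w := by
    rcases exists_of_not_minDegreeThree_contractInto hD hzy (contr y z hzy) with
      ⟨s, r, h1, h2, h3⟩ | ⟨c, d, h1, h2⟩
    · have hs : s = x := by
        rcases hz s h2.symm with h | rfl | rfl
        · exact h
        · exact absurd h1 (G.loopless.irrefl _)
        · exact absurd h1.symm hyw'
      subst hs
      have := h3 w hxw'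
      intro c hc
      have := h3 c hc
      have := hzw.ne
      grind
    · exfalso
      have e1 := h2 x hzx
      have e2 := h2 w hzw
      obtain ⟨t, ht, h3, h4⟩ := hD y x hxy.symm z x
      have e3 := h1 t ht
      have e4 : t ≠ w := by rintro rfl; exact hyw' ht
      have := hxy.ne
      grind
  have two : ∀ y w, G.Adj x y → G.Adj z y → y ≠ w → ¬ G.Adj y w →
      (∀ c, G.Adj z c → c = x ∨ c = y ∨ c = w) → (∀ c, G.Adj x c → c = y ∨ c = z ∨ c = w) →
      ∃ u t, G.Adj y u ∧ G.Adj y t ∧ u ≠ t ∧ u ≠ x ∧ u ≠ z ∧ t ≠ x ∧ t ≠ z := by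
    intro y w hxy hzy hyw hyw' hz hx
    obtain ⟨u, hu, h1, h2⟩ := hD y x hxy.symm x z
    obtain ⟨t, ht1, ht2⟩ := tri u y hu
    refine ⟨u, t, hu, ht2.symm, ht1.ne', h1, h2, ?_, ?_⟩
    · rintro rfl
      have := hx u ht1
      have := hu.ne
      grind
    · rintro rfl
      have := hz u ht1
      have := hu.ne
      grind
  obtain ⟨u, t, hu, ht, hut, hux, huz, htx, htz⟩ := two y w hxy hzy hyw hyw' hz hx
  obtain ⟨u', t', hu', ht', hut', hux', huz', htx', htz'⟩ := two w y hxw' hzw hyw.symm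
    (fun h => hyw' h.symm) (fun c hc => by have := hz c hc; tauto)
    (fun c hc => by have := hx c hc; tauto)
  set G1 := contractInto G z y with hG1
  have hxy1 : G1.Adj x y := ⟨hxy.ne, hzx.ne', hzy.ne', Or.inl hxy⟩
  have hzn := hzx.ne
  have hyz := hzy.ne
  have hxyn := hxy.ne
  have hwz := hzw.ne
  have adj2 : ∀ p q, G.Adj p q → p ≠ x → p ≠ z → q ≠ x → q ≠ z →
      (contractInto G1 x y).Adj p q := fun p q hpq h1 h2 h3 h4 =>
    ⟨hpq.ne, h1, h3, Or.inl ⟨hpq.ne, h2, h4, Or.inl hpq⟩⟩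
  have adjyw : (contractInto G1 x y).Adj y w :=
    ⟨hyw, hxyn.symm, hxw.symm, Or.inl ⟨hyw, hyz.symm, hwz.symm, Or.inr (Or.inl ⟨rfl, hzw⟩)⟩⟩
  have lt2 : (contractInto G1 x y).support.ncard < n := by
    have h1 := ncard_support_contractInto_lt hxy1
    have h2 : G1.support.ncard < _ := ncard_support_contractInto_lt hzy
    omega
  refine ih _ lt2 _ rfl ((hG.contractInto hzy).contractInto hxy1) ?_ ?_
  · intro h
    rw [h] at adjyw
    exact adjyw
  · intro v r hvr a b
    have hvx : v ≠ x := hvr.2.1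
    have hvz : v ≠ z := by
      rcases hvr with ⟨-, -, -, h | ⟨h, -⟩ | ⟨-, h⟩⟩
      · exact h.2.1
      · rw [h]; exact hyz.symm
      · exact h.2.2.1
    by_cases hvy : v = y
    · subst hvy
      have a1 := adj2 v u hu hvx hvz hux huz
      have a2 := adj2 v t ht hvx hvz htx htz
      have : u ≠ w := by rintro rfl; exact hyw' hu
      have : t ≠ w := by rintro rfl; exact hyw' ht
      by_cases h1 : u ≠ a ∧ u ≠ b
      · exact ⟨u, a1, h1⟩
      by_cases h2 : t ≠ a ∧ t ≠ b
      · exact ⟨t, a2, h2⟩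
      exact ⟨w, adjyw, by grind⟩
    by_cases hvw : v = w
    · subst hvw
      have a1 := adj2 v u' hu' hvx hvz hux' huz'
      have a2 := adj2 v t' ht' hvx hvz htx' htz'
      have : u' ≠ y := by rintro rfl; exact hyw' hu'.symm
      have : t' ≠ y := by rintro rfl; exact hyw' ht'.symm
      by_cases h1 : u' ≠ a ∧ u' ≠ b
      · exact ⟨u', a1, h1⟩
      by_cases h2 : t' ≠ a ∧ t' ≠ b
      · exact ⟨t', a2, h2⟩
      exact ⟨y, adjyw.symm, by grind⟩
    · have nx : ∀ c, G.Adj v c → c ≠ x ∧ c ≠ z := by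
        intro c hc
        constructor
        · rintro rfl
          have := hx v hc.symm
          tauto
        · rintro rfl
          have := hz v hc.symm
          tauto
      have : ∃ c, G.Adj v c := by
        rcases hvr with ⟨-, -, -, h | ⟨h, -⟩ | ⟨-, h⟩⟩
        · rcases h with ⟨-, -, -, h | ⟨h, -⟩ | ⟨-, h⟩⟩
          · exact ⟨_, h⟩
          · exact absurd h hvy
          · exact ⟨_, h.symm⟩
        · exact absurd h hvy
        · rcases h with ⟨-, -, -, h | ⟨h, -⟩ | ⟨h, -⟩⟩
          · exact ⟨_, h.symm⟩
          · exact absurd h hxyn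
          · exact absurd h hvy
      obtain ⟨c0, hc0⟩ := this
      obtain ⟨c, hc, h1, h2⟩ := hD v c0 hc0 a b
      exact ⟨c, adj2 v c hc hvx hvz (nx c hc).1 (nx c hc).2, h1, h2⟩

/-- A series-parallel graph with an edge has a vertex of degree one or two. -/
theorem SeriesParallel.exists_degree_le_two {V : Type*} [Finite V] {G : SimpleGraph V}
    (hG : SeriesParallel G) (hbot : G ≠ ⊥) :
    ∃ v a b, G.Adj v a ∧ ∀ c, G.Adj v c → c = a ∨ c = b := by
  have h := not_minDegreeThree_of_seriesParallel _ G rfl hG hbot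
  unfold MinDegreeThree at h
  push Not at h
  obtain ⟨v, u, hvu, a, b, hab⟩ := h
  have hab' : ∀ c, G.Adj v c → c = a ∨ c = b := fun c hc => by
    by_contra hcon
    push Not at hcon
    exact hcon.2 (hab c hc hcon.1)
  rcases hab' u hvu with rfl | rfl
  · exact ⟨v, u, b, hvu, hab'⟩
  · exact ⟨v, u, a, hvu, fun c hc => (hab' c hc).symm⟩

/-- `f 0, …, f (m - 1)` are, in this order, the vertices of a chordless cycle of `G`. -/
structure IsChordlessCycle {V : Type*} (G : SimpleGraph V) (m : ℕ) (f : ℕ → V) : Prop where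
  three_le : 3 ≤ m
  inj : ∀ i < m, ∀ j < m, f i = f j → i = j
  adj : ∀ i < m, ∀ j < m, (G.Adj (f i) (f j) ↔
    (i + 1 = j ∨ j + 1 = i ∨ (i = 0 ∧ j + 1 = m) ∨ (j = 0 ∧ i + 1 = m)))

theorem cycleGraph_adj_iff_val {m : ℕ} (h3 : 3 ≤ m) (i j : Fin m) :
    (SimpleGraph.cycleGraph m).Adj i j ↔
      ((i : ℕ) + 1 = j ∨ (j : ℕ) + 1 = i ∨ ((i : ℕ) = 0 ∧ (j : ℕ) + 1 = m) ∨
        ((j : ℕ) = 0 ∧ (i : ℕ) + 1 = m)) := by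
  have hsub : ∀ i j : Fin m, ((i - j : Fin m) : ℕ) =
      if (j : ℕ) ≤ i then (i : ℕ) - j else m - j + i := by
    intro i j
    have hi := i.2
    have hj := j.2
    rw [Fin.val_sub]
    split_ifs with hle
    · rw [show m - (j : ℕ) + i = (i - j) + m by omega, Nat.add_mod_right, Nat.mod_eq_of_lt]
      omega
    · exact Nat.mod_eq_of_lt (by omega)
  have hi := i.2
  have hj := j.2
  rw [SimpleGraph.cycleGraph_adj', hsub, hsub]
  split_ifs <;> omega

theorem IsChordlessCycle.mem_chordlessCycleLengths {V : Type*} {G : SimpleGraph V} {m : ℕ}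
    {f : ℕ → V} (h : IsChordlessCycle G m f) : m ∈ chordlessCycleLengths G := by
  refine ⟨h.three_le, ⟨⟨⟨fun i => f i, ?_⟩, ?_⟩⟩⟩
  · intro i j hij
    exact Fin.ext (h.inj i i.2 j j.2 hij)
  · intro i j
    exact (h.adj i i.2 j j.2).trans (cycleGraph_adj_iff_val h.three_le i j).symm

theorem exists_isChordlessCycle {V : Type*} [Nonempty V] {G : SimpleGraph V} {m : ℕ}
    (h : m ∈ chordlessCycleLengths G) : ∃ f, IsChordlessCycle G m f := by
  obtain ⟨h3, ⟨e⟩⟩ := h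
  refine ⟨fun i => if h : i < m then e ⟨i, h⟩ else Classical.arbitrary V, h3, ?_, ?_⟩
  · intro i hi j hj hij
    simp only [dif_pos hi, dif_pos hj] at hij
    simpa using e.injective hij
  · intro i hi j hj
    simp only [dif_pos hi, dif_pos hj]
    rw [e.map_adj_iff, cycleGraph_adj_iff_val h3]

/-- A chordless cycle can be traversed so that a given edge closes it. -/
theorem IsChordlessCycle.exists_closing {V : Type*} {G : SimpleGraph V} {m : ℕ} {f : ℕ → V}
    (h : IsChordlessCycle G m f) {i j : ℕ} (hi : i < m) (hj : j < m) (hij : G.Adj (f i) (f j)) :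
    ∃ f', IsChordlessCycle G m f' ∧ f' 0 = f i ∧ f' (m - 1) = f j ∧
      (∀ k < m, ∃ k' < m, f' k' = f k) ∧ (∀ k < m, ∃ k' < m, f k' = f' k) := by
  have h3 := h.three_le
  have hij' := (h.adj i hi j hj).1 hij
  by_cases hc : i + 1 = j ∨ (j = 0 ∧ i + 1 = m)
  · set r : ℕ → ℕ := fun k => if k ≤ i then i - k else i + m - k with hr
    have hrr : ∀ k < m, r (r k) = k := by
      intro k hk
      simp only [hr]
      split_ifs <;> omega
    have hrl : ∀ k < m, r k < m := by
      intro k hk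
      simp only [hr]
      split_ifs <;> omega
    refine ⟨fun k => f (r k), ⟨h3, ?_, ?_⟩, ?_, ?_, ?_, ?_⟩
    · intro k hk l hl hkl
      have := h.inj _ (hrl k hk) _ (hrl l hl) hkl
      rw [← hrr k hk, ← hrr l hl, this]
    · intro k hk l hl
      rw [h.adj _ (hrl k hk) _ (hrl l hl)]
      simp only [hr]
      split_ifs <;> omega
    · simp [hr]
    · have : r (m - 1) = j := by
        simp only [hr]
        split_ifs <;> omega
      simp only [this]
    · exact fun k hk => ⟨r k, hrl k hk, by simp only [hrr k hk]⟩
    · exact fun k hk => ⟨r k, hrl k hk, rfl⟩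
  · set r : ℕ → ℕ := fun k => if i + k < m then i + k else i + k - m with hr
    set r' : ℕ → ℕ := fun k => if i ≤ k then k - i else k + m - i with hr'
    have hrr : ∀ k < m, r' (r k) = k := by
      intro k hk
      simp only [hr, hr']
      split_ifs <;> omega
    have hrr' : ∀ k < m, r (r' k) = k := by
      intro k hk
      simp only [hr, hr']
      split_ifs <;> omega
    have hrl : ∀ k < m, r k < m := by
      intro k hk
      simp only [hr]
      split_ifs <;> omega
    have hrl' : ∀ k < m, r' k < m := by
      intro k hk
      simp only [hr']
      split_ifs <;> omega
    refine ⟨fun k => f (r k), ⟨h3, ?_, ?_⟩, ?_, ?_, ?_, ?_⟩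
    · intro k hk l hl hkl
      have := h.inj _ (hrl k hk) _ (hrl l hl) hkl
      rw [← hrr k hk, ← hrr l hl, this]
    · intro k hk l hl
      rw [h.adj _ (hrl k hk) _ (hrl l hl)]
      simp only [hr]
      split_ifs <;> omega
    · simp [hr, hi]
    · have : r (m - 1) = j := by
        simp only [hr]
        split_ifs <;> omega
      simp only [this]
    · exact fun k hk => ⟨r' k, hrl' k hk, by simp only [hrr' k hk]⟩
    · exact fun k hk => ⟨r k, hrl k hk, rfl⟩

/-- The off-diagonal support of the matrix is contained in the graph. -/
def HasPattern {V : Type*} (G : SimpleGraph V) (X : Matrix V V ℝ) : Prop :=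
  ∀ i j, i ≠ j → X i j ≠ 0 → G.Adj i j

theorem HasPattern.add {V : Type*} {G : SimpleGraph V} {X Y : Matrix V V ℝ} (hX : HasPattern G X)
    (hY : HasPattern G Y) : HasPattern G (X + Y) := by
  intro i j hij h
  by_contra hn
  have h1 : X i j = 0 := by by_contra h'; exact hn (hX i j hij h')
  have h2 : Y i j = 0 := by by_contra h'; exact hn (hY i j hij h')
  simp [h1, h2] at h

theorem HasPattern.smul {V : Type*} {G : SimpleGraph V} {X : Matrix V V ℝ} (hX : HasPattern G X)
    (t : ℝ) : HasPattern G (t • X) := by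
  intro i j hij h
  exact hX i j hij (by intro h0; simp [h0] at h)

theorem HasPattern.mono {V : Type*} {G H : SimpleGraph V} {X : Matrix V V ℝ} (hX : HasPattern G X)
    (h : G ≤ H) : HasPattern H X := fun i j hij hX' => h (hX i j hij hX')

/-- A convex cone of symmetric matrices in which vertices with at most two neighbours in the
support graph can be eliminated. -/
structure IsEliminationCone {V : Type*} (Q : Set (Matrix V V ℝ)) : Prop where
  symm : ∀ X ∈ Q, ∀ i j, X i j = X j i
  add : ∀ X ∈ Q, ∀ Y ∈ Q, X + Y ∈ Q
  smul : ∀ X ∈ Q, ∀ t : ℝ, 0 ≤ t → t • X ∈ Q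
  elim_one : ∀ X ∈ Q, ∀ v c, v ≠ c → (∀ w, w ≠ v → X v w ≠ 0 → w = c) →
    ∃ g ∈ Q, X - g ∈ Q ∧ (∀ w, w ≠ v → g v w = X v w) ∧
      ∀ i j, i ≠ j → g i j ≠ 0 → (i = v ∧ j = c) ∨ (i = c ∧ j = v)
  elim_two : ∀ X ∈ Q, ∀ v a b, v ≠ a → v ≠ b → a ≠ b → X v a ≠ 0 → X v b ≠ 0 →
    (∀ w, w ≠ v → X v w ≠ 0 → w = a ∨ w = b) →
    ∃ g ∈ Q, X - g ∈ Q ∧ (∀ w, w ≠ v → g v w = X v w) ∧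
      (∀ i j, i ≠ j → g i j ≠ 0 → (i = v ∨ i = a ∨ i = b) ∧ (j = v ∨ j = a ∨ j = b)) ∧ g a b ≠ 0

/-- The off-diagonal support of `Y` is contained in a single edge. -/
def OnEdge {V : Type*} (Y : Matrix V V ℝ) (x y : V) : Prop :=
  ∀ i j, i ≠ j → Y i j ≠ 0 → (i = x ∧ j = y) ∨ (i = y ∧ j = x)

/-- The off-diagonal support of `Y` is contained in the set `{f 0, …, f (m - 1)}`. -/
def OnRange {V : Type*} (Y : Matrix V V ℝ) (m : ℕ) (f : ℕ → V) : Prop :=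
  ∀ i j, i ≠ j → Y i j ≠ 0 → (∃ k < m, f k = i) ∧ ∃ k < m, f k = j

/-- A matrix of `Q` supported on a single edge or a single chordless cycle of `G`. -/
structure IsPiece {V : Type*} (G : SimpleGraph V) (Q : Set (Matrix V V ℝ)) (Y : Matrix V V ℝ) :
    Prop where
  mem : Y ∈ Q
  pattern : HasPattern G Y
  shape : (∃ x y, OnEdge Y x y) ∨ ∃ m f, IsChordlessCycle G m f ∧ OnRange Y m f

/-- The graph `G` with all edges at `v` removed. -/
def isolate {V : Type*} (G : SimpleGraph V) (v : V) : SimpleGraph V where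
  Adj x y := G.Adj x y ∧ x ≠ v ∧ y ≠ v
  symm := ⟨fun _ _ h => ⟨h.1.symm, h.2.2, h.2.1⟩⟩
  loopless := ⟨fun _ h => G.loopless.irrefl _ h.1⟩

theorem isolate_le {V : Type*} (G : SimpleGraph V) (v : V) : isolate G v ≤ G := fun _ _ h => h.1

theorem ncard_support_isolate_lt {V : Type*} [Finite V] {G : SimpleGraph V} {v a : V}
    (hva : G.Adj v a) : (isolate G v).support.ncard < G.support.ncard := by
  apply Set.ncard_lt_ncard _ (Set.toFinite _)
  refine Set.ssubset_iff_of_subset ?_ |>.2 ⟨v, ⟨a, hva⟩, ?_⟩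
  · rintro x ⟨y, h1, -⟩
    exact ⟨y, h1⟩
  · rintro ⟨y, -, h2, -⟩
    exact h2 rfl

theorem IsChordlessCycle.exists_adj {V : Type*} {G : SimpleGraph V} {m : ℕ} {f : ℕ → V}
    (h : IsChordlessCycle G m f) {i : ℕ} (hi : i < m) : ∃ x, G.Adj (f i) x := by
  have h3 := h.three_le
  by_cases h0 : i = 0
  · exact ⟨f 1, (h.adj i hi 1 (by omega)).2 (by omega)⟩
  · exact ⟨f (i - 1), (h.adj i hi (i - 1) (by omega)).2 (by omega)⟩

theorem IsPiece.of_isolate {V : Type*} {G : SimpleGraph V} {v : V} {Q : Set (Matrix V V ℝ)}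
    {Y : Matrix V V ℝ} (h : IsPiece (isolate G v) Q Y) : IsPiece G Q Y := by
  refine ⟨h.mem, h.pattern.mono (isolate_le G v), ?_⟩
  rcases h.shape with h1 | ⟨m, f, hf, h1⟩
  · exact Or.inl h1
  · refine Or.inr ⟨m, f, ⟨hf.three_le, hf.inj, fun i hi j hj => ?_⟩, h1⟩
    rw [← hf.adj i hi j hj]
    obtain ⟨x, hx⟩ := hf.exists_adj hi
    obtain ⟨y, hy⟩ := hf.exists_adj hj
    exact ⟨fun h => ⟨h, hx.2.1, hy.2.1⟩, fun h => h.1⟩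

theorem IsChordlessCycle.triangle {V : Type*} {G : SimpleGraph V} {v a b : V} (h1 : G.Adj v a)
    (h2 : G.Adj v b) (h3 : G.Adj a b) :
    IsChordlessCycle G 3 (fun k => if k = 0 then v else if k = 1 then a else b) := by
  have := h1.ne
  have := h2.ne
  have := h3.ne
  have := h1.symm
  have := h2.symm
  have := h3.symm
  refine ⟨le_rfl, ?_, ?_⟩
  · intro i hi j hj h
    interval_cases i <;> interval_cases j <;> simp_all
  · intro i hi j hj
    interval_cases i <;> interval_cases j <;> simp_all

/-- A chordless cycle through the new edge `ab` becomes a chordless cycle when that edge is replaced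
by the path `a v b`. -/
theorem IsChordlessCycle.insert {V : Type*} {G : SimpleGraph V} {v a b : V} (hab : a ≠ b)
    (hva : G.Adj v a) (hvb : G.Adj v b) (hv : ∀ c, G.Adj v c → c = a ∨ c = b)
    (hnab : ¬ G.Adj a b) {m : ℕ} {f : ℕ → V} (h : IsChordlessCycle (contractInto G v a) m f)
    {i j : ℕ} (hi : i < m) (hj : j < m) (hia : f i = a) (hjb : f j = b) :
    ∃ f', IsChordlessCycle G (m + 1) f' ∧ (∃ k < m + 1, f' k = v) ∧
      ∀ k < m, ∃ k' < m + 1, f' k' = f k := by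
  have hadj : (contractInto G v a).Adj a b :=
    ⟨hab, hva.ne', hvb.ne', Or.inr (Or.inl ⟨rfl, hvb⟩)⟩
  obtain ⟨f', hf', h0, hm, hr, -⟩ := h.exists_closing hi hj (by rw [hia, hjb]; exact hadj)
  have h3 := h.three_le
  rw [hia] at h0
  rw [hjb] at hm
  have ne : ∀ k < m, f' k ≠ v := by
    intro k hk
    obtain ⟨x, hx⟩ := hf'.exists_adj hk
    exact hx.2.1
  have adj' : ∀ x y, x ≠ v → y ≠ v →
      ((contractInto G v a).Adj x y ↔ G.Adj x y ∨ (x = a ∧ y = b) ∨ (x = b ∧ y = a)) := by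
    intro x y hx hy
    constructor
    · rintro ⟨h1, -, -, h4 | ⟨rfl, h4⟩ | ⟨rfl, h4⟩⟩
      · exact Or.inl h4
      · rcases hv y h4 with rfl | rfl
        · exact absurd rfl h1
        · exact Or.inr (Or.inl ⟨rfl, rfl⟩)
      · rcases hv x h4 with rfl | rfl
        · exact absurd rfl h1
        · exact Or.inr (Or.inr ⟨rfl, rfl⟩)
    · rintro (h4 | ⟨rfl, rfl⟩ | ⟨rfl, rfl⟩)
      · exact ⟨h4.ne, hx, hy, Or.inl h4⟩
      · exact hadj
      · exact hadj.symm
  have eqa : ∀ k < m, (f' k = a ↔ k = 0) := fun k hk =>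
    ⟨fun h => hf'.inj k hk 0 (by omega) (h.trans h0.symm), fun h => by rw [h, h0]⟩
  have eqb : ∀ k < m, (f' k = b ↔ k = m - 1) := fun k hk =>
    ⟨fun h => hf'.inj k hk (m - 1) (by omega) (h.trans hm.symm), fun h => by rw [h, hm]⟩
  have hvadj : ∀ k < m, (G.Adj v (f' k) ↔ k = 0 ∨ k = m - 1) := by
    intro k hk
    rw [← eqa k hk, ← eqb k hk]
    constructor
    · exact hv _
    · rintro (h | h)
      · rw [h]; exact hva
      · rw [h]; exact hvb
  refine ⟨fun k => if k < m then f' k else v, ⟨by omega, ?_, ?_⟩, ⟨m, by omega, by simp⟩, ?_⟩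
  · intro k hk l hl hkl
    by_cases hkm : k < m <;> by_cases hlm : l < m
    · simp only [hkm, hlm, if_true] at hkl
      exact hf'.inj k hkm l hlm hkl
    · simp only [hkm, hlm, if_true, if_false] at hkl
      exact absurd hkl (ne k hkm)
    · simp only [hkm, hlm, if_true, if_false] at hkl
      exact absurd hkl.symm (ne l hlm)
    · omega
  · intro k hk l hl
    by_cases hkm : k < m <;> by_cases hlm : l < m
    · simp only [hkm, hlm, if_true]
      have e1 := hf'.adj k hkm l hlm
      rw [adj' _ _ (ne k hkm) (ne l hlm), eqa k hkm, eqb k hkm, eqa l hlm, eqb l hlm] at e1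
      have e2 : k = 0 → l = m - 1 → ¬ G.Adj (f' k) (f' l) := by
        rintro rfl rfl
        rw [h0, hm]; exact hnab
      have e3 : l = 0 → k = m - 1 → ¬ G.Adj (f' k) (f' l) := by
        rintro rfl rfl
        rw [h0, hm]; exact fun h => hnab h.symm
      by_cases hA : G.Adj (f' k) (f' l)
      · simp only [hA, true_or, true_iff, not_true_eq_false, imp_false] at e1 e2 e3 ⊢
        omega
      · simp only [hA, false_or, false_iff] at e1 ⊢
        omega
    · simp only [hkm, hlm, if_true, if_false]
      rw [G.adj_comm, hvadj k hkm]
      omega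
    · simp only [hkm, hlm, if_true, if_false]
      rw [hvadj l hlm]
      omega
    · simp only [hkm, hlm, if_false, SimpleGraph.irrefl, false_iff]
      omega
  · intro k hk
    obtain ⟨k', hk', e⟩ := hr k hk
    exact ⟨k', by omega, by simp only [hk', if_true]; exact e⟩

/-- Splitting a sum of pieces by the sign of `Y a b / γ`. -/
theorem exists_sign_splitting {V : Type*} {G : SimpleGraph V} {Q : Set (Matrix V V ℝ)}
    (hQ : IsEliminationCone Q) (h0 : (0 : Matrix V V ℝ) ∈ Q) (a b : V) (γ : ℝ) :
    ∀ l : List (Matrix V V ℝ), (∀ Y ∈ l, IsPiece G Q Y) →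
      ∃ (P : Matrix V V ℝ) (N : List (Matrix V V ℝ)), P ∈ Q ∧ HasPattern G P ∧ 0 ≤ P a b / γ ∧
        (∀ Y ∈ N, IsPiece G Q Y ∧ Y a b / γ < 0) ∧ l.sum = P + N.sum := by
  intro l
  induction l with
  | nil =>
    intro _
    exact ⟨0, [], h0, fun i j _ h => absurd rfl h, by simp, by simp, by simp⟩
  | cons Y l ih =>
    intro hl
    obtain ⟨P, N, h1, h2, h3, h4, h5⟩ := ih (fun Z hZ => hl Z (by simp [hZ]))
    have hY := hl Y (by simp)
    by_cases hs : Y a b / γ < 0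
    · refine ⟨P, Y :: N, h1, h2, h3, ?_, ?_⟩
      · intro Z hZ
        rcases List.mem_cons.1 hZ with rfl | hZ
        · exact ⟨hY, hs⟩
        · exact h4 Z hZ
      · rw [List.sum_cons, List.sum_cons, h5]; abel
    · refine ⟨Y + P, N, hQ.add _ hY.mem _ h1, hY.pattern.add h2, ?_, h4, ?_⟩
      · rw [Matrix.add_apply, add_div]
        linarith [not_lt.1 hs]
      · rw [List.sum_cons, h5]; abel

/-- A piece through the new edge `ab` and a matrix on the triangle `vab` cancelling its `ab` entry
add up to a sum of pieces of the original graph. -/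
theorem add_mem_closure_isPiece {V : Type*} {G : SimpleGraph V} {Q : Set (Matrix V V ℝ)}
    (hQ : IsEliminationCone Q) {v a b : V} (hab : a ≠ b) (hva : G.Adj v a) (hvb : G.Adj v b)
    (hv : ∀ c, G.Adj v c → c = a ∨ c = b) (hnab : ¬ G.Adj a b) {Y g : Matrix V V ℝ}
    (hY : IsPiece (contractInto G v a) Q Y) (hg : g ∈ Q)
    (hgs : ∀ i j, i ≠ j → g i j ≠ 0 → (i = v ∨ i = a ∨ i = b) ∧ (j = v ∨ j = a ∨ j = b))
    (h0 : Y a b ≠ 0) (hsum : Y a b + g a b = 0) :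
    Y + g ∈ AddSubmonoid.closure {Z | IsPiece G Q Z} := by
  have hW : Y + g ∈ Q := hQ.add _ hY.mem _ hg
  have hWab : (Y + g) a b = 0 := hsum
  have hWba : (Y + g) b a = 0 := by rw [hQ.symm _ hW, hWab]
  have pat : HasPattern G (Y + g) := by
    intro i j hij h
    by_cases hs : (i = a ∧ j = b) ∨ (i = b ∧ j = a)
    · rcases hs with ⟨rfl, rfl⟩ | ⟨rfl, rfl⟩
      · exact absurd hWab h
      · exact absurd hWba h
    by_cases hYij : Y i j = 0
    · have hgij : g i j ≠ 0 := by
        intro h'; exact h (by rw [Matrix.add_apply, hYij, h', add_zero])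
      obtain ⟨h1, h2⟩ := hgs i j hij hgij
      rcases h1 with rfl | rfl | rfl <;> rcases h2 with rfl | rfl | rfl
      · exact absurd rfl hij
      · exact hva
      · exact hvb
      · exact hva.symm
      · exact absurd rfl hij
      · tauto
      · exact hvb.symm
      · tauto
      · exact absurd rfl hij
    · obtain ⟨-, -, -, h4 | ⟨rfl, h4⟩ | ⟨rfl, h4⟩⟩ := hY.pattern i j hij hYij
      · exact h4
      · rcases hv j h4 with rfl | rfl <;> tauto
      · rcases hv i h4 with rfl | rfl <;> tauto
  have edge : ∀ Z : Matrix V V ℝ, Z ∈ Q → HasPattern G Z → ∀ x y, OnEdge Z x y →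
      Z ∈ AddSubmonoid.closure {Z | IsPiece G Q Z} := fun Z h1 h2 x y h3 =>
    AddSubmonoid.subset_closure ⟨h1, h2, Or.inl ⟨x, y, h3⟩⟩
  rcases hY.shape with ⟨x, y, hxy⟩ | ⟨m, f, hf, hr⟩
  · have hx := hxy a b hab h0
    have supp : ∀ i j, i ≠ j → (Y + g) i j ≠ 0 →
        (i = v ∧ j = a) ∨ (i = a ∧ j = v) ∨ (i = v ∧ j = b) ∨ (i = b ∧ j = v) := by
      intro i j hij h
      have hadj := pat i j hij h
      have hmem : (i = v ∨ i = a ∨ i = b) ∧ (j = v ∨ j = a ∨ j = b) := by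
        by_cases hYij : Y i j = 0
        · exact hgs i j hij (by
            intro h'; exact h (by rw [Matrix.add_apply, hYij, h', add_zero]))
        · have := hxy i j hij hYij
          grind
      have := hadj.symm
      grind
    obtain ⟨g1, hg1, hg2, hg3, hg4⟩ := hQ.elim_one (Y + g) hW a v hva.ne' (by
      intro w hw h
      have := supp a w hw.symm h
      have := hva.ne'
      grind)
    rw [show Y + g = g1 + (Y + g - g1) by abel]
    refine add_mem (edge g1 hg1 ?_ a v hg4) (edge _ hg2 ?_ v b ?_)
    · intro i j hij h
      rcases hg4 i j hij h with ⟨rfl, rfl⟩ | ⟨rfl, rfl⟩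
      · exact hva.symm
      · exact hva
    · intro i j hij h
      by_cases h1 : (Y + g) i j = 0
      · have h2 : g1 i j ≠ 0 := by
          intro h'; exact h (by rw [Matrix.sub_apply, h1, h', sub_zero])
        rcases hg4 i j hij h2 with ⟨rfl, rfl⟩ | ⟨rfl, rfl⟩
        · exact hva.symm
        · exact hva
      · exact pat i j hij h1
    · intro i j hij h
      have hia : i ≠ a := by
        rintro rfl
        exact h (by rw [Matrix.sub_apply, hg3 j hij.symm, sub_self])
      have hja : j ≠ a := by
        rintro rfl
        exact h (by rw [hQ.symm _ hg2, Matrix.sub_apply, hg3 i hij, sub_self])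
      by_cases h1 : (Y + g) i j = 0
      · have h2 : g1 i j ≠ 0 := by
          intro h'; exact h (by rw [Matrix.sub_apply, h1, h', sub_zero])
        have := hg4 i j hij h2
        grind
      · have := supp i j hij h1
        grind
  · obtain ⟨⟨ka, hka, hfa⟩, ⟨kb, hkb, hfb⟩⟩ := hr a b hab h0
    obtain ⟨f', hf', hv', hr'⟩ := hf.insert hab hva hvb hv hnab hka hkb hfa hfb
    refine AddSubmonoid.subset_closure ⟨hW, pat, Or.inr ⟨m + 1, f', hf', ?_⟩⟩
    have memg : ∀ i, i = v ∨ i = a ∨ i = b → ∃ k < m + 1, f' k = i := by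
      rintro i (rfl | rfl | rfl)
      · exact hv'
      · exact hfa ▸ hr' ka hka
      · exact hfb ▸ hr' kb hkb
    intro i j hij h
    by_cases hYij : Y i j = 0
    · have := hgs i j hij (by
        intro h'; exact h (by rw [Matrix.add_apply, hYij, h', add_zero]))
      exact ⟨memg i this.1, memg j this.2⟩
    · obtain ⟨⟨k, hk, rfl⟩, ⟨k', hk', rfl⟩⟩ := hr i j hij hYij
      exact ⟨hr' k hk, hr' k' hk'⟩

/-- The matrices of an elimination cone with series-parallel support graph are sums of matrices
supported on edges and chordless cycles. -/
theorem mem_closure_isPiece {V : Type*} [Finite V] [Nonempty V] {Q : Set (Matrix V V ℝ)}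
    (hQ : IsEliminationCone Q) : ∀ (n : ℕ) (G : SimpleGraph V), G.support.ncard = n →
      SeriesParallel G → ∀ X ∈ Q, HasPattern G X →
      X ∈ AddSubmonoid.closure {Y | IsPiece G Q Y} := by
  intro n
  induction n using Nat.strong_induction_on with
  | _ n ih =>
  intro G hn hG X hX hXG
  have hQ0 : (0 : Matrix V V ℝ) ∈ Q := by simpa using hQ.smul X hX 0 le_rfl
  by_cases hbot : G = ⊥
  · subst hbot
    refine AddSubmonoid.subset_closure ⟨hX, hXG, Or.inl ⟨Classical.arbitrary V,
      Classical.arbitrary V, fun i j hij h => ?_⟩⟩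
    exact absurd (hXG i j hij h) (by simp)
  obtain ⟨v, a, b, hva, hv⟩ := hG.exists_degree_le_two hbot
  have ihiso : ∀ Z ∈ Q, HasPattern (isolate G v) Z →
      Z ∈ AddSubmonoid.closure {Y | IsPiece G Q Y} := by
    intro Z hZ hZp
    have := ih _ (hn ▸ ncard_support_isolate_lt hva) (isolate G v) rfl
      (hG.anti (isolate_le G v)) Z hZ hZp
    exact AddSubmonoid.closure_mono (fun Y hY => hY.of_isolate) this
  have sub_pat : ∀ g, X - g ∈ Q → (∀ w, w ≠ v → g v w = X v w) →
      (∀ i j, i ≠ j → i ≠ v → j ≠ v → g i j ≠ 0 → G.Adj i j) →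
      HasPattern (isolate G v) (X - g) := by
    intro g hg h1 h2 i j hij h
    have hiv : i ≠ v := by
      rintro rfl
      exact h (by rw [Matrix.sub_apply, h1 j hij.symm, sub_self])
    have hjv : j ≠ v := by
      rintro rfl
      exact h (by rw [hQ.symm _ hg, Matrix.sub_apply, h1 i hij, sub_self])
    refine ⟨?_, hiv, hjv⟩
    by_cases hXij : X i j = 0
    · exact h2 i j hij hiv hjv (by
        intro h'; exact h (by rw [Matrix.sub_apply, hXij, h', sub_zero]))
    · exact hXG i j hij hXij
  by_cases htwo : ∃ c, G.Adj v c ∧ ∀ w, w ≠ v → X v w ≠ 0 → w = c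
  · obtain ⟨c, hvc, hc⟩ := htwo
    obtain ⟨g, hg1, hg2, hg3, hg4⟩ := hQ.elim_one X hX v c hvc.ne hc
    rw [show X = g + (X - g) by abel]
    refine add_mem (AddSubmonoid.subset_closure ⟨hg1, ?_, Or.inl ⟨v, c, hg4⟩⟩)
      (ihiso _ hg2 (sub_pat g hg2 hg3 ?_))
    · intro i j hij h
      rcases hg4 i j hij h with ⟨rfl, rfl⟩ | ⟨rfl, rfl⟩
      · exact hvc
      · exact hvc.symm
    · intro i j hij hi hj h
      rcases hg4 i j hij h with ⟨rfl, rfl⟩ | ⟨rfl, rfl⟩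
      · exact absurd rfl hi
      · exact absurd rfl hj
  have hnbr : ∀ w, w ≠ v → X v w ≠ 0 → w = a ∨ w = b := fun w hw h =>
    hv w (hXG v w hw.symm h)
  have hXb : X v b ≠ 0 ∧ b ≠ v ∧ b ≠ a := by
    by_contra hcon
    exact htwo ⟨a, hva, fun w hw h => by have := hnbr w hw h; grind⟩
  have hvb : G.Adj v b := hXG v b hXb.2.1.symm hXb.1
  have hXa : X v a ≠ 0 := by
    intro hcon
    exact htwo ⟨b, hvb, fun w hw h => by have := hnbr w hw h; grind⟩
  have hab : a ≠ b := hXb.2.2.symm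
  obtain ⟨g, hg1, hg2, hg3, hg4, hg5⟩ := hQ.elim_two X hX v a b hva.ne hvb.ne hab hXa hXb.1 hnbr
  by_cases habG : G.Adj a b
  · rw [show X = g + (X - g) by abel]
    refine add_mem (AddSubmonoid.subset_closure ⟨hg1, ?_, Or.inr ⟨3, _,
      IsChordlessCycle.triangle hva hvb habG, ?_⟩⟩) (ihiso _ hg2 (sub_pat g hg2 hg3 ?_))
    · intro i j hij h
      have := hg4 i j hij h
      have := hva.symm
      have := hvb.symm
      have := habG.symm
      grind
    · have aux : ∀ i, i = v ∨ i = a ∨ i = b →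
          ∃ k < 3, (if k = 0 then v else if k = 1 then a else b) = i := by
        rintro i (rfl | rfl | rfl)
        · exact ⟨0, by simp⟩
        · exact ⟨1, by simp⟩
        · exact ⟨2, by simp⟩
      intro i j hij h
      exact ⟨aux i (hg4 i j hij h).1, aux j (hg4 i j hij h).2⟩
    · intro i j hij hi hj h
      have := hg4 i j hij h
      have := habG.symm
      grind
  have hpat : HasPattern (contractInto G v a) (X - g) := by
    intro i j hij h
    have hiv : i ≠ v := by
      rintro rfl
      exact h (by rw [Matrix.sub_apply, hg3 j hij.symm, sub_self])
    have hjv : j ≠ v := by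
      rintro rfl
      exact h (by rw [hQ.symm _ hg2, Matrix.sub_apply, hg3 i hij, sub_self])
    refine ⟨hij, hiv, hjv, ?_⟩
    by_cases hXij : X i j = 0
    · have := hg4 i j hij (by
        intro h'; exact h (by rw [Matrix.sub_apply, hXij, h', sub_zero]))
      grind
    · exact Or.inl (hXG i j hij hXij)
  have hcl := ih _ (hn ▸ ncard_support_contractInto_lt hva) (contractInto G v a) rfl
    (hG.contractInto hva) _ hg2 hpat
  obtain ⟨l, hl, hls⟩ := AddSubmonoid.exists_list_of_mem_closure hcl
  obtain ⟨P, N, hP1, hP2, hP3, hN, hsum⟩ := exists_sign_splitting hQ hQ0 a b (g a b) l hl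
  rw [hls] at hsum
  have hsumab : P a b / g a b + N.sum a b / g a b = -1 := by
    rw [← add_div, ← Matrix.add_apply, ← hsum, Matrix.sub_apply]
    have : X a b = 0 := by
      by_contra h; exact habG (hXG a b hab h)
    rw [this]
    field_simp
    ring
  have hNsum : N.sum ∈ Q ∧ HasPattern (contractInto G v a) N.sum := by
    clear hsum hsumab
    induction N with
    | nil => exact ⟨by simpa using hQ0, fun i j _ h => absurd (by simp) h⟩
    | cons Y N ihN =>
      have h1 := ihN (fun Z hZ => hN Z (by simp [hZ]))
      have h2 := hN Y (by simp)
      rw [List.sum_cons]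
      exact ⟨hQ.add _ h2.1.mem _ h1.1, h2.1.pattern.add h1.2⟩
  have hterm : ∀ c : ℝ, 0 < c → c • N.sum + (-(c * (N.sum a b / g a b))) • g ∈
      AddSubmonoid.closure {Y | IsPiece G Q Y} := by
    intro c hc
    clear hsum hsumab hNsum
    induction N with
    | nil => simp
    | cons Y N ihN =>
      have h1 := ihN (fun Z hZ => hN Z (by simp [hZ]))
      obtain ⟨h2, h3⟩ := hN Y (by simp)
      have hY0 : Y a b ≠ 0 := by
        intro h; rw [h, zero_div] at h3; exact lt_irrefl _ h3
      have key : c • Y + (-(c * (Y a b / g a b))) • g ∈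
          AddSubmonoid.closure {Y | IsPiece G Q Y} := by
        refine add_mem_closure_isPiece hQ hab hva hvb hv habG (Y := c • Y) ?_ ?_ ?_ ?_ ?_
        · refine ⟨hQ.smul _ h2.mem c hc.le, h2.pattern.smul c, ?_⟩
          have nz : ∀ i j, (c • Y) i j ≠ 0 → Y i j ≠ 0 := by
            intro i j h h'; exact h (by simp [h'])
          rcases h2.shape with ⟨x, y, h⟩ | ⟨m, f, hf, h⟩
          · exact Or.inl ⟨x, y, fun i j hij h' => h i j hij (nz i j h')⟩
          · exact Or.inr ⟨m, f, hf, fun i j hij h' => h i j hij (nz i j h')⟩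
        · refine hQ.smul _ hg1 _ ?_
          have := mul_neg_of_pos_of_neg hc h3
          linarith
        · intro i j hij h
          exact hg4 i j hij (by intro h'; exact h (by simp [h']))
        · simp [hc.ne', hY0]
        · simp only [Matrix.smul_apply, smul_eq_mul]
          field_simp
          ring
      rw [List.sum_cons, Matrix.add_apply, add_div]
      convert add_mem key h1 using 1
      module
  set q : ℝ := -(N.sum a b / g a b) with hq
  have hq1 : 1 ≤ q := by linarith
  have hqpos : 0 < q := by linarith
  have hfin := hterm q⁻¹ (inv_pos.2 hqpos)
  have hcoef : -(q⁻¹ * (N.sum a b / g a b)) = 1 := by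
    rw [show N.sum a b / g a b = -q by rw [hq]; ring]
    field_simp
  rw [hcoef, one_smul] at hfin
  have hq2 : 0 ≤ 1 - q⁻¹ := by
    have := inv_le_one_of_one_le₀ hq1
    linarith
  have hrest : P + (1 - q⁻¹) • N.sum ∈ AddSubmonoid.closure {Y | IsPiece G Q Y} := by
    have hmem : P + (1 - q⁻¹) • N.sum ∈ Q := hQ.add _ hP1 _ (hQ.smul _ hNsum.1 _ hq2)
    have hp : HasPattern (contractInto G v a) (P + (1 - q⁻¹) • N.sum) :=
      hP2.add (hNsum.2.smul _)
    have hz : (P + (1 - q⁻¹) • N.sum) a b = 0 := by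
      have h1 : P a b = (q - 1) * g a b := by
        have : P a b / g a b = q - 1 := by linarith
        rw [div_eq_iff hg5] at this
        exact this
      have h2 : N.sum a b = -q * g a b := by
        have : N.sum a b / g a b = -q := by linarith
        rw [div_eq_iff hg5] at this
        exact this
      rw [Matrix.add_apply, Matrix.smul_apply, smul_eq_mul, h1, h2]
      field_simp
      ring
    refine ihiso _ hmem ?_
    intro i j hij h
    obtain ⟨-, h1, h2, h3⟩ := hp i j hij h
    refine ⟨?_, h1, h2⟩
    rcases h3 with h3 | ⟨rfl, h3⟩ | ⟨rfl, h3⟩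
    · exact h3
    · rcases hv j h3 with rfl | rfl
      · exact absurd rfl hij
      · exact absurd hz h
    · rcases hv i h3 with rfl | rfl
      · exact absurd rfl hij
      · exact absurd (by rw [hQ.symm _ hmem, hz]) h
  have : X = (P + (1 - q⁻¹) • N.sum) + (q⁻¹ • N.sum + g) := by
    rw [show X = (X - g) + g by abel, hsum]
    module
  rw [this]
  exact add_mem hrest hfin

theorem SeriesParallel.exists_list_isPiece {V : Type*} [Finite V] [Nonempty V]
    {Q : Set (Matrix V V ℝ)} (hQ : IsEliminationCone Q) {G : SimpleGraph V}
    (hG : SeriesParallel G) {X : Matrix V V ℝ} (hX : X ∈ Q) (hXG : HasPattern G X) :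
    ∃ l : List (Matrix V V ℝ), (∀ Y ∈ l, IsPiece G Q Y) ∧ l.sum = X :=
  AddSubmonoid.exists_list_of_mem_closure (mem_closure_isPiece hQ _ G rfl hG X hX hXG)

theorem posSemidef_iff_symm_and_nonneg {V : Type*} [Fintype V] {X : Matrix V V ℝ} :
    X.PosSemidef ↔ (∀ i j, X i j = X j i) ∧ ∀ x : V → ℝ, 0 ≤ x ⬝ᵥ X *ᵥ x := by
  constructor
  · intro h
    exact ⟨fun i j => by simpa using (h.1.apply i j).symm,
      fun x => by simpa using h.dotProduct_mulVec_nonneg x⟩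
  · rintro ⟨h1, h2⟩
    exact Matrix.PosSemidef.of_dotProduct_mulVec_nonneg
      (Matrix.IsHermitian.ext fun i j => by simpa using (h1 i j).symm) (fun x => by simpa using h2 x)

theorem dotProduct_mulVec_comm_of_symm {V : Type*} [Fintype V] {X : Matrix V V ℝ}
    (h : ∀ i j, X i j = X j i) (x y : V → ℝ) : x ⬝ᵥ X *ᵥ y = y ⬝ᵥ X *ᵥ x := by
  have hT : Xᵀ = X := by ext i j; exact h j i
  rw [Matrix.dotProduct_mulVec, ← Matrix.mulVec_transpose, hT, dotProduct_comm]

theorem dotProduct_vecMulVec_mulVec {V : Type*} [Fintype V] (w x : V → ℝ) :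
    x ⬝ᵥ Matrix.vecMulVec w w *ᵥ x = (w ⬝ᵥ x) ^ 2 := by
  rw [Matrix.vecMulVec_mulVec, dotProduct_smul, dotProduct_comm x w]
  simp [sq]

theorem Matrix.PosSemidef.mulVec_eq_zero {V : Type*} [Fintype V] {X : Matrix V V ℝ}
    (h : X.PosSemidef) {x : V → ℝ} (hx : x ⬝ᵥ X *ᵥ x = 0) : X *ᵥ x = 0 :=
  (h.dotProduct_mulVec_zero_iff x).1 (by simpa using hx)

/-- A rank one matrix built from a vector in the range of a positive semidefinite matrix can be
split off. -/
theorem Matrix.PosSemidef.sub_vecMulVec {V : Type*} [Fintype V] {X : Matrix V V ℝ}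
    (h : X.PosSemidef) (u : V → ℝ) :
    (X - (u ⬝ᵥ X *ᵥ u)⁻¹ • Matrix.vecMulVec (X *ᵥ u) (X *ᵥ u)).PosSemidef := by
  obtain ⟨h1, h2⟩ := posSemidef_iff_symm_and_nonneg.1 h
  refine posSemidef_iff_symm_and_nonneg.2 ⟨fun i j => ?_, fun x => ?_⟩
  · simp only [Matrix.sub_apply, Matrix.smul_apply, Matrix.vecMulVec_apply, smul_eq_mul]
    rw [h1 i j]; ring
  · rw [Matrix.sub_mulVec, dotProduct_sub, Matrix.smul_mulVec, dotProduct_smul,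
      dotProduct_vecMulVec_mulVec, smul_eq_mul]
    set q := u ⬝ᵥ X *ᵥ u with hq
    rcases (h2 u).eq_or_lt with h0 | hpos
    · rw [hq, ← h0]; simpa using h2 x
    · have hpos' : 0 < q := hpos
      have e1 : X *ᵥ u ⬝ᵥ x = x ⬝ᵥ X *ᵥ u := dotProduct_comm _ _
      have e2 : u ⬝ᵥ X *ᵥ x = x ⬝ᵥ X *ᵥ u := dotProduct_mulVec_comm_of_symm h1 _ _
      rw [e1]
      set p := x ⬝ᵥ X *ᵥ u with hp
      have := h2 (x - (p / q) • u)
      rw [Matrix.mulVec_sub, Matrix.mulVec_smul, dotProduct_sub, sub_dotProduct, sub_dotProduct,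
        dotProduct_smul, dotProduct_smul, smul_dotProduct, smul_dotProduct, e2, ← hp, ← hq] at this
      simp only [smul_eq_mul] at this
      have e3 : x ⬝ᵥ X *ᵥ x - q⁻¹ * p ^ 2 = x ⬝ᵥ X *ᵥ x - p / q * p - (p / q * p - p / q * (p / q * q)) := by
        field_simp
        ring
      rw [e3]
      exact this

theorem mulVec_single_one_apply {V : Type*} [Fintype V] [DecidableEq V] (X : Matrix V V ℝ)
    (v i : V) : (X *ᵥ Pi.single v 1) i = X i v := by
  rw [Matrix.mulVec_single_one]; rfl

theorem Matrix.PosSemidef.apply_eq_zero {V : Type*} [Fintype V] [DecidableEq V]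
    {X : Matrix V V ℝ} (h : X.PosSemidef) {v : V} (hv : X v v = 0) (i : V) : X i v = 0 := by
  have := h.mulVec_eq_zero (x := Pi.single v 1) (by
    rw [single_dotProduct, mulVec_single_one_apply, hv, one_mul])
  rw [← mulVec_single_one_apply X v i, this]; rfl

theorem isEliminationCone_posSemidef {V : Type*} [Fintype V] [DecidableEq V] :
    IsEliminationCone {X : Matrix V V ℝ | X.PosSemidef} := by
  have elim : ∀ X : Matrix V V ℝ, X.PosSemidef → ∀ v, ∃ g : Matrix V V ℝ, g.PosSemidef ∧
      (X - g).PosSemidef ∧ (∀ w, g v w = X v w) ∧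
      (∀ i j, g i j ≠ 0 → X v i ≠ 0 ∧ X v j ≠ 0) ∧ (∀ a b, X v a ≠ 0 → X v b ≠ 0 → g a b ≠ 0) := by
    intro X h v
    have hs := (posSemidef_iff_symm_and_nonneg.1 h).1
    have hq : (Pi.single v 1 : V → ℝ) ⬝ᵥ X *ᵥ Pi.single v 1 = X v v := by
      rw [single_dotProduct, mulVec_single_one_apply, one_mul]
    have hsub := h.sub_vecMulVec (Pi.single v 1)
    set c := X *ᵥ Pi.single v (1 : ℝ) with hc
    rw [hq] at hsub
    have hci : ∀ i, c i = X v i := fun i => by rw [hc, mulVec_single_one_apply, hs]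
    have hgij : ∀ i j, ((X v v)⁻¹ • Matrix.vecMulVec c c) i j = (X v v)⁻¹ * (X v i * X v j) := by
      intro i j
      rw [Matrix.smul_apply, Matrix.vecMulVec_apply, hci, hci, smul_eq_mul]
    have h0 : X v v = 0 → ∀ w, X v w = 0 := fun h' w => by rw [hs]; exact h.apply_eq_zero h' w
    refine ⟨(X v v)⁻¹ • Matrix.vecMulVec c c, ?_, hsub, ?_, ?_, ?_⟩
    · have := Matrix.posSemidef_vecMulVec_self_star c
      exact Matrix.PosSemidef.smul (by simpa using this) (inv_nonneg.2 h.diag_nonneg)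
    · intro w
      rw [hgij]
      by_cases h' : X v v = 0
      · rw [h0 h' w]; simp
      · field_simp
    · intro i j hij
      rw [hgij] at hij
      constructor
      · intro h'; simp [h'] at hij
      · intro h'; simp [h'] at hij
    · intro a b ha hb
      rw [hgij]
      have : X v v ≠ 0 := fun h' => ha (h0 h' a)
      positivity
  refine ⟨?_, ?_, ?_, ?_, ?_⟩
  · exact fun X h => (posSemidef_iff_symm_and_nonneg.1 h).1
  · exact fun X hX Y hY => Matrix.PosSemidef.add hX hY
  · exact fun X hX t ht => Matrix.PosSemidef.smul hX ht
  · intro X hX v c hvc hc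
    obtain ⟨g, h1, h2, h3, h4, -⟩ := elim X hX v
    refine ⟨g, h1, h2, fun w _ => h3 w, fun i j hij h => ?_⟩
    have := h4 i j h
    have := hc i
    have := hc j
    grind
  · intro X hX v a b _ _ _ ha hb hc
    obtain ⟨g, h1, h2, h3, h4, h5⟩ := elim X hX v
    refine ⟨g, h1, h2, fun w _ => h3 w, fun i j hij h => ?_, h5 a b ha hb⟩
    have := h4 i j h
    have := hc i
    have := hc j
    grind

theorem mem_psdCone_iff {V : Type*} {G : SimpleGraph V} {X : Matrix V V ℝ} :
    X ∈ psdCone G ↔ X.PosSemidef ∧ HasPattern G X := by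
  unfold psdCone HasPattern
  constructor
  · rintro ⟨h1, h2⟩
    exact ⟨h1, fun i j hij h => by by_contra h'; exact h (h2 i j hij h')⟩
  · rintro ⟨h1, h2⟩
    exact ⟨h1, fun i j hij h => by by_contra h'; exact h (h2 i j hij h')⟩

theorem add_mem_psdCone {V : Type*} {G : SimpleGraph V} {X Y : Matrix V V ℝ}
    (hX : X ∈ psdCone G) (hY : Y ∈ psdCone G) : X + Y ∈ psdCone G := by
  rw [mem_psdCone_iff] at *
  exact ⟨hX.1.add hY.1, hX.2.add hY.2⟩

theorem smul_mem_psdCone {V : Type*} {G : SimpleGraph V} {X : Matrix V V ℝ}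
    (hX : X ∈ psdCone G) {t : ℝ} (ht : 0 ≤ t) : t • X ∈ psdCone G := by
  rw [mem_psdCone_iff] at *
  exact ⟨hX.1.smul ht, hX.2.smul t⟩

theorem IsExtremalMatrix.mem {V : Type*} {G : SimpleGraph V} {X : Matrix V V ℝ}
    (h : IsExtremalMatrix G X) : X ∈ psdCone G :=
  h.2.subset ⟨1, zero_le_one, (one_smul _ _).symm⟩

theorem IsExtremalMatrix.exists_eq_smul {V : Type*} {G : SimpleGraph V} {X A B : Matrix V V ℝ}
    (h : IsExtremalMatrix G X) (hA : A ∈ psdCone G) (hB : B ∈ psdCone G) (hX : X = A + B) :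
    ∃ t : ℝ, 0 ≤ t ∧ A = t • X := by
  obtain ⟨t, ht, e⟩ := h.2.left_mem_of_mem_openSegment
    (smul_mem_psdCone hA (zero_le_two (α := ℝ))) (smul_mem_psdCone hB (zero_le_two (α := ℝ)))
    (z := X) ⟨1, zero_le_one, (one_smul _ _).symm⟩
    ⟨1 / 2, 1 / 2, by norm_num, by norm_num, by norm_num, by rw [hX]; module⟩
  refine ⟨t / 2, by positivity, ?_⟩
  rw [show A = (1 / 2 : ℝ) • ((2 : ℝ) • A) by module, e]
  module

/-- A criterion for extremality: a matrix of the cone that is dominated by a multiple of `X` is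
itself a multiple of `X`. -/
theorem isExtremalMatrix_of_forall {V : Type*} {G : SimpleGraph V} {X : Matrix V V ℝ}
    (h0 : X ≠ 0) (hX : X ∈ psdCone G)
    (h : ∀ A ∈ psdCone G, ∀ B ∈ psdCone G, ∀ s : ℝ, s • X = A + B → ∃ t : ℝ, 0 ≤ t ∧ A = t • X) :
    IsExtremalMatrix G X := by
  refine ⟨h0, ?_, ?_⟩
  · rintro Y ⟨t, ht, rfl⟩
    exact smul_mem_psdCone hX ht
  · rintro A hA B hB Z ⟨s, hs, rfl⟩ ⟨c, d, hc, hd, hcd, e⟩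
    obtain ⟨t, ht, e'⟩ := h _ (smul_mem_psdCone hA hc.le) _ (smul_mem_psdCone hB hd.le) s e.symm
    refine ⟨c⁻¹ * t, by positivity, ?_⟩
    rw [mul_smul, ← e', smul_smul, inv_mul_cancel₀ hc.ne', one_smul]

theorem vecMulVec_self_mem_psdCone {V : Type*} [Fintype V] {G : SimpleGraph V} {w : V → ℝ}
    (h : ∀ i j, i ≠ j → w i ≠ 0 → w j ≠ 0 → G.Adj i j) : Matrix.vecMulVec w w ∈ psdCone G := by
  rw [mem_psdCone_iff]
  refine ⟨by simpa using Matrix.posSemidef_vecMulVec_self_star w, fun i j hij h' => ?_⟩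
  rw [Matrix.vecMulVec_apply] at h'
  exact h i j hij (left_ne_zero_of_mul h') (right_ne_zero_of_mul h')

/-- If the range of an extremal matrix contains a nonzero vector supported on a clique, then the
matrix has rank one. -/
theorem IsExtremalMatrix.rank_eq_one {V : Type*} [Fintype V] {G : SimpleGraph V}
    {X : Matrix V V ℝ} (h : IsExtremalMatrix G X) (u : V → ℝ) (hu : X *ᵥ u ≠ 0)
    (hc : ∀ i j, i ≠ j → (X *ᵥ u) i ≠ 0 → (X *ᵥ u) j ≠ 0 → G.Adj i j) : X.rank = 1 := by
  have hX := (mem_psdCone_iff.1 h.mem)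
  have hq : 0 < u ⬝ᵥ X *ᵥ u := by
    refine lt_of_le_of_ne ((posSemidef_iff_symm_and_nonneg.1 hX.1).2 u) (fun h' => hu ?_)
    exact hX.1.mulVec_eq_zero h'.symm
  have hw := vecMulVec_self_mem_psdCone hc
  have hA := smul_mem_psdCone hw (inv_nonneg.2 hq.le)
  have hB : X - (u ⬝ᵥ X *ᵥ u)⁻¹ • Matrix.vecMulVec (X *ᵥ u) (X *ᵥ u) ∈ psdCone G := by
    rw [mem_psdCone_iff] at hA ⊢
    refine ⟨hX.1.sub_vecMulVec u, ?_⟩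
    rw [sub_eq_add_neg, ← neg_one_smul ℝ]
    exact hX.2.add (hA.2.smul _)
  obtain ⟨t, ht, e⟩ := h.exists_eq_smul hA hB (by abel)
  have hne : Matrix.vecMulVec (X *ᵥ u) (X *ᵥ u) ≠ 0 := by
    intro h0
    apply hu
    ext i
    have := congrFun (congrFun h0 i) i
    simpa [Matrix.vecMulVec_apply] using this
  have ht0 : t ≠ 0 := by
    rintro rfl
    rw [zero_smul] at e
    rcases smul_eq_zero.1 e with h1 | h1
    · exact hq.ne' (inv_eq_zero.1 h1)
    · exact hne h1
  have hXe : X = Matrix.vecMulVec ((t⁻¹ * (u ⬝ᵥ X *ᵥ u)⁻¹) • (X *ᵥ u)) (X *ᵥ u) := by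
    rw [Matrix.smul_vecMulVec, mul_smul, e, smul_smul, inv_mul_cancel₀ ht0, one_smul]
  apply le_antisymm
  · rw [hXe]; exact Matrix.rank_vecMulVec_le _ _
  · rw [Nat.one_le_iff_ne_zero]
    intro h0
    have hbot : LinearMap.range X.mulVecLin = ⊥ := Submodule.finrank_eq_zero.1 h0
    have hmem : X *ᵥ u ∈ LinearMap.range X.mulVecLin := ⟨u, rfl⟩
    rw [hbot] at hmem
    exact hu hmem

theorem IsExtremalMatrix.rank_eq_one_of_col {V : Type*} [Fintype V] [DecidableEq V]
    {G : SimpleGraph V} {X : Matrix V V ℝ} (h : IsExtremalMatrix G X) {v i : V} (hv : X i v ≠ 0)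
    (hc : ∀ i j, i ≠ j → X i v ≠ 0 → X j v ≠ 0 → G.Adj i j) : X.rank = 1 := by
  refine h.rank_eq_one (Pi.single v 1) ?_ ?_
  · intro h0
    apply hv
    rw [← mulVec_single_one_apply X v i, h0]; rfl
  · intro i j hij
    rw [mulVec_single_one_apply, mulVec_single_one_apply]
    exact hc i j hij

/-- Extremal matrices of series-parallel graphs are supported on a single edge or a single
chordless cycle. -/
theorem IsExtremalMatrix.shape {V : Type*} [Fintype V] [Nonempty V] {G : SimpleGraph V}
    (hG : SeriesParallel G) {X : Matrix V V ℝ} (h : IsExtremalMatrix G X) :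
    (∃ x y, OnEdge X x y) ∨ ∃ m f, IsChordlessCycle G m f ∧ OnRange X m f := by
  classical
  obtain ⟨hX1, hX2⟩ := mem_psdCone_iff.1 h.mem
  obtain ⟨l, hl, hs⟩ := hG.exists_list_isPiece isEliminationCone_posSemidef hX1 hX2
  obtain ⟨Y, hY, hY0⟩ : ∃ Y ∈ l, Y ≠ 0 := by
    by_contra hcon
    push Not at hcon
    exact h.1 (hs ▸ List.sum_eq_zero hcon)
  have hmem : ∀ Z ∈ l, Z ∈ psdCone G := fun Z hZ => mem_psdCone_iff.2 ⟨(hl Z hZ).mem, (hl Z hZ).pattern⟩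
  have hsum : ∀ l' : List (Matrix V V ℝ), (∀ Z ∈ l', Z ∈ psdCone G) → l'.sum ∈ psdCone G := by
    intro l'
    induction l' with
    | nil =>
      intro _
      simpa using smul_mem_psdCone h.mem le_rfl
    | cons Z l' ih =>
      intro h'
      rw [List.sum_cons]
      exact add_mem_psdCone (h' Z (by simp)) (ih fun W hW => h' W (by simp [hW]))
  obtain ⟨t, ht, e⟩ := h.exists_eq_smul (hmem Y hY)
    (hsum (l.erase Y) (fun Z hZ => hmem Z (List.mem_of_mem_erase hZ)))
    (by rw [← hs, List.sum_erase hY])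
  have nz : ∀ i j, X i j ≠ 0 → Y i j ≠ 0 := by
    intro i j hij h'
    rw [e, Matrix.smul_apply, smul_eq_mul] at h'
    rcases mul_eq_zero.1 h' with h' | h'
    · exact hY0 (by rw [e, h', zero_smul])
    · exact hij h'
  rcases (hl Y hY).shape with ⟨x, y, h'⟩ | ⟨m, f, hf, h'⟩
  · exact Or.inl ⟨x, y, fun i j hij hne => h' i j hij (nz i j hne)⟩
  · exact Or.inr ⟨m, f, hf, fun i j hij hne => h' i j hij (nz i j hne)⟩

theorem IsExtremalMatrix.exists_ne_zero {V : Type*} {G : SimpleGraph V} {X : Matrix V V ℝ}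
    (h : IsExtremalMatrix G X) : ∃ i j, X i j ≠ 0 := by
  by_contra hcon
  push Not at hcon
  exact h.1 (by ext i j; exact hcon i j)

theorem IsExtremalMatrix.rank_eq_one_of_onEdge {V : Type*} [Fintype V] [DecidableEq V]
    {G : SimpleGraph V} {X : Matrix V V ℝ} (h : IsExtremalMatrix G X) {x y : V}
    (hxy : OnEdge X x y) : X.rank = 1 := by
  obtain ⟨i, j, hij⟩ := h.exists_ne_zero
  obtain ⟨hX1, hX2⟩ := mem_psdCone_iff.1 h.mem
  refine h.rank_eq_one_of_col hij (fun a b hab ha hb => ?_)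
  by_cases haj : a = j
  · subst haj
    exact (hX2 b a hab.symm hb).symm
  by_cases hbj : b = j
  · subst hbj
    exact hX2 a b hab ha
  · have := hxy a j haj ha
    have := hxy b j hbj hb
    grind

/-- The off-diagonal support of a matrix on a chordless cycle: consecutive vertices. -/
theorem IsChordlessCycle.eq_of_ne_zero {V : Type*} {G : SimpleGraph V} {m : ℕ} {f : ℕ → V}
    (hf : IsChordlessCycle G m f) {X : Matrix V V ℝ} (hX : HasPattern G X) (hr : OnRange X m f)
    {k : ℕ} (hk : k < m) {i : V} (hi : X i (f k) ≠ 0) : ∃ l < m, f l = i ∧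
      (l = k ∨ l + 1 = k ∨ k + 1 = l ∨ (l = 0 ∧ k + 1 = m) ∨ (k = 0 ∧ l + 1 = m)) := by
  by_cases hik : i = f k
  · exact ⟨k, hk, hik.symm, Or.inl rfl⟩
  · obtain ⟨⟨l, hl, rfl⟩, -⟩ := hr i (f k) hik hi
    exact ⟨l, hl, rfl, Or.inr ((hf.adj l hl k hk).1 (hX _ _ hik hi))⟩

/-- An extremal matrix on a chordless cycle that is not of rank one vanishes outside the cycle and is
nonzero on the edges of the cycle. -/
theorem IsExtremalMatrix.apply_ne_zero {V : Type*} [Fintype V] [DecidableEq V]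
    {G : SimpleGraph V} {X : Matrix V V ℝ} (h : IsExtremalMatrix G X) (h1 : X.rank ≠ 1) {m : ℕ}
    {f : ℕ → V} (hf : IsChordlessCycle G m f) (hr : OnRange X m f) :
    (∀ w i, (∀ k < m, f k ≠ w) → X i w = 0) ∧ ∀ k, k + 1 < m → X (f k) (f (k + 1)) ≠ 0 := by
  obtain ⟨hX1, hX2⟩ := mem_psdCone_iff.1 h.mem
  have hs := (posSemidef_iff_symm_and_nonneg.1 hX1).1
  have h3 := hf.three_le
  have out : ∀ w i, (∀ k < m, f k ≠ w) → X i w = 0 := by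
    intro w i hw
    by_contra hne
    refine h1 (h.rank_eq_one_of_col hne (fun a b hab ha hb => ?_))
    have haux : ∀ a, X a w ≠ 0 → a = w := by
      intro a ha
      by_contra haw
      obtain ⟨-, k, hk, e⟩ := hr a w haw ha
      exact hw k hk e
    exact absurd ((haux a ha).trans (haux b hb).symm) hab
  refine ⟨out, ?_⟩
  -- a vanishing edge makes the next column vanish
  have step : ∀ k l p : ℕ, k < m → l < m → p < m →
      (k + 1 = l ∨ (l = 0 ∧ k + 1 = m)) → (l + 1 = p ∨ (p = 0 ∧ l + 1 = m)) →
      X (f k) (f l) = 0 → ∀ i, X i (f l) = 0 := by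
    intro k l p hk hl hp hkl hlp h0 i
    by_contra hne
    refine h1 (h.rank_eq_one_of_col hne (fun a b hab ha hb => ?_))
    obtain ⟨la, hla, rfl, hla'⟩ := hf.eq_of_ne_zero hX2 hr hl ha
    obtain ⟨lb, hlb, rfl, hlb'⟩ := hf.eq_of_ne_zero hX2 hr hl hb
    have hak : la ≠ k := by rintro rfl; exact ha h0
    have hbk : lb ≠ k := by rintro rfl; exact hb h0
    have hlalb : la ≠ lb := by rintro rfl; exact hab rfl
    rw [hf.adj la hla lb hlb]
    omega
  intro k hk h0
  have forward : ∀ n k : ℕ, k + 1 + n < m → X (f k) (f (k + 1)) = 0 →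
      ∀ i, X i (f (k + 1 + n)) = 0 := by
    intro n
    induction n with
    | zero =>
      intro k hk h0
      by_cases hlast : k + 1 + 1 < m
      · exact step k (k + 1) (k + 1 + 1) (by omega) (by omega) hlast (Or.inl rfl) (Or.inl rfl) h0
      · exact step k (k + 1) 0 (by omega) (by omega) (by omega) (Or.inl rfl)
          (Or.inr ⟨rfl, by omega⟩) h0
    | succ n ih =>
      intro k hk h0
      have hc := step k (k + 1) (k + 1 + 1) (by omega) (by omega) (by omega) (Or.inl rfl)
        (Or.inl rfl) h0
      have := ih (k + 1) (by omega) (by rw [hs]; exact hc _)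
      rwa [show k + 1 + (n + 1) = k + 1 + 1 + n by omega]
  have hlast : ∀ i, X i (f (m - 1)) = 0 := by
    have := forward (m - 1 - (k + 1)) k (by omega) h0
    rwa [show k + 1 + (m - 1 - (k + 1)) = m - 1 by omega] at this
  have hzero : ∀ i, X i (f 0) = 0 :=
    step (m - 1) 0 1 (by omega) (by omega) (by omega) (Or.inr ⟨rfl, by omega⟩) (Or.inl rfl)
      (by rw [hs]; exact hlast _)
  have hall : ∀ l < m, ∀ i, X i (f l) = 0 := by
    intro l hl
    by_cases hl0 : l = 0
    · rw [hl0]; exact hzero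
    · have := forward (l - 1) 0 (by omega) (by rw [hs]; exact hzero _)
      rwa [show 0 + 1 + (l - 1) = l by omega] at this
  apply h.1
  ext i w
  by_cases hw : ∃ l < m, f l = w
  · obtain ⟨l, hl, rfl⟩ := hw
    exact hall l hl i
  · push Not at hw
    exact out w i hw

theorem le_rank_of_apply_ne_zero {V : Type*} [Fintype V] {G : SimpleGraph V} {X : Matrix V V ℝ}
    (hX : HasPattern G X) {m : ℕ} {f : ℕ → V} (hf : IsChordlessCycle G m f)
    (h : ∀ k, k + 2 < m → X (f k) (f (k + 1)) ≠ 0) : m - 2 ≤ X.rank := by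
  have h3 := hf.three_le
  set A : Matrix (Fin (m - 2)) (Fin (m - 2)) ℝ :=
    X.submatrix (fun i => f i) (fun j => f (j + 1)) with hA
  have hle := Matrix.rank_submatrix_le X (fun i : Fin (m - 2) => f i)
    (fun j : Fin (m - 2) => f (j + 1))
  have hlow : A.IsLowerTriangular := by
    intro i j hij
    have hij' : (i : ℕ) < j := by simpa using hij
    have hi := i.2
    have hj := j.2
    by_contra hne
    have hne' : f i ≠ f (j + 1) := by
      intro e
      have := hf.inj i (by omega) (j + 1) (by omega) e
      omega
    have := (hf.adj i (by omega) (j + 1) (by omega)).1 (hX _ _ hne' hne)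
    omega
  have hdet : A.det ≠ 0 := by
    rw [Matrix.det_of_isLowerTriangular A hlow]
    exact Finset.prod_ne_zero_iff.2 fun i _ => h i (by have := i.2; omega)
  have := Matrix.rank_of_det_ne_zero hdet
  rw [Fintype.card_fin] at this
  rw [← this]
  exact hle

theorem IsExtremalMatrix.rank_le {V : Type*} [Fintype V] [DecidableEq V] {G : SimpleGraph V}
    {X : Matrix V V ℝ} (h : IsExtremalMatrix G X) (h1 : X.rank ≠ 1) {m : ℕ} {f : ℕ → V}
    (hf : IsChordlessCycle G m f) (hr : OnRange X m f) : X.rank ≤ m - 2 := by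
  obtain ⟨hX1, hX2⟩ := mem_psdCone_iff.1 h.mem
  have hs := (posSemidef_iff_symm_and_nonneg.1 hX1).1
  have h3 := hf.three_le
  have out := (h.apply_ne_zero h1 hf hr).1
  let L : (V → ℝ) →ₗ[ℝ] (Fin (m - 2) → ℝ) := LinearMap.funLeft ℝ ℝ (fun i : Fin (m - 2) => f (i + 2))
  have hinj : Function.Injective (L.comp (LinearMap.range X.mulVecLin).subtype) := by
    rw [← LinearMap.ker_eq_bot, LinearMap.ker_eq_bot']
    rintro ⟨w, u, rfl⟩ hw
    have hw' : ∀ k, 2 ≤ k → k < m → (X *ᵥ u) (f k) = 0 := by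
      intro k hk hkm
      have := congrFun hw ⟨k - 2, by omega⟩
      simpa [L, LinearMap.funLeft_apply, Nat.sub_add_cancel hk] using this
    have hwout : ∀ i, (∀ k < m, f k ≠ i) → (X *ᵥ u) i = 0 := by
      intro i hi
      rw [Matrix.mulVec, dotProduct]
      exact Finset.sum_eq_zero fun j _ => by rw [hs, out i j hi, zero_mul]
    by_contra hne
    refine h1 (h.rank_eq_one u (fun h0 => hne (Subtype.ext h0)) (fun i j hij hi hj => ?_))
    have aux : ∀ i, (X *ᵥ u) i ≠ 0 → i = f 0 ∨ i = f 1 := by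
      intro i hi
      by_contra hcon
      apply hi
      by_cases hi' : ∀ k < m, f k ≠ i
      · exact hwout i hi'
      · push Not at hi'
        obtain ⟨k, hk, rfl⟩ := hi'
        refine hw' k ?_ hk
        by_contra hk2
        have : k = 0 ∨ k = 1 := by omega
        rcases this with rfl | rfl <;> simp at hcon
    have h01 : G.Adj (f 0) (f 1) := (hf.adj 0 (by omega) 1 (by omega)).2 (by omega)
    rcases aux i hi with rfl | rfl <;> rcases aux j hj with rfl | rfl
    · exact absurd rfl hij
    · exact h01
    · exact h01.symm
    · exact absurd rfl hij
  have := LinearMap.finrank_le_finrank_of_injective hinj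
  rwa [Module.finrank_fin_fun] at this

theorem IsExtremalMatrix.rank_mem {V : Type*} [Fintype V] [Nonempty V] {G : SimpleGraph V}
    (hG : SeriesParallel G) {X : Matrix V V ℝ} (h : IsExtremalMatrix G X) :
    X.rank = 1 ∨ ∃ m ∈ chordlessCycleLengths G, X.rank = m - 2 := by
  classical
  by_cases h1 : X.rank = 1
  · exact Or.inl h1
  rcases h.shape hG with ⟨x, y, hxy⟩ | ⟨m, f, hf, hr⟩
  · exact Or.inl (h.rank_eq_one_of_onEdge hxy)
  · refine Or.inr ⟨m, hf.mem_chordlessCycleLengths, le_antisymm (h.rank_le h1 hf hr) ?_⟩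
    exact le_rank_of_apply_ne_zero (mem_psdCone_iff.1 h.mem).2 hf
      (fun k hk => (h.apply_ne_zero h1 hf hr).2 k (by omega))

/-- The linear forms `x_k - x_{k+1} + x_{m-1}` along the cycle `f 0, …, f (m - 1)`. -/
noncomputable def cycleForm {V : Type*} [DecidableEq V] (m : ℕ) (f : ℕ → V) (k : ℕ) : V → ℝ :=
  Pi.single (f k) 1 - Pi.single (f (k + 1)) 1 + Pi.single (f (m - 1)) 1

/-- The Gram matrix of the forms `cycleForm`; it has rank `m - 2` and is extremal. -/
noncomputable def cycleGram {V : Type*} [DecidableEq V] (m : ℕ) (f : ℕ → V) : Matrix V V ℝ :=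
  ∑ k ∈ Finset.range (m - 2), Matrix.vecMulVec (cycleForm m f k) (cycleForm m f k)

theorem cycleGram_apply {V : Type*} [DecidableEq V] (m : ℕ) (f : ℕ → V) (i j : V) :
    cycleGram m f i j = ∑ k ∈ Finset.range (m - 2), cycleForm m f k i * cycleForm m f k j := by
  simp [cycleGram, Matrix.sum_apply, Matrix.vecMulVec_apply]

theorem IsChordlessCycle.cycleForm_apply {V : Type*} [DecidableEq V] {G : SimpleGraph V} {m : ℕ}
    {f : ℕ → V} (hf : IsChordlessCycle G m f) {k : ℕ} (hk : k < m - 2) {i : ℕ} (hi : i < m) :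
    cycleForm m f k (f i) =
      (if i = k then 1 else 0) - (if i = k + 1 then 1 else 0) + (if i = m - 1 then 1 else 0) := by
  have h3 := hf.three_le
  have aux : ∀ j < m, (Pi.single (f j) (1 : ℝ) : V → ℝ) (f i) = if i = j then 1 else 0 := by
    intro j hj
    rw [Pi.single_apply]
    congr 1
    exact propext ⟨fun h => hf.inj i hi j hj h, fun h => by rw [h]⟩
  simp only [cycleForm, Pi.add_apply, Pi.sub_apply]
  rw [aux k (by omega), aux (k + 1) (by omega), aux (m - 1) (by omega)]

theorem cycleForm_apply_eq_zero {V : Type*} [DecidableEq V] {m : ℕ} {f : ℕ → V} {k : ℕ}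
    (hk : k < m - 2) {w : V} (hw : ∀ i < m, f i ≠ w) : cycleForm m f k w = 0 := by
  simp only [cycleForm, Pi.add_apply, Pi.sub_apply]
  rw [Pi.single_eq_of_ne (hw k (by omega)).symm, Pi.single_eq_of_ne (hw (k + 1) (by omega)).symm,
    Pi.single_eq_of_ne (hw (m - 1) (by omega)).symm]
  ring

theorem IsChordlessCycle.cycleGram_mem {V : Type*} [Fintype V] [DecidableEq V]
    {G : SimpleGraph V} {m : ℕ} {f : ℕ → V} (hf : IsChordlessCycle G m f) :
    cycleGram m f ∈ psdCone G := by
  have h3 := hf.three_le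
  rw [mem_psdCone_iff]
  refine ⟨Matrix.posSemidef_sum _ fun k _ => by
    simpa using Matrix.posSemidef_vecMulVec_self_star (cycleForm m f k), fun i j hij h => ?_⟩
  rw [cycleGram_apply] at h
  have hin : ∀ i j, ∑ k ∈ Finset.range (m - 2), cycleForm m f k i * cycleForm m f k j ≠ 0 →
      ∃ a < m, f a = i := by
    intro i j h
    by_contra hcon
    push Not at hcon
    exact h (Finset.sum_eq_zero fun k hk => by
      rw [cycleForm_apply_eq_zero (Finset.mem_range.1 hk) hcon, zero_mul])
  obtain ⟨a, ha, rfl⟩ := hin i j h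
  obtain ⟨b, hb, rfl⟩ := hin j (f a) (by simpa only [mul_comm] using h)
  rw [hf.adj a ha b hb]
  have hab : a ≠ b := by rintro rfl; exact hij rfl
  by_contra hadj
  have last : ∀ b < m, b ≠ m - 1 → b ≠ 0 → b + 1 ≠ m - 1 →
      ∑ k ∈ Finset.range (m - 2), cycleForm m f k (f (m - 1)) * cycleForm m f k (f b) = 0 := by
    intro b hb h1 h2 h3'
    have : ∀ k ∈ Finset.range (m - 2), cycleForm m f k (f (m - 1)) * cycleForm m f k (f b) =
        (if b = k then (1 : ℝ) else 0) - (if b - 1 = k then 1 else 0) := by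
      intro k hk
      have hk' := Finset.mem_range.1 hk
      rw [hf.cycleForm_apply hk' hb, hf.cycleForm_apply hk' (by omega),
        if_neg (show ¬ m - 1 = k by omega), if_neg (show ¬ m - 1 = k + 1 by omega), if_pos rfl,
        if_neg h1]
      have hiff : b = k + 1 ↔ b - 1 = k := by omega
      simp only [hiff]
      ring
    rw [Finset.sum_congr rfl this, Finset.sum_sub_distrib, Finset.sum_ite_eq, Finset.sum_ite_eq,
      if_pos (Finset.mem_range.2 (by omega)), if_pos (Finset.mem_range.2 (by omega)), sub_self]
  apply h
  by_cases ham : a = m - 1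
  · subst ham
    exact last b hb (by omega) (by omega) (by omega)
  by_cases hbm : b = m - 1
  · subst hbm
    simp only [mul_comm (cycleForm m f _ (f a))]
    exact last a ha (by omega) (by omega) (by omega)
  · refine Finset.sum_eq_zero fun k hk => ?_
    have hk' := Finset.mem_range.1 hk
    rw [hf.cycleForm_apply hk' ha, hf.cycleForm_apply hk' hb]
    split_ifs <;> first | omega | simp

theorem IsChordlessCycle.cycleGram_apply_succ {V : Type*} [DecidableEq V]
    {G : SimpleGraph V} {m : ℕ} {f : ℕ → V} (hf : IsChordlessCycle G m f) {i : ℕ}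
    (hi : i + 2 < m) : cycleGram m f (f i) (f (i + 1)) = -1 := by
  rw [cycleGram_apply, Finset.sum_eq_single i]
  · rw [hf.cycleForm_apply (by omega) (by omega), hf.cycleForm_apply (by omega) (by omega)]
    have : ¬ i + 1 = m - 1 := by omega
    have : ¬ i = m - 1 := by omega
    simp [*]
  · intro k hk hki
    have hk' := Finset.mem_range.1 hk
    rw [hf.cycleForm_apply hk' (by omega), hf.cycleForm_apply hk' (by omega)]
    split_ifs <;> first | omega | simp
  · intro h
    exact absurd (Finset.mem_range.2 (by omega)) h

theorem IsChordlessCycle.cycleGram_apply_zero {V : Type*} [DecidableEq V]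
    {G : SimpleGraph V} {m : ℕ} {f : ℕ → V} (hf : IsChordlessCycle G m f) :
    cycleGram m f (f 0) (f 0) = 1 := by
  have h3 := hf.three_le
  rw [cycleGram_apply, Finset.sum_eq_single 0]
  · rw [hf.cycleForm_apply (by omega) (by omega)]
    have : ¬ 0 = m - 1 := by omega
    simp [*]
  · intro k hk hki
    have hk' := Finset.mem_range.1 hk
    rw [hf.cycleForm_apply hk' (by omega), if_neg hki.symm, if_neg (by omega), if_neg (by omega)]
    ring
  · intro h
    exact absurd (Finset.mem_range.2 (by omega)) h

/-- A matrix dominated by the Gram matrix of the cycle satisfies the linear relations between the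
columns of the latter. -/
theorem sum_mul_apply_eq_zero {V : Type*} [Fintype V] [DecidableEq V] {G : SimpleGraph V} {m : ℕ}
    {f : ℕ → V} (hf : IsChordlessCycle G m f) {A B : Matrix V V ℝ} (hA : A.PosSemidef)
    (hB : B.PosSemidef) {s : ℝ} (hs : s • cycleGram m f = A + B) {c : ℕ → ℝ}
    (hc : ∀ k < m - 2, c k - c (k + 1) + c (m - 1) = 0) (v : V) :
    ∑ i ∈ Finset.range m, c i * A v (f i) = 0 := by
  set x : V → ℝ := ∑ i ∈ Finset.range m, c i • Pi.single (f i) 1 with hx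
  have happ : ∀ (M : Matrix V V ℝ), (M *ᵥ x) v = ∑ i ∈ Finset.range m, c i * M v (f i) := by
    intro M
    rw [hx, Matrix.mulVec_sum, Finset.sum_apply]
    refine Finset.sum_congr rfl fun i _ => ?_
    rw [Matrix.mulVec_smul, Pi.smul_apply, mulVec_single_one_apply, smul_eq_mul]
  rw [← happ]
  have hform : ∀ k < m - 2, cycleForm m f k ⬝ᵥ x = 0 := by
    intro k hk
    rw [hx, dotProduct_sum, ← hc k hk]
    have : ∀ i ∈ Finset.range m, cycleForm m f k ⬝ᵥ c i • Pi.single (f i) 1 =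
        (if i = k then c i else 0) - (if i = k + 1 then c i else 0) +
          (if i = m - 1 then c i else 0) := by
      intro i hi
      rw [dotProduct_smul, dotProduct_single, mul_one,
        hf.cycleForm_apply hk (Finset.mem_range.1 hi), smul_eq_mul]
      split_ifs <;> ring
    rw [Finset.sum_congr rfl this, Finset.sum_add_distrib, Finset.sum_sub_distrib,
      Finset.sum_ite_eq', Finset.sum_ite_eq', Finset.sum_ite_eq',
      if_pos (Finset.mem_range.2 (by omega)), if_pos (Finset.mem_range.2 (by omega)),
      if_pos (Finset.mem_range.2 (by omega))]
  have hX : x ⬝ᵥ cycleGram m f *ᵥ x = 0 := by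
    rw [cycleGram, Matrix.sum_mulVec, dotProduct_sum]
    refine Finset.sum_eq_zero fun k hk => ?_
    rw [dotProduct_vecMulVec_mulVec, hform k (Finset.mem_range.1 hk)]
    simp
  have hsum : x ⬝ᵥ A *ᵥ x + x ⬝ᵥ B *ᵥ x = 0 := by
    rw [← dotProduct_add, ← Matrix.add_mulVec, ← hs, Matrix.smul_mulVec, dotProduct_smul, hX,
      smul_zero]
  have h1 := (posSemidef_iff_symm_and_nonneg.1 hA).2 x
  have h2 := (posSemidef_iff_symm_and_nonneg.1 hB).2 x
  rw [hA.mulVec_eq_zero (by linarith)]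
  rfl

theorem IsChordlessCycle.isExtremalMatrix_cycleGram {V : Type*} [Fintype V] [DecidableEq V]
    {G : SimpleGraph V} {m : ℕ} {f : ℕ → V} (hf : IsChordlessCycle G m f) (h4 : 4 ≤ m) :
    IsExtremalMatrix G (cycleGram m f) := by
  have hX := mem_psdCone_iff.1 hf.cycleGram_mem
  have hXs := (posSemidef_iff_symm_and_nonneg.1 hX.1).1
  refine isExtremalMatrix_of_forall ?_ hf.cycleGram_mem ?_
  · intro h0
    have := hf.cycleGram_apply_zero
    rw [h0] at this
    simp at this
  intro A hA B hB s hs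
  rw [mem_psdCone_iff] at hA hB
  have hAs := (posSemidef_iff_symm_and_nonneg.1 hA.1).1
  set t := A (f 0) (f 0) with ht
  refine ⟨t, hA.1.diag_nonneg, ?_⟩
  set D := A - t • cycleGram m f with hD
  have hDs : ∀ i j, D i j = D j i := by
    intro i j
    rw [hD, Matrix.sub_apply, Matrix.sub_apply, Matrix.smul_apply, Matrix.smul_apply, hAs, hXs]
  have hDpat : HasPattern G D := by
    rw [hD, sub_eq_add_neg, ← neg_smul]
    exact hA.2.add (hX.2.smul _)
  have hDout : ∀ w i, (∀ k < m, f k ≠ w) → D i w = 0 := by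
    intro w i hw
    have hXw : ∀ i, cycleGram m f i w = 0 := by
      intro i
      rw [cycleGram_apply]
      exact Finset.sum_eq_zero fun k hk => by
        rw [cycleForm_apply_eq_zero (Finset.mem_range.1 hk) hw, mul_zero]
    have hsum := congrFun (congrFun hs w) w
    rw [Matrix.smul_apply, hXw, smul_zero, Matrix.add_apply] at hsum
    have hAw : A w w = 0 := by
      have := hA.1.diag_nonneg (i := w)
      have := hB.1.diag_nonneg (i := w)
      linarith
    rw [hD, Matrix.sub_apply, Matrix.smul_apply, hXw, hA.1.apply_eq_zero hAw, smul_zero, sub_zero]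
  have hrel : ∀ c : ℕ → ℝ, (∀ k < m - 2, c k - c (k + 1) + c (m - 1) = 0) → ∀ v,
      ∑ i ∈ Finset.range m, c i * D v (f i) = 0 := by
    intro c hc v
    have h1 := sum_mul_apply_eq_zero hf hA.1 hB.1 hs hc v
    have h2 := sum_mul_apply_eq_zero hf hX.1 Matrix.PosSemidef.zero (s := 1)
      (by rw [one_smul, add_zero]) hc v
    simp only [hD, Matrix.sub_apply, Matrix.smul_apply, smul_eq_mul, mul_sub,
      Finset.sum_sub_distrib, h1, zero_sub, neg_eq_zero]
    rw [← mul_zero t, ← h2, Finset.mul_sum]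
    exact Finset.sum_congr rfl fun i _ => by ring
  -- the two linear relations determine two entries of a row
  set c1 : ℕ → ℝ := fun i => if i = m - 1 then 0 else 1 with hc1
  set c2 : ℕ → ℝ := fun i => if i = m - 1 then 1 else i with hc2
  have two : ∀ v, ∀ p < m, ∀ q < m, p ≠ q → (∀ i < m, i ≠ p → i ≠ q → D v (f i) = 0) →
      c1 p * c2 q - c1 q * c2 p ≠ 0 → D v (f p) = 0 ∧ D v (f q) = 0 := by
    intro v p hp q hq hpq h0 hdet
    have expand : ∀ c : ℕ → ℝ, ∑ i ∈ Finset.range m, c i * D v (f i) =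
        c p * D v (f p) + c q * D v (f q) := by
      intro c
      refine Finset.sum_eq_add p q hpq ?_ ?_ ?_
      · intro i hi hne
        rw [h0 i (Finset.mem_range.1 hi) hne.1 hne.2, mul_zero]
      · exact fun h => absurd (Finset.mem_range.2 hp) h
      · exact fun h => absurd (Finset.mem_range.2 hq) h
    have e1 := hrel c1 (by
      intro k hk
      simp only [hc1]
      rw [if_neg (by omega), if_neg (by omega), if_pos trivial]
      ring) v
    have e2 := hrel c2 (by
      intro k hk
      simp only [hc2]
      rw [if_neg (by omega), if_neg (by omega), if_pos trivial]
      push_cast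
      ring) v
    rw [expand] at e1 e2
    constructor
    · refine (mul_eq_zero.1 (?_ : (c1 p * c2 q - c1 q * c2 p) * D v (f p) = 0)).resolve_left hdet
      linear_combination c2 q * e1 - c1 q * e2
    · refine (mul_eq_zero.1 (?_ : (c1 p * c2 q - c1 q * c2 p) * D v (f q) = 0)).resolve_left hdet
      linear_combination c1 p * e2 - c2 p * e1
  have hD00 : D (f 0) (f 0) = 0 := by
    rw [hD, Matrix.sub_apply, Matrix.smul_apply, hf.cycleGram_apply_zero, smul_eq_mul, mul_one, ht,
      sub_self]
  have nonadj : ∀ l < m, ∀ i < m, l ≠ i →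
      ¬ (l + 1 = i ∨ i + 1 = l ∨ (l = 0 ∧ i + 1 = m) ∨ (i = 0 ∧ l + 1 = m)) →
      D (f l) (f i) = 0 := by
    intro l hl i hi hli hn
    by_contra hne
    exact hn ((hf.adj l hl i hi).1 (hDpat _ _ (fun h => hli (hf.inj l hl i hi h)) hne))
  have rows : ∀ l < m, ∀ i < m, D (f l) (f i) = 0 := by
    intro l
    induction l using Nat.strong_induction_on with
    | _ l ih =>
    intro hl
    have low : ∀ i < l, D (f l) (f i) = 0 := fun i hi => by
      rw [hDs]; exact ih i hi (by omega) l hl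
    obtain ⟨p, q, hp, hq, hpq, h0, hdet⟩ : ∃ p q, p < m ∧ q < m ∧ p ≠ q ∧
        (∀ i < m, i ≠ p → i ≠ q → D (f l) (f i) = 0) ∧ c1 p * c2 q - c1 q * c2 p ≠ 0 := by
      by_cases hl0 : l = 0
      · refine ⟨1, m - 1, by omega, by omega, by omega, fun i hi h1 h2 => ?_, ?_⟩
        · by_cases hi0 : i = 0
          · rw [hl0, hi0]; exact hD00
          · exact nonadj l hl i hi (by omega) (by omega)
        · have : ¬ 1 = m - 1 := by omega
          simp [hc1, hc2, this]
      by_cases hlm : l = m - 1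
      · refine ⟨m - 1, 0, by omega, by omega, by omega, fun i hi h1 h2 => low i (by omega), ?_⟩
        have : ¬ 0 = m - 1 := by omega
        simp [hc1, hc2, this]
      · refine ⟨l, l + 1, by omega, by omega, by omega, fun i hi h1 h2 => ?_, ?_⟩
        · by_cases hil : i < l
          · exact low i hil
          · exact nonadj l hl i hi (by omega) (by omega)
        · by_cases hl1 : l + 1 = m - 1
          · simp [hc1, hc2, hl1, hlm]
          · simp [hc1, hc2, hl1, hlm]
    intro i hi
    obtain ⟨z1, z2⟩ := two (f l) p hp q hq hpq h0 hdet
    by_cases hip : i = p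
    · rw [hip]; exact z1
    by_cases hiq : i = q
    · rw [hiq]; exact z2
    · exact h0 i hi hip hiq
  have hD0 : D = 0 := by
    ext u w
    by_cases hw : ∃ k < m, f k = w
    · obtain ⟨k, hk, rfl⟩ := hw
      by_cases hu : ∃ l < m, f l = u
      · obtain ⟨l, hl, rfl⟩ := hu
        exact rows l hl k hk
      · push Not at hu
        rw [hDs]
        exact hDout u _ hu
    · push Not at hw
      exact hDout w u hw
  rw [hD] at hD0
  exact sub_eq_zero.1 hD0

theorem one_mem_extremalRanks {V : Type*} [Fintype V] [Nonempty V] (G : SimpleGraph V) :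
    1 ∈ extremalRanks G := by
  classical
  let v := Classical.arbitrary V
  set w : V → ℝ := Pi.single v 1 with hw
  have hwv : ∀ i, i ≠ v → w i = 0 := fun i hi => Pi.single_eq_of_ne hi _
  have hwv' : w v = 1 := Pi.single_eq_same _ _
  have hX : Matrix.vecMulVec w w ∈ psdCone G := vecMulVec_self_mem_psdCone (by
    intro i j hij hi hj
    have h1 : i = v := by by_contra h; exact hi (hwv i h)
    have h2 : j = v := by by_contra h; exact hj (hwv j h)
    exact absurd (h1.trans h2.symm) hij)
  have hne : Matrix.vecMulVec w w ≠ 0 := by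
    intro h
    have := congrFun (congrFun h v) v
    simp [Matrix.vecMulVec_apply, hwv'] at this
  have hext : IsExtremalMatrix G (Matrix.vecMulVec w w) := by
    refine isExtremalMatrix_of_forall hne hX ?_
    intro A hA B hB s hs
    rw [mem_psdCone_iff] at hA hB
    have hcol : ∀ u, u ≠ v → ∀ i, A i u = 0 := by
      intro u hu i
      have hsum := congrFun (congrFun hs u) u
      rw [Matrix.smul_apply, Matrix.vecMulVec_apply, hwv u hu, mul_zero, smul_zero,
        Matrix.add_apply] at hsum
      have := hA.1.diag_nonneg (i := u)
      have := hB.1.diag_nonneg (i := u)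
      exact hA.1.apply_eq_zero (by linarith) i
    refine ⟨A v v, hA.1.diag_nonneg, ?_⟩
    ext i j
    rw [Matrix.smul_apply, Matrix.vecMulVec_apply, smul_eq_mul]
    by_cases hj : j = v
    · by_cases hi : i = v
      · rw [hi, hj, hwv', one_mul, mul_one]
      · rw [(posSemidef_iff_symm_and_nonneg.1 hA.1).1, hcol i hi, hwv i hi, zero_mul, mul_zero]
    · rw [hcol j hj, hwv j hj, mul_zero, mul_zero]
  refine ⟨_, hext, hext.rank_eq_one_of_col (v := v) (i := v) ?_ ?_⟩
  · simp [Matrix.vecMulVec_apply, hwv']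
  · intro i j hij hi hj
    rw [Matrix.vecMulVec_apply] at hi hj
    have h1 : i = v := by by_contra h; exact hi (by rw [hwv i h, zero_mul])
    have h2 : j = v := by by_contra h; exact hj (by rw [hwv j h, zero_mul])
    exact absurd (h1.trans h2.symm) hij

theorem sub_two_mem_extremalRanks {V : Type*} [Fintype V] [Nonempty V] {G : SimpleGraph V} {m : ℕ}
    (hm : m ∈ chordlessCycleLengths G) : m - 2 ∈ extremalRanks G := by
  classical
  obtain ⟨f, hf⟩ := exists_isChordlessCycle hm
  rcases hf.three_le.eq_or_lt with h3 | h4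
  · rw [← h3]; exact one_mem_extremalRanks G
  have hext := hf.isExtremalMatrix_cycleGram h4
  have hX := mem_psdCone_iff.1 hext.mem
  have hge := le_rank_of_apply_ne_zero hX.2 hf (fun k hk => by
    rw [hf.cycleGram_apply_succ hk]; norm_num)
  refine ⟨_, hext, le_antisymm (hext.rank_le (by omega) hf ?_) hge⟩
  have hin : ∀ i j, cycleGram m f i j ≠ 0 → ∃ a < m, f a = i := by
    intro i j h
    by_contra hcon
    push Not at hcon
    apply h
    rw [cycleGram_apply]
    exact Finset.sum_eq_zero fun k hk => by
      rw [cycleForm_apply_eq_zero (Finset.mem_range.1 hk) hcon, zero_mul]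
  intro i j _ h
  exact ⟨hin i j h, hin j i (by
    rwa [(posSemidef_iff_symm_and_nonneg.1 hX.1).1])⟩

theorem SeriesParallel.extremalRanks_eq {V : Type*} [Fintype V] [Nonempty V] {G : SimpleGraph V}
    (hG : SeriesParallel G) :
    extremalRanks G = {1} ∪ {r | ∃ m ∈ chordlessCycleLengths G, r = m - 2} := by
  ext r
  constructor
  · rintro ⟨X, hX, rfl⟩
    exact hX.rank_mem hG
  · rintro (rfl | ⟨m, hm, rfl⟩)
    · exact one_mem_extremalRanks G
    · exact sub_two_mem_extremalRanks hm

/-- A vector with entries `±1`. -/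
def IsSpin {V : Type*} (s : V → ℝ) : Prop := ∀ i, s i = 1 ∨ s i = -1

theorem IsSpin.mul_self {V : Type*} {s : V → ℝ} (h : IsSpin s) (i : V) : s i * s i = 1 := by
  rcases h i with h | h <;> rw [h] <;> norm_num

theorem IsSpin.update {V : Type*} [DecidableEq V] {s : V → ℝ} (h : IsSpin s) (v : V) {ε : ℝ}
    (hε : ε = 1 ∨ ε = -1) : IsSpin (Function.update s v ε) := by
  intro i
  by_cases hi : i = v
  · subst hi; simpa using hε
  · simpa [hi] using h i

theorem exists_sign (α : ℝ) : ∃ σ : ℝ, (σ = 1 ∨ σ = -1) ∧ |α| * σ = α := by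
  rcases le_total 0 α with h | h
  · exact ⟨1, Or.inl rfl, by rw [abs_of_nonneg h, mul_one]⟩
  · exact ⟨-1, Or.inr rfl, by rw [abs_of_nonpos h]; ring⟩

/-- The symmetric matrices whose quadratic form is nonnegative on all `±1` vectors. -/
def spinCone (V : Type*) [Fintype V] : Set (Matrix V V ℝ) :=
  {X | (∀ i j, X i j = X j i) ∧ ∀ s : V → ℝ, IsSpin s → 0 ≤ s ⬝ᵥ X *ᵥ s}

theorem dotProduct_mulVec_eq_sum {V : Type*} [Fintype V] (X : Matrix V V ℝ) (s : V → ℝ) :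
    s ⬝ᵥ X *ᵥ s = ∑ i, ∑ j, X i j * (s i * s j) := by
  simp only [dotProduct, Matrix.mulVec, Finset.mul_sum]
  exact Finset.sum_congr rfl fun i _ => Finset.sum_congr rfl fun j _ => by ring

theorem sub_mem_spinCone {V : Type*} [Fintype V] [DecidableEq V] {X g : Matrix V V ℝ}
    (hX : X ∈ spinCone V) (hg : ∀ i j, g i j = g j i) {v : V}
    (hrow : ∀ w, w ≠ v → g v w = X v w)
    (hzero : ∀ s : V → ℝ, IsSpin s → ∃ ε : ℝ, (ε = 1 ∨ ε = -1) ∧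
      Function.update s v ε ⬝ᵥ g *ᵥ Function.update s v ε = 0) : X - g ∈ spinCone V := by
  refine ⟨fun i j => by rw [Matrix.sub_apply, Matrix.sub_apply, hX.1, hg], fun s hs => ?_⟩
  obtain ⟨ε, hε, h0⟩ := hzero s hs
  have hs' := hs.update v hε
  have : s ⬝ᵥ (X - g) *ᵥ s =
      Function.update s v ε ⬝ᵥ (X - g) *ᵥ Function.update s v ε := by
    rw [dotProduct_mulVec_eq_sum, dotProduct_mulVec_eq_sum]
    refine Finset.sum_congr rfl fun i _ => Finset.sum_congr rfl fun j _ => ?_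
    by_cases hi : i = v
    · by_cases hj : j = v
      · rw [hi, hj, hs.mul_self, hs'.mul_self]
      · rw [hi, Matrix.sub_apply, hrow j hj, sub_self, zero_mul, zero_mul]
    · by_cases hj : j = v
      · rw [hj, Matrix.sub_apply, hX.1, hg, hrow i hi, sub_self, zero_mul, zero_mul]
      · rw [Function.update_of_ne hi, Function.update_of_ne hj]
  rw [this, Matrix.sub_mulVec, dotProduct_sub, h0, sub_zero]
  exact hX.2 _ hs'

theorem spinCone_elim_one {V : Type*} [Fintype V] [DecidableEq V] {X : Matrix V V ℝ}
    (hX : X ∈ spinCone V) {v c : V} (hvc : v ≠ c) (h : ∀ w, w ≠ v → X v w ≠ 0 → w = c) :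
    ∃ g ∈ spinCone V, X - g ∈ spinCone V ∧ (∀ w, w ≠ v → g v w = X v w) ∧
      ∀ i j, i ≠ j → g i j ≠ 0 → (i = v ∧ j = c) ∨ (i = c ∧ j = v) := by
  obtain ⟨σ, hσ, hσα⟩ := exists_sign (X v c)
  set p : V → ℝ := Pi.single v 1 + σ • Pi.single c 1 with hp
  have hpv : p v = 1 := by simp [hp, hvc]
  have hpc : p c = σ := by simp [hp, hvc.symm]
  have hpo : ∀ i, i ≠ v → i ≠ c → p i = 0 := fun i h1 h2 => by simp [hp, h1, h2]
  have hpdot : ∀ s : V → ℝ, p ⬝ᵥ s = s v + σ * s c := by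
    intro s
    rw [hp, add_dotProduct, smul_dotProduct, single_dotProduct, single_dotProduct, smul_eq_mul]
    ring
  set g : Matrix V V ℝ := |X v c| • Matrix.vecMulVec p p with hg
  have hgij : ∀ i j, g i j = |X v c| * (p i * p j) := fun i j => by
    rw [hg, Matrix.smul_apply, Matrix.vecMulVec_apply, smul_eq_mul]
  have hquad : ∀ s : V → ℝ, s ⬝ᵥ g *ᵥ s = |X v c| * (s v + σ * s c) ^ 2 := by
    intro s
    rw [hg, Matrix.smul_mulVec, dotProduct_smul, dotProduct_vecMulVec_mulVec, hpdot, smul_eq_mul]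
  have hsymm : ∀ i j, g i j = g j i := fun i j => by rw [hgij, hgij, mul_comm (p i)]
  have hrow : ∀ w, w ≠ v → g v w = X v w := by
    intro w hw
    rw [hgij, hpv, one_mul]
    by_cases hwc : w = c
    · rw [hwc, hpc, hσα]
    · rw [hpo w hw hwc, mul_zero]
      by_contra hne
      exact hwc (h w hw (Ne.symm hne))
  refine ⟨g, ⟨hsymm, fun s _ => ?_⟩, sub_mem_spinCone hX hsymm hrow fun s hs => ?_, hrow, ?_⟩
  · rw [hquad]; positivity
  · refine ⟨-(σ * s c), ?_, ?_⟩
    · rcases hσ with h1 | h1 <;> rcases hs c with h2 | h2 <;> rw [h1, h2] <;> norm_num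
    · rw [hquad, Function.update_self, Function.update_of_ne hvc.symm]
      ring
  · intro i j hij hne
    rw [hgij] at hne
    have h1 : i = v ∨ i = c := by
      by_contra hcon
      push Not at hcon
      exact hne (by rw [hpo i hcon.1 hcon.2]; ring)
    have h2 : j = v ∨ j = c := by
      by_contra hcon
      push Not at hcon
      exact hne (by rw [hpo j hcon.1 hcon.2]; ring)
    grind

theorem spinCone_elim_two_of_le {V : Type*} [Fintype V] [DecidableEq V] {X : Matrix V V ℝ}
    (hX : X ∈ spinCone V) {v a b : V} (hva : v ≠ a) (hvb : v ≠ b) (hab : a ≠ b)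
    (hb : X v b ≠ 0) (hle : |X v b| ≤ |X v a|)
    (h : ∀ w, w ≠ v → X v w ≠ 0 → w = a ∨ w = b) :
    ∃ g ∈ spinCone V, X - g ∈ spinCone V ∧ (∀ w, w ≠ v → g v w = X v w) ∧
      (∀ i j, i ≠ j → g i j ≠ 0 → (i = v ∨ i = a ∨ i = b) ∧ (j = v ∨ j = a ∨ j = b)) ∧
      g a b ≠ 0 := by
  obtain ⟨σ, hσ, hσα⟩ := exists_sign (X v a)
  obtain ⟨τ, hτ, hτβ⟩ := exists_sign (X v b)
  set p : V → ℝ := Pi.single v 1 + σ • Pi.single a 1 with hp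
  set q : V → ℝ := p + τ • Pi.single b 1 with hq
  set e : V → ℝ := Pi.single v 1 with he
  have hpv : p v = 1 := by simp [hp, he, hva]
  have hpa : p a = σ := by simp [hp, he, hva.symm]
  have hpo : ∀ i, i ≠ v → i ≠ a → p i = 0 := fun i h1 h2 => by simp [hp, he, h1, h2]
  have hqv : q v = 1 := by simp [hq, hpv, hvb]
  have hqa : q a = σ := by simp [hq, hpa, hab]
  have hqb : q b = τ := by simp [hq, hpo b hvb.symm hab.symm]
  have hqo : ∀ i, i ≠ v → i ≠ a → i ≠ b → q i = 0 := fun i h1 h2 h3 => by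
    simp [hq, hpo i h1 h2, h3]
  have heo : ∀ i, i ≠ v → e i = 0 := fun i h1 => by simp [he, h1]
  have hpdot : ∀ s : V → ℝ, p ⬝ᵥ s = s v + σ * s a := by
    intro s
    rw [hp, add_dotProduct, smul_dotProduct, single_dotProduct, single_dotProduct, smul_eq_mul]
    ring
  have hqdot : ∀ s : V → ℝ, q ⬝ᵥ s = s v + σ * s a + τ * s b := by
    intro s
    rw [hq, add_dotProduct, hpdot, smul_dotProduct, single_dotProduct, smul_eq_mul]
    ring
  have hedot : ∀ s : V → ℝ, e ⬝ᵥ s = s v := by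
    intro s
    rw [he, single_dotProduct, one_mul]
  set g : Matrix V V ℝ := |X v b| • (Matrix.vecMulVec q q - Matrix.vecMulVec e e) +
    (|X v a| - |X v b|) • Matrix.vecMulVec p p with hg
  have hgij : ∀ i j, g i j = |X v b| * (q i * q j - e i * e j) +
      (|X v a| - |X v b|) * (p i * p j) := fun i j => by
    simp [hg, Matrix.vecMulVec_apply]
  have hquad : ∀ s : V → ℝ, s ⬝ᵥ g *ᵥ s = |X v b| * ((s v + σ * s a + τ * s b) ^ 2 - s v ^ 2) +
      (|X v a| - |X v b|) * (s v + σ * s a) ^ 2 := by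
    intro s
    rw [hg, Matrix.add_mulVec, Matrix.smul_mulVec, Matrix.smul_mulVec, Matrix.sub_mulVec,
      dotProduct_add, dotProduct_smul, dotProduct_smul, dotProduct_sub,
      dotProduct_vecMulVec_mulVec, dotProduct_vecMulVec_mulVec, dotProduct_vecMulVec_mulVec,
      hpdot, hqdot, hedot, smul_eq_mul, smul_eq_mul]
  have hsymm : ∀ i j, g i j = g j i := fun i j => by rw [hgij, hgij]; ring
  have hrow : ∀ w, w ≠ v → g v w = X v w := by
    intro w hw
    rw [hgij, hpv, hqv, heo w hw]
    by_cases hwa : w = a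
    · rw [hwa, hqa, hpa]
      linear_combination hσα
    by_cases hwb : w = b
    · rw [hwb, hqb, hpo b hvb.symm hab.symm]
      linear_combination hτβ
    · rw [hpo w hw hwa, hqo w hw hwa hwb]
      have : X v w = 0 := by
        by_contra hne
        rcases h w hw hne with h1 | h1
        · exact hwa h1
        · exact hwb h1
      rw [this]; ring
  refine ⟨g, ⟨hsymm, fun s hs => ?_⟩, sub_mem_spinCone hX hsymm hrow fun s hs => ?_, hrow, ?_, ?_⟩
  · rw [hquad]
    have h1 : 0 ≤ (s v + σ * s a + τ * s b) ^ 2 - s v ^ 2 := by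
      rcases hσ with h1 | h1 <;> rcases hτ with h2 | h2 <;> rcases hs v with h3 | h3 <;>
        rcases hs a with h4 | h4 <;> rcases hs b with h5 | h5 <;> rw [h1, h2, h3, h4, h5] <;>
        norm_num
    have h2 : 0 ≤ |X v a| - |X v b| := sub_nonneg.2 hle
    positivity
  · refine ⟨-(σ * s a), ?_, ?_⟩
    · rcases hσ with h1 | h1 <;> rcases hs a with h2 | h2 <;> rw [h1, h2] <;> norm_num
    · rw [hquad, Function.update_self, Function.update_of_ne hva.symm,
        Function.update_of_ne hvb.symm]
      have h1 : (τ * s b) ^ 2 = 1 := by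
        rcases hτ with h1 | h1 <;> rcases hs b with h2 | h2 <;> rw [h1, h2] <;> norm_num
      have h2 : (-(σ * s a)) ^ 2 = 1 := by
        rcases hσ with h1 | h1 <;> rcases hs a with h2 | h2 <;> rw [h1, h2] <;> norm_num
      rw [h2, show -(σ * s a) + σ * s a + τ * s b = τ * s b by ring, h1]
      ring
  · intro i j hij hne
    rw [hgij] at hne
    constructor
    · by_contra hcon
      push Not at hcon
      exact hne (by
        rw [hpo i hcon.1 hcon.2.1, hqo i hcon.1 hcon.2.1 hcon.2.2, heo i hcon.1]; ring)
    · by_contra hcon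
      push Not at hcon
      exact hne (by
        rw [hpo j hcon.1 hcon.2.1, hqo j hcon.1 hcon.2.1 hcon.2.2, heo j hcon.1]; ring)
  · rw [hgij, hqa, hqb, hpo b hvb.symm hab.symm, heo a hva.symm]
    have h0 : |X v b| ≠ 0 := abs_ne_zero.2 hb
    rcases hσ with h1 | h1 <;> rcases hτ with h2 | h2 <;> rw [h1, h2] <;> simpa using hb

theorem isEliminationCone_spinCone {V : Type*} [Fintype V] [DecidableEq V] :
    IsEliminationCone (spinCone V) := by
  refine ⟨fun X h => h.1, ?_, ?_, ?_, ?_⟩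
  · intro X hX Y hY
    refine ⟨fun i j => by rw [Matrix.add_apply, Matrix.add_apply, hX.1, hY.1], fun s hs => ?_⟩
    rw [Matrix.add_mulVec, dotProduct_add]
    exact add_nonneg (hX.2 s hs) (hY.2 s hs)
  · intro X hX t ht
    refine ⟨fun i j => by rw [Matrix.smul_apply, Matrix.smul_apply, hX.1], fun s hs => ?_⟩
    rw [Matrix.smul_mulVec, dotProduct_smul]
    exact mul_nonneg ht (hX.2 s hs)
  · exact fun X hX v c hvc h => spinCone_elim_one hX hvc h
  · intro X hX v a b hva hvb hab ha hb h
    rcases le_total |X v b| |X v a| with hle | hle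
    · exact spinCone_elim_two_of_le hX hva hvb hab hb hle h
    · obtain ⟨g, h1, h2, h3, h4, h5⟩ := spinCone_elim_two_of_le hX hvb hva hab.symm ha hle
        (fun w hw hne => (h w hw hne).symm)
      refine ⟨g, h1, h2, h3, fun i j hij hne => ?_, by rw [h1.1]; exact h5⟩
      have := h4 i j hij hne
      tauto

/-! ### Facets of full-dimensional polytopes -/

theorem mem_dualAnnihilator_vectorSpan_iff {E : Type*} [AddCommGroup E] [Module ℝ E] {F : Set E}
    (φ : Module.Dual ℝ E) :
    φ ∈ (vectorSpan ℝ F).dualAnnihilator ↔ ∀ x ∈ F, ∀ y ∈ F, φ x = φ y := by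
  rw [Submodule.mem_dualAnnihilator]
  constructor
  · intro h x hx y hy
    have := h (x - y) (vsub_mem_vectorSpan ℝ hx hy)
    rw [map_sub] at this
    exact sub_eq_zero.1 this
  · intro h w hw
    refine Submodule.span_induction (p := fun w _ => φ w = 0) ?_ (map_zero _) ?_ ?_ hw
    · rintro _ ⟨x, hx, y, hy, rfl⟩
      change φ (x - y) = 0
      rw [map_sub, h x hx y hy, sub_self]
    · intro x y _ _ hx hy
      rw [map_add, hx, hy, add_zero]
    · intro t x _ hx
      rw [map_smul, hx, smul_zero]

theorem finrank_vectorSpan_eq_card {ι : Type*} [Fintype ι] {P : Set (ι → ℝ)}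
    (h : ∀ β : ι → ℝ, (∀ x ∈ P, ∀ y ∈ P, β ⬝ᵥ x = β ⬝ᵥ y) → β = 0) :
    Module.finrank ℝ (vectorSpan ℝ P) = Fintype.card ι := by
  classical
  have h1 := Subspace.finrank_add_finrank_dualAnnihilator_eq (vectorSpan ℝ P)
  have h2 : (vectorSpan ℝ P).dualAnnihilator = ⊥ := by
    rw [eq_bot_iff]
    intro φ hφ
    rw [mem_dualAnnihilator_vectorSpan_iff] at hφ
    have h3 := h ((dotProductEquiv ℝ ι).symm φ) (by
      intro x hx y hy
      have e : ∀ z, (dotProductEquiv ℝ ι).symm φ ⬝ᵥ z = φ z := fun z => by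
        rw [← dotProductEquiv_apply_apply, LinearEquiv.apply_symm_apply]
      rw [e, e]
      exact hφ x hx y hy)
    rw [Submodule.mem_bot]
    exact (LinearEquiv.map_eq_zero_iff _).1 h3
  rw [h2, finrank_bot, add_zero, Module.finrank_fintype_fun_eq_card] at h1
  exact h1

/-- The normal vector of a facet of a full-dimensional polytope is unique up to scaling. -/
theorem IsFacetDefining.exists_eq_smul {ι : Type*} [Fintype ι] {P : Set (ι → ℝ)} {α : ι → ℝ}
    {b : ℝ} (h : IsFacetDefining P α b)
    (hP : Module.finrank ℝ (vectorSpan ℝ P) = Fintype.card ι) (hα : α ≠ 0) {β : ι → ℝ}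
    (hβ : ∀ x ∈ P, α ⬝ᵥ x = b → ∀ y ∈ P, α ⬝ᵥ y = b → β ⬝ᵥ x = β ⬝ᵥ y) :
    ∃ t : ℝ, β = t • α := by
  classical
  have h1 := Subspace.finrank_add_finrank_dualAnnihilator_eq
    (vectorSpan ℝ {x | x ∈ P ∧ α ⬝ᵥ x = b})
  have h2 := h.2.2
  rw [hP] at h2
  rw [Module.finrank_fintype_fun_eq_card] at h1
  have h3 : Module.finrank ℝ (vectorSpan ℝ {x | x ∈ P ∧ α ⬝ᵥ x = b}).dualAnnihilator = 1 := by
    omega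
  have hαm : dotProductEquiv ℝ ι α ∈ (vectorSpan ℝ {x | x ∈ P ∧ α ⬝ᵥ x = b}).dualAnnihilator := by
    rw [mem_dualAnnihilator_vectorSpan_iff]
    intro x hx y hy
    rw [dotProductEquiv_apply_apply, dotProductEquiv_apply_apply, hx.2, hy.2]
  have hβm : dotProductEquiv ℝ ι β ∈ (vectorSpan ℝ {x | x ∈ P ∧ α ⬝ᵥ x = b}).dualAnnihilator := by
    rw [mem_dualAnnihilator_vectorSpan_iff]
    intro x hx y hy
    rw [dotProductEquiv_apply_apply, dotProductEquiv_apply_apply]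
    exact hβ x hx.1 hx.2 y hy.1 hy.2
  obtain ⟨t, ht⟩ := (finrank_eq_one_iff_of_nonzero'
    (⟨_, hαm⟩ : (vectorSpan ℝ {x | x ∈ P ∧ α ⬝ᵥ x = b}).dualAnnihilator) (by
      intro h0
      exact hα ((LinearEquiv.map_eq_zero_iff _).1 (congrArg Subtype.val h0)))).1 h3 ⟨_, hβm⟩
  refine ⟨t, ?_⟩
  have := congrArg Subtype.val ht
  change t • dotProductEquiv ℝ ι α = dotProductEquiv ℝ ι β at this
  rw [← map_smul] at this
  exact ((dotProductEquiv ℝ ι).injective this).symm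

theorem isFacetDefining_of_forall {ι : Type*} [Fintype ι] {P : Set (ι → ℝ)} {α : ι → ℝ} {b : ℝ}
    (hP : Module.finrank ℝ (vectorSpan ℝ P) = Fintype.card ι) (hα : α ≠ 0)
    (hle : ∀ x ∈ P, α ⬝ᵥ x ≤ b) (hne : ∃ x ∈ P, α ⬝ᵥ x = b)
    (h : ∀ β : ι → ℝ, (∀ x ∈ P, α ⬝ᵥ x = b → ∀ y ∈ P, α ⬝ᵥ y = b → β ⬝ᵥ x = β ⬝ᵥ y) →
      ∃ t : ℝ, β = t • α) : IsFacetDefining P α b := by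
  classical
  obtain ⟨x0, hx0⟩ := hne
  refine ⟨hle, ⟨x0, hx0⟩, ?_⟩
  have h1 := Subspace.finrank_add_finrank_dualAnnihilator_eq
    (vectorSpan ℝ {x | x ∈ P ∧ α ⬝ᵥ x = b})
  rw [Module.finrank_fintype_fun_eq_card] at h1
  rw [hP, ← h1]
  congr 1
  symm
  have hαm : dotProductEquiv ℝ ι α ∈ (vectorSpan ℝ {x | x ∈ P ∧ α ⬝ᵥ x = b}).dualAnnihilator := by
    rw [mem_dualAnnihilator_vectorSpan_iff]
    intro x hx y hy
    rw [dotProductEquiv_apply_apply, dotProductEquiv_apply_apply, hx.2, hy.2]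
  refine (finrank_eq_one_iff_of_nonzero'
    (⟨_, hαm⟩ : (vectorSpan ℝ {x | x ∈ P ∧ α ⬝ᵥ x = b}).dualAnnihilator) (by
      intro h0
      exact hα ((LinearEquiv.map_eq_zero_iff _).1 (congrArg Subtype.val h0)))).2 ?_
  rintro ⟨φ, hφ⟩
  rw [mem_dualAnnihilator_vectorSpan_iff] at hφ
  have e : ∀ z, (dotProductEquiv ℝ ι).symm φ ⬝ᵥ z = φ z := fun z => by
    rw [← dotProductEquiv_apply_apply, LinearEquiv.apply_symm_apply]
  obtain ⟨t, ht⟩ := h ((dotProductEquiv ℝ ι).symm φ) (by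
    intro x hx hxb y hy hyb
    rw [e, e]
    exact hφ x ⟨hx, hxb⟩ y ⟨hy, hyb⟩)
  refine ⟨t, Subtype.ext ?_⟩
  change t • dotProductEquiv ℝ ι α = φ
  rw [← map_smul, ← ht, LinearEquiv.apply_symm_apply]

/-! ### Cut vectors and spins -/

/-- The vector of products `s i * s j` over the edges `ij`. -/
def spinVector {V : Type*} (G : SimpleGraph V) (s : V → ℝ) : G.edgeSet → ℝ :=
  fun e => Sym2.lift ⟨fun a b => s a * s b, fun _ _ => mul_comm _ _⟩ (e : Sym2 V)

@[simp] theorem spinVector_mk {V : Type*} {G : SimpleGraph V} (s : V → ℝ) {a b : V}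
    (h : s(a, b) ∈ G.edgeSet) : spinVector G s ⟨s(a, b), h⟩ = s a * s b := rfl

open Classical in
theorem cutVector_eq_spinVector {V : Type*} (G : SimpleGraph V) (U : Set V) :
    cutVector G U = spinVector G (fun i => if i ∈ U then -1 else 1) := by
  ext ⟨e, he⟩
  induction e with | _ a b
  rw [spinVector_mk]
  unfold cutVector cutset
  have : (s(a, b) ∈ {e | e ∈ G.edgeSet ∧ ∃ a ∈ U, ∃ b ∉ U, e = s(a, b)}) ↔
      (a ∈ U ∧ b ∉ U) ∨ (b ∈ U ∧ a ∉ U) := by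
    simp only [Set.mem_ofPred_eq, Sym2.eq_iff]
    constructor
    · rintro ⟨-, c, hc, d, hd, ⟨rfl, rfl⟩ | ⟨rfl, rfl⟩⟩
      · exact Or.inl ⟨hc, hd⟩
      · exact Or.inr ⟨hc, hd⟩
    · rintro (⟨h1, h2⟩ | ⟨h1, h2⟩)
      · exact ⟨he, a, h1, b, h2, Or.inl ⟨rfl, rfl⟩⟩
      · exact ⟨he, b, h1, a, h2, Or.inr ⟨rfl, rfl⟩⟩
  simp only [this]
  by_cases ha : a ∈ U <;> by_cases hb : b ∈ U <;> simp [ha, hb]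

theorem range_cutVector {V : Type*} (G : SimpleGraph V) :
    Set.range (cutVector G) = {x | ∃ s, IsSpin s ∧ x = spinVector G s} := by
  classical
  ext x
  constructor
  · rintro ⟨U, rfl⟩
    refine ⟨_, ?_, cutVector_eq_spinVector G U⟩
    intro i
    by_cases hi : i ∈ U <;> simp [hi]
  · rintro ⟨s, hs, rfl⟩
    refine ⟨{i | s i = -1}, ?_⟩
    rw [cutVector_eq_spinVector]
    congr 1
    ext i
    rcases hs i with h | h
    · simp [h]; norm_num
    · simp [h]

theorem spinVector_mem_cutPolytope {V : Type*} (G : SimpleGraph V) {s : V → ℝ} (hs : IsSpin s) :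
    spinVector G s ∈ cutPolytope G := by
  apply subset_convexHull
  rw [range_cutVector]
  exact ⟨s, hs, rfl⟩

theorem dotProduct_le_of_forall_spin {V : Type*} {G : SimpleGraph V} [Fintype G.edgeSet]
    {α : G.edgeSet → ℝ} {b : ℝ} (h : ∀ s, IsSpin s → α ⬝ᵥ spinVector G s ≤ b) :
    ∀ x ∈ cutPolytope G, α ⬝ᵥ x ≤ b := by
  have hconv : Convex ℝ {x : G.edgeSet → ℝ | α ⬝ᵥ x ≤ b} := by
    intro x hx y hy c d hc hd hcd
    simp only [Set.mem_ofPred_eq, dotProduct_add, dotProduct_smul, smul_eq_mul] at *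
    calc c * α ⬝ᵥ x + d * α ⬝ᵥ y ≤ c * b + d * b := by gcongr
      _ = b := by rw [← add_mul, hcd, one_mul]
  intro x hx
  refine convexHull_min ?_ hconv hx
  rw [range_cutVector]
  rintro _ ⟨s, hs, rfl⟩
  exact h s hs

open Classical in
/-- The symmetric matrix with zero diagonal given by edge weights. -/
noncomputable def edgeMatrix {V : Type*} {G : SimpleGraph V} (α : G.edgeSet → ℝ) : Matrix V V ℝ :=
  fun i j => if h : G.Adj i j then α ⟨s(i, j), G.mem_edgeSet.2 h⟩ else 0

theorem edgeMatrix_of_adj {V : Type*} {G : SimpleGraph V} (α : G.edgeSet → ℝ) {i j : V}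
    (h : G.Adj i j) : edgeMatrix α i j = α ⟨s(i, j), G.mem_edgeSet.2 h⟩ := dif_pos h

theorem edgeMatrix_of_not_adj {V : Type*} {G : SimpleGraph V} (α : G.edgeSet → ℝ) {i j : V}
    (h : ¬ G.Adj i j) : edgeMatrix α i j = 0 := dif_neg h

theorem edgeMatrix_self {V : Type*} {G : SimpleGraph V} (α : G.edgeSet → ℝ) (i : V) :
    edgeMatrix α i i = 0 := edgeMatrix_of_not_adj α (G.loopless.irrefl i)

theorem edgeMatrix_symm {V : Type*} {G : SimpleGraph V} (α : G.edgeSet → ℝ) (i j : V) :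
    edgeMatrix α i j = edgeMatrix α j i := by
  by_cases h : G.Adj i j
  · rw [edgeMatrix_of_adj α h, edgeMatrix_of_adj α h.symm]
    congr 1
    exact Subtype.ext Sym2.eq_swap
  · rw [edgeMatrix_of_not_adj α h, edgeMatrix_of_not_adj α (fun h' => h h'.symm)]

theorem hasPattern_edgeMatrix {V : Type*} {G : SimpleGraph V} (α : G.edgeSet → ℝ) :
    HasPattern G (edgeMatrix α) := by
  intro i j _ h
  by_contra hn
  exact h (edgeMatrix_of_not_adj α hn)

theorem dotProduct_edgeMatrix_mulVec {V : Type*} [Fintype V] {G : SimpleGraph V}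
    [Fintype G.edgeSet] (α : G.edgeSet → ℝ) (s : V → ℝ) :
    s ⬝ᵥ edgeMatrix α *ᵥ s = 2 * (α ⬝ᵥ spinVector G s) := by
  classical
  have h1 : ∀ i j, edgeMatrix α i j * (s i * s j) =
      ∑ e : G.edgeSet, if (e : Sym2 V) = s(i, j) then α e * spinVector G s e else 0 := by
    intro i j
    by_cases h : G.Adj i j
    · rw [Finset.sum_eq_single (⟨s(i, j), G.mem_edgeSet.2 h⟩ : G.edgeSet), edgeMatrix_of_adj α h]
      · rw [if_pos rfl, spinVector_mk]
      · intro e _ he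
        rw [if_neg (fun h' => he (Subtype.ext h'))]
      · simp
    · rw [edgeMatrix_of_not_adj α h, zero_mul]
      symm
      refine Finset.sum_eq_zero fun e _ => if_neg fun he => h ?_
      have := e.2
      rwa [he] at this
  rw [dotProduct_mulVec_eq_sum]
  simp only [h1]
  rw [show (∑ i, ∑ j, ∑ e : G.edgeSet,
      if (e : Sym2 V) = s(i, j) then α e * spinVector G s e else 0) =
      ∑ e : G.edgeSet, ∑ i, ∑ j,
        if (e : Sym2 V) = s(i, j) then α e * spinVector G s e else 0 by
    rw [Finset.sum_congr rfl fun i _ => Finset.sum_comm]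
    exact Finset.sum_comm]
  rw [dotProduct, Finset.mul_sum]
  refine Finset.sum_congr rfl ?_
  rintro ⟨e, he⟩ -
  induction e with | _ a b
  have hab : a ≠ b := G.ne_of_adj he
  set c := α ⟨s(a, b), he⟩ * spinVector G s ⟨s(a, b), he⟩
  have h2 : ∀ i j, (if s(a, b) = s(i, j) then c else 0) =
      (if a = i then (if b = j then c else 0) else 0) +
        (if b = i then (if a = j then c else 0) else 0) := by
    intro i j
    simp only [Sym2.eq_iff]
    by_cases h3 : a = i <;> by_cases h4 : b = j <;> by_cases h5 : a = j <;>
      by_cases h6 : b = i <;> simp [*] <;> grind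
  simp only [h2, Finset.sum_add_distrib, Finset.sum_ite_eq, Finset.mem_univ, if_true,
    Finset.sum_ite_irrel, Finset.sum_const_zero]
  ring

/-- The effect of changing the sign of one coordinate on a quadratic form with zero diagonal. -/
theorem quadratic_sub_flip {V : Type*} [Fintype V] [DecidableEq V] {B : Matrix V V ℝ}
    (hB : ∀ i j, B i j = B j i) (s : V → ℝ) {a : V} (ha : B a a = 0) :
    s ⬝ᵥ B *ᵥ s - Function.update s a (-s a) ⬝ᵥ B *ᵥ Function.update s a (-s a) =
      4 * s a * (B *ᵥ s) a := by
  have h : Function.update s a (-s a) = s - (2 * s a) • Pi.single a 1 := by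
    ext i
    by_cases hi : i = a
    · subst hi; simp; ring
    · simp [hi]
  rw [h, Matrix.mulVec_sub, Matrix.mulVec_smul, dotProduct_sub, sub_dotProduct, sub_dotProduct,
    dotProduct_smul, dotProduct_smul, smul_dotProduct, smul_dotProduct,
    dotProduct_mulVec_comm_of_symm hB s (Pi.single a 1), single_dotProduct, single_dotProduct,
    mulVec_single_one_apply, ha]
  simp only [smul_eq_mul]
  ring

theorem mulVec_flip {V : Type*} [Fintype V] [DecidableEq V] (B : Matrix V V ℝ) (s : V → ℝ)
    (a c : V) : (B *ᵥ Function.update s c (-s c)) a = (B *ᵥ s) a - 2 * s c * B a c := by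
  have h : Function.update s c (-s c) = s - (2 * s c) • Pi.single c 1 := by
    ext i
    by_cases hi : i = c
    · subst hi; simp; ring
    · simp [hi]
  rw [h, Matrix.mulVec_sub, Matrix.mulVec_smul, Pi.sub_apply, Pi.smul_apply,
    mulVec_single_one_apply, smul_eq_mul]

/-- The mixed second difference of the linear form `β` along two flips is the entry of `β`. -/
theorem edgeMatrix_eq_zero_of_flips {V : Type*} [Fintype V] [DecidableEq V] {G : SimpleGraph V}
    [Fintype G.edgeSet] (β : G.edgeSet → ℝ) {s : V → ℝ} (hs : IsSpin s) {a c : V} (hac : a ≠ c)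
    (h1 : β ⬝ᵥ spinVector G (Function.update s a (-s a)) = β ⬝ᵥ spinVector G s)
    (h2 : β ⬝ᵥ spinVector G (Function.update (Function.update s c (-s c)) a (-s a)) =
      β ⬝ᵥ spinVector G (Function.update s c (-s c))) : edgeMatrix β a c = 0 := by
  have e1 := quadratic_sub_flip (edgeMatrix_symm β) s (edgeMatrix_self β a)
  have e2 := quadratic_sub_flip (edgeMatrix_symm β) (Function.update s c (-s c))
    (edgeMatrix_self β a)
  rw [Function.update_of_ne hac, mulVec_flip] at e2
  simp only [dotProduct_edgeMatrix_mulVec] at e1 e2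
  rw [h1] at e1
  rw [h2] at e2
  have h3 : s a * s c * edgeMatrix β a c = 0 := by linear_combination (e2 - e1) / 8
  rcases hs a with h | h <;> rcases hs c with h' | h' <;> rw [h, h'] at h3 <;> linarith

theorem isSpin_one {V : Type*} : IsSpin (1 : V → ℝ) := fun _ => Or.inl rfl

theorem IsSpin.flip {V : Type*} [DecidableEq V] {s : V → ℝ} (h : IsSpin s) (v : V) :
    IsSpin (Function.update s v (-s v)) :=
  h.update v (by rcases h v with h | h <;> rw [h] <;> norm_num)

theorem eq_zero_of_edgeMatrix {V : Type*} {G : SimpleGraph V} {β : G.edgeSet → ℝ}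
    (h : ∀ a c, G.Adj a c → edgeMatrix β a c = 0) : β = 0 := by
  ext ⟨e, he⟩
  induction e with | _ a b
  rw [← edgeMatrix_of_adj β he]
  exact h a b he

theorem finrank_vectorSpan_cutPolytope {V : Type*} [Fintype V] (G : SimpleGraph V)
    [Fintype G.edgeSet] :
    Module.finrank ℝ (vectorSpan ℝ (cutPolytope G)) = Fintype.card G.edgeSet := by
  classical
  refine finrank_vectorSpan_eq_card fun β h => eq_zero_of_edgeMatrix fun a c hac => ?_
  have h' : ∀ s t : V → ℝ, IsSpin s → IsSpin t → β ⬝ᵥ spinVector G s = β ⬝ᵥ spinVector G t :=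
    fun s t hs ht => h _ (spinVector_mem_cutPolytope G hs) _ (spinVector_mem_cutPolytope G ht)
  have hc := (isSpin_one (V := V)).flip c
  have hca := hc.flip a
  rw [Function.update_of_ne hac.ne] at hca
  exact edgeMatrix_eq_zero_of_flips β isSpin_one hac.ne
    (h' _ _ (isSpin_one.flip a) isSpin_one) (h' _ _ hca hc)

/-! ### The edges of a chordless cycle -/

/-- The cyclic successor on `{0, …, m - 1}`. -/
def cycleSucc (m i : ℕ) : ℕ := if i + 1 < m then i + 1 else 0

theorem cycleSucc_of_lt {m i : ℕ} (h : i + 1 < m) : cycleSucc m i = i + 1 := if_pos h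

theorem cycleSucc_of_eq {m i : ℕ} (h : i + 1 = m) : cycleSucc m i = 0 := if_neg (by omega)

theorem cycleSucc_lt {m i : ℕ} (h : i < m) : cycleSucc m i < m := by
  unfold cycleSucc
  split_ifs <;> omega

theorem IsChordlessCycle.adj_succ {V : Type*} {G : SimpleGraph V} {m : ℕ} {f : ℕ → V}
    (hf : IsChordlessCycle G m f) {i : ℕ} (hi : i < m) : G.Adj (f i) (f (cycleSucc m i)) := by
  rw [hf.adj i hi _ (cycleSucc_lt hi)]
  unfold cycleSucc
  split_ifs <;> omega

/-- The edges of a chordless cycle. -/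
def IsChordlessCycle.edge {V : Type*} {G : SimpleGraph V} {m : ℕ} {f : ℕ → V}
    (hf : IsChordlessCycle G m f) (i : Fin m) : G.edgeSet :=
  ⟨s(f i, f (cycleSucc m i)), G.mem_edgeSet.2 (hf.adj_succ i.2)⟩

theorem IsChordlessCycle.edge_injective {V : Type*} {G : SimpleGraph V} {m : ℕ} {f : ℕ → V}
    (hf : IsChordlessCycle G m f) : Function.Injective hf.edge := by
  intro i j hij
  have h3 := hf.three_le
  have hi := i.2
  have hj := j.2
  have h := congrArg Subtype.val hij
  change s(f i, f (cycleSucc m i)) = s(f j, f (cycleSucc m j)) at h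
  rw [Sym2.eq_iff] at h
  apply Fin.ext
  rcases h with ⟨h, -⟩ | ⟨h1, h2⟩
  · exact hf.inj _ hi _ hj h
  · have e1 := hf.inj _ hi _ (cycleSucc_lt hj) h1
    have e2 := hf.inj _ (cycleSucc_lt hi) _ hj h2
    unfold cycleSucc at e1 e2
    split_ifs at e1 e2 <;> omega

theorem IsChordlessCycle.exists_edge_eq {V : Type*} {G : SimpleGraph V} {m : ℕ} {f : ℕ → V}
    (hf : IsChordlessCycle G m f) {k l : ℕ} (hk : k < m) (hl : l < m) (h : G.Adj (f k) (f l)) :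
    ∃ i : Fin m, hf.edge i = ⟨s(f k, f l), G.mem_edgeSet.2 h⟩ := by
  have h3 := hf.three_le
  have h' := (hf.adj k hk l hl).1 h
  by_cases hc : l = cycleSucc m k
  · subst hc
    exact ⟨⟨k, hk⟩, rfl⟩
  · refine ⟨⟨l, hl⟩, Subtype.ext ?_⟩
    have : k = cycleSucc m l := by
      unfold cycleSucc at hc ⊢
      split_ifs at hc ⊢ <;> omega
    change s(f l, f (cycleSucc m l)) = s(f k, f l)
    rw [← this, Sym2.eq_swap]

theorem IsChordlessCycle.spinVector_edge {V : Type*} {G : SimpleGraph V} {m : ℕ} {f : ℕ → V}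
    (hf : IsChordlessCycle G m f) (s : V → ℝ) (i : Fin m) :
    spinVector G s (hf.edge i) = s (f i) * s (f (cycleSucc m i)) := rfl

theorem IsChordlessCycle.dotProduct_eq_sum {V : Type*} {G : SimpleGraph V} [Fintype G.edgeSet]
    {m : ℕ} {f : ℕ → V} (hf : IsChordlessCycle G m f) {β : G.edgeSet → ℝ}
    (hβ : ∀ e, (∀ i, hf.edge i ≠ e) → β e = 0) (x : G.edgeSet → ℝ) :
    β ⬝ᵥ x = ∑ i, β (hf.edge i) * x (hf.edge i) := by
  symm
  refine Fintype.sum_of_injective hf.edge hf.edge_injective _ _ ?_ (fun i => rfl)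
  intro e he
  rw [hβ e (fun i h => he ⟨i, h⟩), zero_mul]

theorem IsChordlessCycle.apply_eq_zero_of_onRange {V : Type*} {G : SimpleGraph V} {m : ℕ}
    {f : ℕ → V} (hf : IsChordlessCycle G m f) {β : G.edgeSet → ℝ}
    (hβ : OnRange (edgeMatrix β) m f) (e : G.edgeSet) (he : ∀ i, hf.edge i ≠ e) : β e = 0 := by
  obtain ⟨e, he'⟩ := e
  induction e with | _ a b
  by_contra hne
  have hadj : G.Adj a b := he'
  obtain ⟨⟨k, hk, rfl⟩, ⟨l, hl, rfl⟩⟩ := hβ a b hadj.ne (by rwa [edgeMatrix_of_adj β hadj])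
  obtain ⟨i, hi⟩ := hf.exists_edge_eq hk hl hadj
  exact he i hi

/-- Prescribed signs along the vertices of a cycle, and `1` elsewhere. -/
theorem exists_spin {V : Type*} {m : ℕ} {f : ℕ → V}
    (hf : ∀ i < m, ∀ j < m, f i = f j → i = j) {p : ℕ → ℝ} (hp : ∀ i, p i = 1 ∨ p i = -1) :
    ∃ s : V → ℝ, IsSpin s ∧ ∀ i < m, s (f i) = p i := by
  classical
  refine ⟨fun w => if h : ∃ i < m, f i = w then p h.choose else 1, fun w => ?_, fun i hi => ?_⟩
  · by_cases h : ∃ i < m, f i = w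
    · simp only [dif_pos h]; exact hp _
    · simp only [dif_neg h]; exact Or.inl trivial
  · have h : ∃ j < m, f j = f i := ⟨i, hi, rfl⟩
    simp only [dif_pos h]
    rw [hf _ h.choose_spec.1 i hi h.choose_spec.2]

theorem sign_mul_apply_le_one {V : Type*} {G : SimpleGraph V} [Fintype G.edgeSet]
    {x : G.edgeSet → ℝ} (hx : x ∈ cutPolytope G) {σ : ℝ} (hσ : σ = 1 ∨ σ = -1) (e : G.edgeSet) :
    σ * x e ≤ 1 := by
  classical
  have := dotProduct_le_of_forall_spin (α := Pi.single e σ) (b := 1) (by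
    intro s hs
    rw [single_dotProduct]
    obtain ⟨e, he⟩ := e
    induction e with | _ a b
    rw [spinVector_mk]
    rcases hσ with h | h <;> rcases hs a with h1 | h1 <;> rcases hs b with h2 | h2 <;>
      rw [h, h1, h2] <;> norm_num) x hx
  rwa [single_dotProduct] at this

theorem mul_eq_neg_one_or {x y z : ℝ} (hx : x = 1 ∨ x = -1) (hy : y = 1 ∨ y = -1)
    (hz : z = 1 ∨ z = -1) : x * (y * z) = 1 ∨ x * (y * z) = -1 := by
  rcases hx with h | h <;> rcases hy with h1 | h1 <;> rcases hz with h2 | h2 <;>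
    rw [h, h1, h2] <;> norm_num

/-- The cycle inequality. -/
theorem IsChordlessCycle.sum_le {V : Type*} {G : SimpleGraph V} {m : ℕ} {f : ℕ → V}
    (hf : IsChordlessCycle G m f) {σ : ℕ → ℝ} (hσ : ∀ i, σ i = 1 ∨ σ i = -1)
    (hprod : ∏ i ∈ Finset.range m, σ i = -1) {s : V → ℝ} (hs : IsSpin s) :
    ∑ i : Fin m, σ i * spinVector G s (hf.edge i) ≤ m - 2 := by
  have h3 := hf.three_le
  simp only [hf.spinVector_edge]
  have hterm : ∀ i : ℕ, σ i * (s (f i) * s (f (cycleSucc m i))) = 1 ∨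
      σ i * (s (f i) * s (f (cycleSucc m i))) = -1 := fun i =>
    mul_eq_neg_one_or (hσ i) (hs _) (hs _)
  obtain ⟨i0, hi0⟩ : ∃ i : Fin m, σ i * (s (f i) * s (f (cycleSucc m i))) = -1 := by
    by_contra hcon
    push Not at hcon
    have hall : ∀ i < m, σ i * (s (f i) * s (f (cycleSucc m i))) = 1 := fun i hi =>
      (hterm i).resolve_right (hcon ⟨i, hi⟩)
    have hind : ∀ i < m, s (f i) = (∏ j ∈ Finset.range i, σ j) * s (f 0) := by
      intro i
      induction i with
      | zero => intro _; simp
      | succ i ih =>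
        intro hi
        have h1 := hall i (by omega)
        rw [cycleSucc_of_lt hi] at h1
        rw [Finset.prod_range_succ, mul_right_comm, ← ih (by omega)]
        rcases hσ i with h | h <;> rcases hs (f i) with h' | h' <;> rw [h, h'] at h1 <;>
          rw [h, h'] <;> linarith
    have h1 := hall (m - 1) (by omega)
    rw [cycleSucc_of_eq (by omega), hind (m - 1) (by omega)] at h1
    have h2 : (∏ j ∈ Finset.range (m - 1), σ j) * σ (m - 1) = -1 := by
      rw [← Finset.prod_range_succ, Nat.sub_add_cancel (by omega), hprod]
    have h3 := hs.mul_self (f 0)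
    have : σ (m - 1) * ((∏ j ∈ Finset.range (m - 1), σ j) * s (f 0) * s (f 0)) =
        ((∏ j ∈ Finset.range (m - 1), σ j) * σ (m - 1)) * (s (f 0) * s (f 0)) := by ring
    rw [this, h2, h3] at h1
    norm_num at h1
  have hsingle := Finset.single_le_sum
    (f := fun i : Fin m => 1 - σ i * (s (f i) * s (f (cycleSucc m i)))) (s := Finset.univ)
    (fun i _ => by rcases hterm i with h | h <;> simp only [h] <;> norm_num) (Finset.mem_univ i0)
  simp only [hi0, Finset.sum_sub_distrib, Finset.sum_const, Finset.card_univ, Fintype.card_fin,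
    nsmul_eq_mul, mul_one] at hsingle
  linarith

/-! ### The constant terms of the facets -/

theorem facet_constant_of_edge {V : Type*} [Fintype V] {G : SimpleGraph V} [Fintype G.edgeSet]
    {a : G.edgeSet → ℤ} (ha : ∀ d : ℤ, (∀ e, d ∣ a e) → IsUnit d) {b : ℝ}
    (h : IsFacetDefining (cutPolytope G) (fun e => (a e : ℝ)) b) {e0 : G.edgeSet}
    (h0 : ∀ e, e ≠ e0 → a e = 0) : b = 1 := by
  classical
  have hunit := ha (a e0) (fun e => by
    by_cases he : e = e0
    · rw [he]
    · rw [h0 e he]; exact dvd_zero _)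
  have hσ : (a e0 : ℝ) = 1 ∨ (a e0 : ℝ) = -1 := by
    rcases Int.isUnit_iff.1 hunit with h | h <;> rw [h] <;> simp
  have hdot : ∀ x : G.edgeSet → ℝ, (fun e => (a e : ℝ)) ⬝ᵥ x = a e0 * x e0 := by
    intro x
    rw [dotProduct, Finset.sum_eq_single e0]
    · intro e _ he
      rw [h0 e he]; simp
    · simp
  obtain ⟨hle, ⟨x, hx, hxb⟩, -⟩ := h
  apply le_antisymm
  · rw [← hxb, hdot]
    exact sign_mul_apply_le_one hx hσ e0
  · obtain ⟨e, he⟩ := e0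
    induction e with | _ u w
    have huw : u ≠ w := G.ne_of_adj he
    have hs : IsSpin (Function.update (1 : V → ℝ) u (a ⟨s(u, w), he⟩ : ℝ)) :=
      isSpin_one.update u hσ
    have := hle _ (spinVector_mem_cutPolytope G hs)
    rw [hdot, spinVector_mk, Function.update_self, Function.update_of_ne huw.symm,
      Pi.one_apply, mul_one] at this
    rcases hσ with h | h <;> rw [h] at this <;> linarith

theorem facet_constant_of_cycle {V : Type*} [Fintype V] {G : SimpleGraph V} [Fintype G.edgeSet]
    {a : G.edgeSet → ℤ} (ha : ∀ d : ℤ, (∀ e, d ∣ a e) → IsUnit d) {b : ℝ}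
    (h : IsFacetDefining (cutPolytope G) (fun e => (a e : ℝ)) b) {m : ℕ} {f : ℕ → V}
    (hf : IsChordlessCycle G m f) (hr : OnRange (edgeMatrix fun e => (a e : ℝ)) m f) :
    b = 1 ∨ b = m - 2 := by
  classical
  set α : G.edgeSet → ℝ := fun e => (a e : ℝ) with hα
  have hfull := finrank_vectorSpan_cutPolytope G
  have hα0 : α ≠ 0 := by
    intro h0
    have h2 := ha 2 (fun e => by
      have : (a e : ℝ) = 0 := congrFun h0 e
      rw [Int.cast_eq_zero.1 this]; exact dvd_zero _)
    rw [Int.isUnit_iff] at h2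
    omega
  -- arrange that the closing edge has minimal weight
  have h3 := hf.three_le
  obtain ⟨⟨u, w⟩, ⟨⟨ku, hku, rfl⟩, ⟨kw, hkw, rfl⟩, huw⟩, hmin⟩ :=
    Set.exists_min_image {p : V × V | (∃ k < m, f k = p.1) ∧ (∃ k < m, f k = p.2) ∧ G.Adj p.1 p.2}
      (fun p => |edgeMatrix α p.1 p.2|) (Set.toFinite _)
      ⟨(f 0, f 1), ⟨0, by omega, rfl⟩, ⟨1, by omega, rfl⟩,
        (hf.adj 0 (by omega) 1 (by omega)).2 (by omega)⟩
  obtain ⟨f', hf', hf0, hfm, hrange, hrange'⟩ := hf.exists_closing hku hkw huw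
  have hr' : OnRange (edgeMatrix α) m f' := by
    intro i j hij hne
    obtain ⟨⟨k, hk, rfl⟩, ⟨l, hl, rfl⟩⟩ := hr i j hij hne
    exact ⟨hrange k hk, hrange l hl⟩
  have hmin' : ∀ i j : ℕ, i < m → j < m → G.Adj (f' i) (f' j) →
      |edgeMatrix α (f' (m - 1)) (f' 0)| ≤ |edgeMatrix α (f' i) (f' j)| := by
    intro i j hi hj hij
    rw [edgeMatrix_symm α (f' (m - 1)), hf0, hfm]
    exact hmin (f' i, f' j) ⟨hrange' i hi, hrange' j hj, hij⟩
  clear hmin hrange hrange' hf0 hfm hr huw hkw hku hf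
  rename' hf' => hf, hr' => hr
  have hzero := hf.apply_eq_zero_of_onRange hr
  set c : ℕ → ℝ := fun i => edgeMatrix α (f' i) (f' (cycleSucc m i)) with hc
  have hcE : ∀ i : Fin m, α (hf.edge i) = c i := fun i =>
    (edgeMatrix_of_adj α (hf.adj_succ i.2)).symm
  have hdot : ∀ x : G.edgeSet → ℝ, α ⬝ᵥ x = ∑ i : Fin m, c i * x (hf.edge i) := by
    intro x
    rw [hf.dotProduct_eq_sum hzero]
    exact Finset.sum_congr rfl fun i _ => by rw [hcE]
  have hcmin : ∀ i < m, |c (m - 1)| ≤ |c i| := by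
    intro i hi
    simp only [hc]
    rw [cycleSucc_of_eq (by omega : m - 1 + 1 = m)]
    exact hmin' i _ hi (cycleSucc_lt hi) (hf.adj_succ hi)
  choose σ0 hσ0 hσ0c using fun i => exists_sign (c i)
  set p : ℕ → ℝ := fun i => ∏ j ∈ Finset.range i, σ0 j with hp
  have hpsign : ∀ i, p i = 1 ∨ p i = -1 := by
    intro i
    induction i with
    | zero => simp [hp]
    | succ i ih =>
      have e : p (i + 1) = p i * σ0 i := Finset.prod_range_succ _ _
      rcases ih with h1 | h1 <;> rcases hσ0 i with h2 | h2 <;> rw [e, h1, h2] <;> norm_num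
  obtain ⟨s, hs, hsp⟩ := exists_spin hf.inj hpsign
  have hvalue := h.1 _ (spinVector_mem_cutPolytope G hs)
  rw [hdot] at hvalue
  simp only [hf.spinVector_edge] at hvalue
  have hsum_range : ∀ g : ℕ → ℝ, ∑ i : Fin m, g i = ∑ i ∈ Finset.range (m - 1), g i + g (m - 1) := by
    intro g
    rw [Fin.sum_univ_eq_sum_range, ← Finset.sum_range_succ, Nat.sub_add_cancel (by omega)]
  rw [hsum_range (fun i => c i * (s (f' i) * s (f' (cycleSucc m i))))] at hvalue
  have hpath : ∑ i ∈ Finset.range (m - 1), c i * (s (f' i) * s (f' (cycleSucc m i))) =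
      ∑ i ∈ Finset.range (m - 1), |c i| := by
    refine Finset.sum_congr rfl fun i hi => ?_
    have hi' := Finset.mem_range.1 hi
    rw [cycleSucc_of_lt (by omega), hsp i (by omega), hsp (i + 1) (by omega)]
    have e : p (i + 1) = p i * σ0 i := Finset.prod_range_succ _ _
    have e2 : p i * p i = 1 := by rcases hpsign i with h1 | h1 <;> rw [h1] <;> norm_num
    have e3 : σ0 i * σ0 i = 1 := by rcases hσ0 i with h1 | h1 <;> rw [h1] <;> norm_num
    rw [e]
    linear_combination c i * σ0 i * e2 - σ0 i * hσ0c i + |c i| * e3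
  have hp0 : p 0 = 1 := by simp [hp]
  rw [hpath, cycleSucc_of_eq (by omega : m - 1 + 1 = m), hsp (m - 1) (by omega), hsp 0 (by omega),
    hp0, mul_one] at hvalue
  have habs := hsum_range (fun i => |c i|)
  obtain ⟨x0, hx0, hx0b⟩ := h.2.1
  rcases le_or_gt 0 (c (m - 1) * p (m - 1)) with hpos | hneg
  · -- all edges of the support are tight
    left
    have hb : ∑ i : Fin m, |c i| ≤ b := by
      have : c (m - 1) * p (m - 1) = |c (m - 1)| := by
        rw [← abs_of_nonneg hpos, abs_mul]
        rcases hpsign (m - 1) with h1 | h1 <;> rw [h1] <;> simp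
      rw [habs, ← this]
      exact hvalue
    have htight : ∀ x ∈ cutPolytope G, α ⬝ᵥ x = b → ∀ i : Fin m, c i * x (hf.edge i) = |c i| := by
      intro x hx hxb i
      rw [hdot] at hxb
      have hle : ∀ i : Fin m, c i * x (hf.edge i) ≤ |c i| := by
        intro i
        have := mul_le_mul_of_nonneg_left (sign_mul_apply_le_one hx (hσ0 i) (hf.edge i))
          (abs_nonneg (c i))
        rwa [← mul_assoc, hσ0c, mul_one] at this
      have heq := (Finset.sum_eq_sum_iff_of_le (s := Finset.univ) fun i _ => hle i).1
        (le_antisymm (Finset.sum_le_sum fun i _ => hle i) (by rw [hxb]; exact hb))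
      exact heq i (Finset.mem_univ _)
    obtain ⟨i, hi⟩ : ∃ i : Fin m, c i ≠ 0 := by
      by_contra hcon
      push Not at hcon
      apply hα0
      ext e
      by_cases he : ∃ i, hf.edge i = e
      · obtain ⟨i, rfl⟩ := he
        rw [hcE, hcon i]; rfl
      · push Not at he
        exact hzero e he
    obtain ⟨t, ht⟩ := h.exists_eq_smul hfull hα0 (β := Pi.single (hf.edge i) 1) (by
      intro x hx hxb y hy hyb
      rw [single_dotProduct, single_dotProduct, one_mul, one_mul]
      exact mul_left_cancel₀ hi ((htight x hx hxb i).trans (htight y hy hyb i).symm))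
    have ht0 : t ≠ 0 := by
      rintro rfl
      have := congrFun ht (hf.edge i)
      simp at this
    refine facet_constant_of_edge ha h (e0 := hf.edge i) fun e he => ?_
    have := congrFun ht e
    rw [Pi.single_eq_of_ne he, Pi.smul_apply, smul_eq_mul] at this
    rcases mul_eq_zero.1 this.symm with h1 | h1
    · exact absurd h1 ht0
    · exact Int.cast_eq_zero.1 h1
  · -- the facet is defined by a cycle inequality
    right
    set σ : ℕ → ℝ := fun i => if i = m - 1 then -p (m - 1) else σ0 i with hσdef
    have hσ : ∀ i, σ i = 1 ∨ σ i = -1 := by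
      intro i
      simp only [hσdef]
      split_ifs
      · rcases hpsign (m - 1) with h1 | h1 <;> rw [h1] <;> norm_num
      · exact hσ0 i
    have hσc : ∀ i, |c i| * σ i = c i := by
      intro i
      simp only [hσdef]
      split_ifs with hi
      · subst hi
        rcases hpsign (m - 1) with h1 | h1
        · rw [h1, mul_one] at hneg
          rw [h1, abs_of_neg hneg]; ring
        · rw [h1] at hneg
          rw [h1, abs_of_pos (by linarith)]; ring
      · exact hσ0c i
    have hprod : ∏ i ∈ Finset.range m, σ i = -1 := by
      rw [show m = m - 1 + 1 by omega, Finset.prod_range_succ]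
      have : ∏ i ∈ Finset.range (m - 1), σ i = p (m - 1) := by
        refine Finset.prod_congr rfl fun i hi => ?_
        have := Finset.mem_range.1 hi
        simp only [hσdef]
        rw [if_neg (by omega)]
      rw [this]
      simp only [hσdef, if_true]
      rcases hpsign (m - 1) with h1 | h1 <;> rw [h1] <;> norm_num
    set μ := |c (m - 1)| with hμ
    have hμpos : 0 < μ := abs_pos.2 (fun h0 => by rw [h0, zero_mul] at hneg; exact lt_irrefl _ hneg)
    have hb : ∑ i : Fin m, |c i| - 2 * μ ≤ b := by
      have : c (m - 1) * p (m - 1) = -μ := by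
        have := hσc (m - 1)
        simp only [hσdef, if_true] at this
        rw [← this, ← hμ]
        rcases hpsign (m - 1) with h1 | h1 <;> rw [h1] <;> ring
      rw [this] at hvalue
      linarith
    set η : G.edgeSet → ℝ := Function.extend hf.edge (fun i => σ i) 0 with hη
    have hηE : ∀ i, η (hf.edge i) = σ i := fun i => hf.edge_injective.extend_apply _ _ i
    have hη0 : ∀ e, (∀ i, hf.edge i ≠ e) → η e = 0 := fun e he =>
      Function.extend_apply' _ _ _ (fun ⟨i, hi⟩ => he i hi)
    have hηdot : ∀ x : G.edgeSet → ℝ, η ⬝ᵥ x = ∑ i : Fin m, σ i * x (hf.edge i) := by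
      intro x
      rw [hf.dotProduct_eq_sum hη0]
      exact Finset.sum_congr rfl fun i _ => by rw [hηE]
    have hηle := dotProduct_le_of_forall_spin (α := η) (b := m - 2) (fun s hs => by
      rw [hηdot]; exact hf.sum_le hσ hprod hs)
    have hdecomp : ∀ x : G.edgeSet → ℝ, α ⬝ᵥ x = μ * (η ⬝ᵥ x) +
        ∑ i : Fin m, (|c i| - μ) * (σ i * x (hf.edge i)) := by
      intro x
      rw [hdot, hηdot, Finset.mul_sum, ← Finset.sum_add_distrib]
      refine Finset.sum_congr rfl fun i _ => ?_
      linear_combination -x (hf.edge i) * hσc i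
    have hrest : ∀ x ∈ cutPolytope G, ∑ i : Fin m, (|c i| - μ) * (σ i * x (hf.edge i)) ≤
        ∑ i : Fin m, |c i| - m * μ := by
      intro x hx
      have : ∑ i : Fin m, |c i| - m * μ = ∑ i : Fin m, (|c i| - μ) := by
        rw [Finset.sum_sub_distrib]
        simp
      rw [this]
      refine Finset.sum_le_sum fun i _ => ?_
      have h1 := mul_le_mul_of_nonneg_left (sign_mul_apply_le_one hx (hσ i) (hf.edge i))
        (sub_nonneg.2 (hcmin i i.2))
      rwa [mul_one] at h1
    have htight : ∀ x ∈ cutPolytope G, α ⬝ᵥ x = b → η ⬝ᵥ x = m - 2 := by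
      intro x hx hxb
      refine le_antisymm (hηle x hx) ?_
      rw [hdecomp] at hxb
      have h1 := hrest x hx
      have h2 : μ * ((m : ℝ) - 2) ≤ μ * (η ⬝ᵥ x) := by linarith
      exact le_of_mul_le_mul_left h2 hμpos
    obtain ⟨t, ht⟩ := h.exists_eq_smul hfull hα0 (β := η) (by
      intro x hx hxb y hy hyb
      rw [htight x hx hxb, htight y hy hyb])
    have hta : ∀ i : Fin m, |t| * |c i| = 1 := by
      intro i
      have := congrFun ht (hf.edge i)
      rw [hηE, Pi.smul_apply, smul_eq_mul, hcE] at this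
      rw [← abs_mul, ← this]
      rcases hσ i with h1 | h1 <;> rw [h1] <;> simp
    have hcμ : ∀ i : Fin m, |c i| = μ := by
      intro i
      have h1 := hta i
      have h2 := hta ⟨m - 1, by omega⟩
      have ht0 : |t| ≠ 0 := fun h0 => by rw [h0, zero_mul] at h1; norm_num at h1
      exact mul_left_cancel₀ ht0 (h1.trans h2.symm)
    have hμ1 : μ = 1 := by
      set e1 := hf.edge ⟨m - 1, by omega⟩ with he1
      have hunit := ha (a e1) (fun e => by
        by_cases he : ∃ i, hf.edge i = e
        · obtain ⟨i, rfl⟩ := he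
          have h1 : |(a (hf.edge i) : ℝ)| = |(a e1 : ℝ)| := by
            change |α (hf.edge i)| = |α e1|
            rw [he1, hcE, hcE, hcμ, hcμ]
          have h2 : |a (hf.edge i)| = |a e1| := by exact_mod_cast h1
          rw [← abs_dvd, ← h2, abs_dvd]
        · push Not at he
          have : (a e : ℝ) = 0 := hzero e he
          rw [Int.cast_eq_zero.1 this]; exact dvd_zero _)
      have h1 : |α e1| = μ := by rw [he1, hcE]
      rw [← h1]
      change |(a e1 : ℝ)| = 1
      rcases Int.isUnit_iff.1 hunit with h2 | h2 <;> rw [h2] <;> simp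
    have hfin := hdecomp x0
    rw [hx0b, htight x0 hx0 hx0b, hμ1, one_mul, Finset.sum_eq_zero (fun i _ => by
      rw [hcμ, hμ1, sub_self, zero_mul]), add_zero] at hfin
    exact hfin

/-- The edge weights of a matrix, with the sign for which `2 * α ⬝ᵥ x ≤ trace` is the
inequality expressing nonnegativity on spins. -/
noncomputable def edgePart {V : Type*} (G : SimpleGraph V) :
    Matrix V V ℝ →ₗ[ℝ] (G.edgeSet → ℝ) where
  toFun Y e := Sym2.lift ⟨fun a b => -(Y a b + Y b a) / 2, fun a b => by ring⟩ (e : Sym2 V)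
  map_add' X Y := by
    ext ⟨e, he⟩
    induction e with | _ a b
    simp only [Sym2.lift_mk, Matrix.add_apply, Pi.add_apply]
    ring
  map_smul' t Y := by
    ext ⟨e, he⟩
    induction e with | _ a b
    simp only [Sym2.lift_mk, Matrix.smul_apply, Pi.smul_apply, smul_eq_mul, RingHom.id_apply]
    ring

theorem edgePart_mk {V : Type*} {G : SimpleGraph V} {Y : Matrix V V ℝ}
    (hY : ∀ i j, Y i j = Y j i) {a b : V} (h : s(a, b) ∈ G.edgeSet) :
    edgePart G Y ⟨s(a, b), h⟩ = -Y a b := by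
  change -(Y a b + Y b a) / 2 = _
  rw [hY b a]; ring

theorem quadratic_eq_trace_sub {V : Type*} [Fintype V] {G : SimpleGraph V} [Fintype G.edgeSet]
    {Y : Matrix V V ℝ} (hY : ∀ i j, Y i j = Y j i) (hp : HasPattern G Y) {s : V → ℝ}
    (hs : IsSpin s) : s ⬝ᵥ Y *ᵥ s = Y.trace - 2 * (edgePart G Y ⬝ᵥ spinVector G s) := by
  rw [← dotProduct_edgeMatrix_mulVec, eq_sub_iff_add_eq, ← dotProduct_add, ← Matrix.add_mulVec,
    dotProduct_mulVec_eq_sum, Matrix.trace]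
  refine Finset.sum_congr rfl fun i _ => ?_
  rw [Finset.sum_eq_single i]
  · rw [hs.mul_self, mul_one, Matrix.add_apply, edgeMatrix_self, add_zero]; rfl
  · intro j _ hji
    by_cases hadj : G.Adj i j
    · rw [Matrix.add_apply, edgeMatrix_of_adj _ hadj, edgePart_mk hY, add_neg_cancel, zero_mul]
    · rw [Matrix.add_apply, edgeMatrix_of_not_adj _ hadj]
      have : Y i j = 0 := by
        by_contra hne
        exact hadj (hp i j hji.symm hne)
      rw [this, add_zero, zero_mul]
  · simp

/-- The facet normals of the cut polytope of a series-parallel graph are supported on a single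
edge or on a chordless cycle. -/
theorem SeriesParallel.facet_support {V : Type*} [Fintype V] [Nonempty V] {G : SimpleGraph V}
    [Fintype G.edgeSet] (hG : SeriesParallel G) {α : G.edgeSet → ℝ} {b : ℝ}
    (h : IsFacetDefining (cutPolytope G) α b) (hα : α ≠ 0) :
    (∃ x y, OnEdge (edgeMatrix α) x y) ∨
      ∃ m f, IsChordlessCycle G m f ∧ OnRange (edgeMatrix α) m f := by
  classical
  set v0 : V := Classical.arbitrary V
  set X : Matrix V V ℝ := Matrix.single v0 v0 (2 * b) - edgeMatrix α with hX
  have hdiag : ∀ i j, i ≠ j → Matrix.single v0 v0 (2 * b) i j = (0 : ℝ) := by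
    intro i j hij
    rw [Matrix.single_apply, if_neg]
    rintro ⟨rfl, rfl⟩
    exact hij rfl
  have hXsymm : ∀ i j, X i j = X j i := by
    intro i j
    by_cases hij : i = j
    · rw [hij]
    · rw [hX, Matrix.sub_apply, Matrix.sub_apply, hdiag i j hij, hdiag j i (Ne.symm hij),
        edgeMatrix_symm]
  have hXpat : HasPattern G X := by
    intro i j hij hne
    rw [hX, Matrix.sub_apply, hdiag i j hij, zero_sub] at hne
    exact hasPattern_edgeMatrix α i j hij (neg_ne_zero.1 hne)
  have hXedge : edgePart G X = α := by
    ext ⟨e, he⟩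
    induction e with | _ i j
    have hadj : G.Adj i j := he
    rw [edgePart_mk hXsymm, hX, Matrix.sub_apply, hdiag i j hadj.ne, edgeMatrix_of_adj α hadj]
    ring
  have hXtr : X.trace = 2 * b := by
    have : (edgeMatrix α).trace = 0 := Finset.sum_eq_zero fun i _ => edgeMatrix_self α i
    rw [hX, Matrix.trace_sub, this, Matrix.trace_single_eq_same, sub_zero]
  have hXmem : X ∈ spinCone V := by
    refine ⟨hXsymm, fun s hs => ?_⟩
    rw [quadratic_eq_trace_sub hXsymm hXpat hs, hXedge, hXtr]
    linarith [h.1 _ (spinVector_mem_cutPolytope G hs)]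
  obtain ⟨l, hl, hsum⟩ := hG.exists_list_isPiece isEliminationCone_spinCone hXmem hXpat
  obtain ⟨Y, hYl, hY0⟩ : ∃ Y ∈ l, edgePart G Y ≠ 0 := by
    by_contra hcon
    push Not at hcon
    apply hα
    rw [← hXedge, ← hsum, map_list_sum]
    refine List.sum_eq_zero fun z hz => ?_
    obtain ⟨Y, hY, rfl⟩ := List.mem_map.1 hz
    exact hcon Y hY
  have hYsymm := (hl Y hYl).mem.1
  have hle : ∀ Z ∈ l, ∀ x ∈ cutPolytope G, 0 ≤ Z.trace - 2 * (edgePart G Z ⬝ᵥ x) := by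
    intro Z hZ x hx
    have := dotProduct_le_of_forall_spin (α := edgePart G Z) (b := Z.trace / 2) (fun s hs => by
      have := (hl Z hZ).mem.2 s hs
      rw [quadratic_eq_trace_sub (hl Z hZ).mem.1 (hl Z hZ).pattern hs] at this
      linarith) x hx
    linarith
  have htight : ∀ x ∈ cutPolytope G, α ⬝ᵥ x = b → 2 * (edgePart G Y ⬝ᵥ x) = Y.trace := by
    intro x hx hxb
    let L : Matrix V V ℝ →+ ℝ :=
      { toFun := fun Z => Z.trace - 2 * (edgePart G Z ⬝ᵥ x)
        map_zero' := by simp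
        map_add' := fun Z W => by
          rw [Matrix.trace_add, map_add, add_dotProduct]; ring }
    have hL : (l.map L).sum = 0 := by
      rw [← map_list_sum, hsum]
      change X.trace - 2 * (edgePart G X ⬝ᵥ x) = 0
      rw [hXtr, hXedge, hxb, sub_self]
    have hLY : L Y ≤ (l.map L).sum := List.single_le_sum (fun z hz => by
      obtain ⟨Z, hZ, rfl⟩ := List.mem_map.1 hz
      exact hle Z hZ x hx) _ (List.mem_map_of_mem hYl)
    rw [hL] at hLY
    have h1 : Y.trace - 2 * (edgePart G Y ⬝ᵥ x) ≤ 0 := hLY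
    have h2 := hle Y hYl x hx
    linarith
  obtain ⟨t, ht⟩ := h.exists_eq_smul (finrank_vectorSpan_cutPolytope G) hα (β := edgePart G Y) (by
    intro x hx hxb y hy hyb
    have h1 := htight x hx hxb
    have h2 := htight y hy hyb
    linarith)
  have ht0 : t ≠ 0 := by
    rintro rfl
    exact hY0 (by rw [ht, zero_smul])
  have nz : ∀ i j, edgeMatrix α i j ≠ 0 → Y i j ≠ 0 := by
    intro i j hne hYij
    have hadj : G.Adj i j := by
      by_contra hn
      exact hne (edgeMatrix_of_not_adj α hn)
    have := congrFun ht ⟨s(i, j), G.mem_edgeSet.2 hadj⟩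
    rw [edgePart_mk hYsymm, hYij, Pi.smul_apply, smul_eq_mul, ← edgeMatrix_of_adj α hadj,
      neg_zero] at this
    rcases mul_eq_zero.1 this.symm with h1 | h1
    · exact ht0 h1
    · exact hne h1
  rcases (hl Y hYl).shape with ⟨x, y, hxy⟩ | ⟨m, f, hf, hr⟩
  · exact Or.inl ⟨x, y, fun i j hij hne => hxy i j hij (nz i j hne)⟩
  · exact Or.inr ⟨m, f, hf, fun i j hij hne => hr i j hij (nz i j hne)⟩

theorem SeriesParallel.facetConstantTerms_subset {V : Type*} [Fintype V] [Nonempty V]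
    {G : SimpleGraph V} [Fintype G.edgeSet] (hG : SeriesParallel G) {b : ℝ}
    (hb : b ∈ facetConstantTerms G) :
    b = 1 ∨ ∃ m ∈ chordlessCycleLengths G, b = ((m - 2 : ℕ) : ℝ) := by
  obtain ⟨a, ha, h⟩ := hb
  have hα : (fun e => (a e : ℝ)) ≠ 0 := by
    intro h0
    have h2 := ha 2 (fun e => by
      have : (a e : ℝ) = 0 := congrFun h0 e
      rw [Int.cast_eq_zero.1 this]; exact dvd_zero _)
    rw [Int.isUnit_iff] at h2
    omega
  rcases hG.facet_support h hα with ⟨x, y, hxy⟩ | ⟨m, f, hf, hr⟩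
  · left
    obtain ⟨e0, he0⟩ : ∃ e0, a e0 ≠ 0 := by
      by_contra hcon
      push Not at hcon
      exact hα (by ext e; simp [hcon e])
    have hval : ∀ e : G.edgeSet, a e ≠ 0 → (e : Sym2 V) = s(x, y) := by
      rintro ⟨e, he⟩ hne
      induction e with | _ i j
      have hadj : G.Adj i j := he
      have := hxy i j hadj.ne (by
        rw [edgeMatrix_of_adj _ hadj]
        exact_mod_cast hne)
      rw [Sym2.eq_iff]
      exact this
    refine facet_constant_of_edge ha h (e0 := e0) fun e he => ?_
    by_contra hne
    exact he (Subtype.ext ((hval e hne).trans (hval e0 he0).symm))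
  · have h3 := hf.three_le
    rcases facet_constant_of_cycle ha h hf hr with h1 | h1
    · exact Or.inl h1
    · refine Or.inr ⟨m, hf.mem_chordlessCycleLengths, ?_⟩
      rw [h1]
      push_cast [show 2 ≤ m by omega]
      ring

/-! ### Cycle inequalities and edge inequalities define facets -/

theorem mulVec_eq_zero_of_flip {V : Type*} [Fintype V] [DecidableEq V] {G : SimpleGraph V}
    [Fintype G.edgeSet] {β : G.edgeSet → ℝ} {s : V → ℝ} (hs : IsSpin s) {a : V}
    (h : β ⬝ᵥ spinVector G (Function.update s a (-s a)) = β ⬝ᵥ spinVector G s) :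
    (edgeMatrix β *ᵥ s) a = 0 := by
  have e := quadratic_sub_flip (edgeMatrix_symm β) s (edgeMatrix_self β a)
  simp only [dotProduct_edgeMatrix_mulVec, h, sub_self] at e
  rcases hs a with h1 | h1 <;> rw [h1] at e <;> linarith

/-- The sign pattern of the cycle inequality with exactly one negative edge. -/
def closingSign (m i : ℕ) : ℤ := if i + 1 = m then -1 else 1

theorem closingSign_cast {m i : ℕ} : ((closingSign m i : ℤ) : ℝ) = 1 ∨
    ((closingSign m i : ℤ) : ℝ) = -1 := by
  unfold closingSign
  split_ifs <;> simp

theorem prod_closingSign {m : ℕ} (hm : 0 < m) :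
    ∏ i ∈ Finset.range m, ((closingSign m i : ℤ) : ℝ) = -1 := by
  rw [show Finset.range m = Finset.range (m - 1 + 1) by rw [Nat.sub_add_cancel hm],
    Finset.prod_range_succ, Finset.prod_eq_one]
  · simp [closingSign, Nat.sub_add_cancel hm]
  · intro i hi
    have := Finset.mem_range.1 hi
    simp [closingSign, show i + 1 ≠ m by omega]

/-- A spin that changes sign along the cycle exactly after position `j`. -/
structure IsStep {V : Type*} (m : ℕ) (f : ℕ → V) (s : V → ℝ) (τ : ℝ) (j : ℕ) : Prop where
  spin : IsSpin s
  sign : τ = 1 ∨ τ = -1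
  lt : j < m
  eq : ∀ i < m, s (f i) = τ * if i ≤ j then 1 else -1

theorem IsChordlessCycle.closingSign_mul {V : Type*} {G : SimpleGraph V} {m : ℕ} {f : ℕ → V}
    (hf : IsChordlessCycle G m f) {s : V → ℝ} {τ : ℝ} {j : ℕ} (h : IsStep m f s τ j) (i : Fin m) :
    ((closingSign m i : ℤ) : ℝ) * spinVector G s (hf.edge i) = if (i : ℕ) = j then -1 else 1 := by
  have h3 := hf.three_le
  have hi := i.2
  have hj := h.lt
  rw [hf.spinVector_edge, h.eq i hi, h.eq _ (cycleSucc_lt hi)]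
  have hτ : τ * τ = 1 := by rcases h.sign with h1 | h1 <;> rw [h1] <;> norm_num
  unfold closingSign
  by_cases hlast : (i : ℕ) + 1 = m
  · rw [cycleSucc_of_eq hlast, if_pos hlast, if_pos (Nat.zero_le j)]
    by_cases hij : (i : ℕ) = j
    · rw [if_pos hij, if_pos (by omega)]
      push_cast
      linear_combination -hτ
    · rw [if_neg hij, if_neg (by omega)]
      push_cast
      linear_combination hτ
  · rw [cycleSucc_of_lt (by omega), if_neg hlast]
    push_cast
    by_cases hij : (i : ℕ) = j
    · rw [if_pos hij, if_pos (by omega), if_neg (by omega)]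
      linear_combination -hτ
    · rw [if_neg hij]
      by_cases hlt : (i : ℕ) ≤ j
      · rw [if_pos hlt, if_pos (by omega)]
        linear_combination hτ
      · rw [if_neg hlt, if_neg (by omega)]
        linear_combination hτ

theorem IsChordlessCycle.exists_isStep {V : Type*} {G : SimpleGraph V} {m : ℕ} {f : ℕ → V}
    (hf : IsChordlessCycle G m f) {j : ℕ} (hj : j < m) : ∃ s : V → ℝ, IsStep m f s 1 j := by
  obtain ⟨s, hs, h⟩ := exists_spin hf.inj (p := fun i => if i ≤ j then 1 else -1)
    (fun i => by split_ifs <;> simp)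
  exact ⟨s, hs, Or.inl rfl, hj, fun i hi => by rw [h i hi, one_mul]⟩

theorem IsStep.flip_of_notMem {V : Type*} [DecidableEq V] {m : ℕ} {f : ℕ → V} {s : V → ℝ} {τ : ℝ}
    {j : ℕ} (h : IsStep m f s τ j) {a : V} (ha : ∀ i < m, f i ≠ a) :
    IsStep m f (Function.update s a (-s a)) τ j :=
  ⟨h.spin.flip a, h.sign, h.lt, fun i hi => by
    rw [Function.update_of_ne (ha i hi)]; exact h.eq i hi⟩

theorem IsChordlessCycle.mem_facetConstantTerms {V : Type*} [Fintype V] {G : SimpleGraph V}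
    [Fintype G.edgeSet] {m : ℕ} {f : ℕ → V} (hf : IsChordlessCycle G m f) :
    (m : ℝ) - 2 ∈ facetConstantTerms G := by
  classical
  have h3 := hf.three_le
  set a : G.edgeSet → ℤ := Function.extend hf.edge (fun i => closingSign m i) 0 with ha
  have haE : ∀ i, a (hf.edge i) = closingSign m i := fun i => hf.edge_injective.extend_apply _ _ i
  have ha0 : ∀ e, (∀ i, hf.edge i ≠ e) → a e = 0 := fun e he =>
    Function.extend_apply' _ _ _ (fun ⟨i, hi⟩ => he i hi)
  have hdot : ∀ x : G.edgeSet → ℝ, (fun e => (a e : ℝ)) ⬝ᵥ x =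
      ∑ i : Fin m, ((closingSign m i : ℤ) : ℝ) * x (hf.edge i) := by
    intro x
    rw [hf.dotProduct_eq_sum (fun e he => by rw [ha0 e he, Int.cast_zero])]
    exact Finset.sum_congr rfl fun i _ => by rw [haE]
  have htight : ∀ s τ j, IsStep m f s τ j → (fun e => (a e : ℝ)) ⬝ᵥ spinVector G s = m - 2 := by
    intro s τ j h
    rw [hdot]
    simp only [hf.closingSign_mul h]
    have : ∀ i : Fin m, (if (i : ℕ) = j then (-1 : ℝ) else 1) =
        1 - if i = ⟨j, h.lt⟩ then 2 else 0 := by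
      intro i
      by_cases hij : (i : ℕ) = j
      · rw [if_pos hij, if_pos (Fin.ext hij)]; norm_num
      · rw [if_neg hij, if_neg (fun h' => hij (congrArg Fin.val h'))]; norm_num
    simp only [this, Finset.sum_sub_distrib, Finset.sum_ite_eq', Finset.mem_univ, if_true]
    simp
  refine ⟨a, fun d hd => ?_, ?_⟩
  · have := hd (hf.edge ⟨0, by omega⟩)
    rw [haE] at this
    simp only [closingSign, zero_add, show ¬ 1 = m by omega, if_false] at this
    exact isUnit_of_dvd_one this
  refine isFacetDefining_of_forall (finrank_vectorSpan_cutPolytope G) ?_ ?_ ?_ ?_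
  · intro h0
    have := congrFun h0 (hf.edge ⟨0, by omega⟩)
    simp only [haE, closingSign, zero_add, show ¬ 1 = m by omega, if_false] at this
    simp at this
  · refine dotProduct_le_of_forall_spin fun s hs => ?_
    rw [hdot]
    exact hf.sum_le (σ := fun i => ((closingSign m i : ℤ) : ℝ)) (fun i => closingSign_cast)
      (prod_closingSign (by omega)) hs
  · obtain ⟨s, hs⟩ := hf.exists_isStep (j := 0) (by omega)
    exact ⟨_, spinVector_mem_cutPolytope G hs.spin, htight _ _ _ hs⟩
  · intro β hβ
    have hconst : ∀ s τ j s' τ' j', IsStep m f s τ j → IsStep m f s' τ' j' →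
        β ⬝ᵥ spinVector G s = β ⬝ᵥ spinVector G s' := fun s τ j s' τ' j' h h' =>
      hβ _ (spinVector_mem_cutPolytope G h.spin) (htight _ _ _ h) _
        (spinVector_mem_cutPolytope G h'.spin) (htight _ _ _ h')
    -- the weights vanish off the cycle
    have hoff : ∀ u w, u ≠ w → (∀ i < m, f i ≠ u) → edgeMatrix β u w = 0 := by
      intro u w huw hu
      obtain ⟨s, j, τ', j', hs, hs'⟩ : ∃ s j τ' j', IsStep m f s 1 j ∧
          IsStep m f (Function.update s w (-s w)) τ' j' := by
        by_cases hw : ∃ k < m, f k = w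
        · obtain ⟨k, hk, rfl⟩ := hw
          obtain ⟨s, hs⟩ := hf.exists_isStep hk
          have hne : ∀ i < m, i ≠ k → f i ≠ f k := fun i hi hik h => hik (hf.inj i hi k hk h)
          by_cases hk0 : k = 0
          · refine ⟨s, k, -1, m - 1, hs, hs.spin.flip _, Or.inr rfl, by omega, fun i hi => ?_⟩
            rw [if_pos (by omega)]
            by_cases hik : i = k
            · rw [hik, Function.update_self, hs.eq k hk, if_pos le_rfl]; norm_num
            · rw [Function.update_of_ne (hne i hi hik), hs.eq i hi, if_neg (by omega)]; norm_num
          · refine ⟨s, k, 1, k - 1, hs, hs.spin.flip _, Or.inl rfl, by omega, fun i hi => ?_⟩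
            by_cases hik : i = k
            · rw [hik, Function.update_self, hs.eq k hk, if_pos le_rfl, if_neg (by omega)]
              norm_num
            · rw [Function.update_of_ne (hne i hi hik), hs.eq i hi]
              congr 1
              by_cases hle : i ≤ k
              · rw [if_pos hle, if_pos (by omega)]
              · rw [if_neg hle, if_neg (by omega)]
        · push Not at hw
          obtain ⟨s, hs⟩ := hf.exists_isStep (j := 0) (by omega)
          exact ⟨s, 0, 1, 0, hs, hs.flip_of_notMem hw⟩
      have h1 := hconst _ _ _ _ _ _ (hs.flip_of_notMem hu) hs
      have h2 := hconst _ _ _ _ _ _ (hs'.flip_of_notMem hu) hs'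
      rw [Function.update_of_ne huw] at h2
      exact edgeMatrix_eq_zero_of_flips β hs.spin huw h1 h2
    have hrange : OnRange (edgeMatrix β) m f := by
      intro i j hij hne
      constructor
      · by_contra hcon
        push Not at hcon
        exact hne (hoff i j hij hcon)
      · by_contra hcon
        push Not at hcon
        exact hne (by rw [edgeMatrix_symm, hoff j i hij.symm hcon])
    have hzero := hf.apply_eq_zero_of_onRange hrange
    set ρ : Fin m → ℝ := fun i => β (hf.edge i) * ((closingSign m i : ℤ) : ℝ) with hρ
    have hsq : ∀ i : Fin m, ((closingSign m i : ℤ) : ℝ) * ((closingSign m i : ℤ) : ℝ) = 1 := by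
      intro i
      rcases closingSign_cast (m := m) (i := i) with h | h <;> rw [h] <;> norm_num
    have hval : ∀ s τ j, ∀ h : IsStep m f s τ j,
        β ⬝ᵥ spinVector G s = ∑ i, ρ i - 2 * ρ ⟨j, h.lt⟩ := by
      intro s τ j h
      have e : ∀ i : Fin m, β (hf.edge i) * spinVector G s (hf.edge i) =
          ρ i - if i = ⟨j, h.lt⟩ then 2 * ρ i else 0 := by
        intro i
        have h1 : β (hf.edge i) * spinVector G s (hf.edge i) =
            ρ i * (((closingSign m i : ℤ) : ℝ) * spinVector G s (hf.edge i)) := by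
          simp only [hρ]
          linear_combination -(β (hf.edge i) * spinVector G s (hf.edge i)) * hsq i
        rw [h1, hf.closingSign_mul h]
        by_cases hij : (i : ℕ) = j
        · rw [if_pos hij, if_pos (Fin.ext hij)]; ring
        · rw [if_neg hij, if_neg (fun h' => hij (congrArg Fin.val h'))]; ring
      rw [hf.dotProduct_eq_sum hzero, Finset.sum_congr rfl fun i _ => e i,
        Finset.sum_sub_distrib, Finset.sum_ite_eq', if_pos (Finset.mem_univ _)]
    have hρconst : ∀ i : Fin m, ρ i = ρ ⟨0, by omega⟩ := by
      intro i
      obtain ⟨s, hs⟩ := hf.exists_isStep i.2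
      obtain ⟨s', hs'⟩ := hf.exists_isStep (j := 0) (by omega)
      have h1 := hconst _ _ _ _ _ _ hs hs'
      rw [hval _ _ _ hs, hval _ _ _ hs'] at h1
      linarith
    refine ⟨ρ ⟨0, by omega⟩, ?_⟩
    ext e
    rw [Pi.smul_apply, smul_eq_mul]
    by_cases he : ∃ i, hf.edge i = e
    · obtain ⟨i, rfl⟩ := he
      rw [haE, ← hρconst i]
      simp only [hρ]
      linear_combination -β (hf.edge i) * hsq i
    · push Not at he
      rw [hzero e he, ha0 e he, Int.cast_zero, mul_zero]

/-- An edge in no triangle gives a facet with constant term one. -/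
theorem one_mem_facetConstantTerms_of_adj {V : Type*} [Fintype V] {G : SimpleGraph V}
    [Fintype G.edgeSet] {u w : V} (huw : G.Adj u w) (hno : ∀ c, G.Adj c u → ¬ G.Adj c w) :
    1 ∈ facetConstantTerms G := by
  classical
  set e0 : G.edgeSet := ⟨s(u, w), G.mem_edgeSet.2 huw⟩ with he0
  set a : G.edgeSet → ℤ := Pi.single e0 1 with ha
  have hcast : (fun e => (a e : ℝ)) = Pi.single e0 1 := by
    ext e
    by_cases he : e = e0
    · subst he; simp [ha]
    · simp [ha, he]
  refine ⟨a, fun d hd => ?_, ?_⟩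
  · have := hd e0
    rw [ha, Pi.single_eq_same] at this
    exact isUnit_of_dvd_one this
  rw [hcast]
  have htight : ∀ s : V → ℝ, IsSpin s → s u = s w →
      (Pi.single e0 1 : G.edgeSet → ℝ) ⬝ᵥ spinVector G s = 1 := by
    intro s hs h
    rw [single_dotProduct, one_mul, he0, spinVector_mk, ← h, hs.mul_self]
  refine isFacetDefining_of_forall (finrank_vectorSpan_cutPolytope G) ?_ ?_ ?_ ?_
  · intro h0
    have := congrFun h0 e0
    simp at this
  · intro x hx
    rw [single_dotProduct]
    exact sign_mul_apply_le_one hx (Or.inl rfl) e0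
  · exact ⟨_, spinVector_mem_cutPolytope G isSpin_one, htight _ isSpin_one rfl⟩
  · intro β hβ
    have hflip : ∀ s : V → ℝ, IsSpin s → s u = s w → ∀ c, c ≠ u → c ≠ w →
        (edgeMatrix β *ᵥ s) c = 0 := by
      intro s hs h c hcu hcw
      have h' : Function.update s c (-s c) u = Function.update s c (-s c) w := by
        rw [Function.update_of_ne hcu.symm, Function.update_of_ne hcw.symm, h]
      exact mulVec_eq_zero_of_flip hs (hβ _ (spinVector_mem_cutPolytope G (hs.flip c))
        (htight _ (hs.flip c) h') _ (spinVector_mem_cutPolytope G hs) (htight _ hs h))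
    have hout : ∀ c d, G.Adj c d → c ≠ u → c ≠ w → edgeMatrix β c d = 0 := by
      intro c d hcd hcu hcw
      have h1 := hflip 1 isSpin_one rfl c hcu hcw
      by_cases hd : d ≠ u ∧ d ≠ w
      · have h2 := hflip _ (isSpin_one.flip d) (by
          rw [Function.update_of_ne hd.1.symm, Function.update_of_ne hd.2.symm]; rfl) c hcu hcw
        rw [mulVec_flip, h1, Pi.one_apply] at h2
        linarith
      · have hs2 := (isSpin_one (V := V)).flip u
        have h2 := hflip _ (hs2.flip w) (by
          rw [Function.update_of_ne huw.ne, Function.update_self, Function.update_self,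
            Function.update_of_ne huw.ne.symm]; rfl) c hcu hcw
        rw [mulVec_flip, mulVec_flip, h1, Function.update_of_ne huw.ne.symm, Pi.one_apply,
          Pi.one_apply] at h2
        by_cases hdu : d = u
        · subst hdu
          rw [edgeMatrix_of_not_adj β (hno c hcd)] at h2
          linarith
        · have hdw : d = w := by
            by_contra hdw
            exact hd ⟨hdu, hdw⟩
          subst hdw
          rw [edgeMatrix_of_not_adj β (fun h => hno c h hcd)] at h2
          linarith
    refine ⟨β e0, ?_⟩
    ext ⟨e, he⟩
    induction e with | _ c d
    have hcd : G.Adj c d := he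
    rw [Pi.smul_apply, smul_eq_mul]
    by_cases hee : (⟨s(c, d), he⟩ : G.edgeSet) = e0
    · rw [hee, Pi.single_eq_same, mul_one]
    · rw [Pi.single_eq_of_ne hee, mul_zero]
      by_cases hc : c ≠ u ∧ c ≠ w
      · rw [← hout c d hcd hc.1 hc.2, edgeMatrix_of_adj β hcd]
      · have hd : d ≠ u ∧ d ≠ w := by
          have hne : s(c, d) ≠ s(u, w) := fun h => hee (Subtype.ext h)
          have := hcd.ne
          rw [Ne, Sym2.eq_iff] at hne
          grind
        rw [← hout d c hcd.symm hd.1 hd.2, edgeMatrix_symm, edgeMatrix_of_adj β hcd]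

theorem one_mem_facetConstantTerms {V : Type*} [Fintype V] {G : SimpleGraph V}
    [Fintype G.edgeSet] (hG : G ≠ ⊥) : 1 ∈ facetConstantTerms G := by
  obtain ⟨u, w, huw⟩ := SimpleGraph.ne_bot_iff_exists_adj.1 hG
  by_cases h : ∃ c, G.Adj c u ∧ G.Adj c w
  · obtain ⟨c, h1, h2⟩ := h
    have := (IsChordlessCycle.triangle h1 h2 huw).mem_facetConstantTerms
    norm_num at this
    exact this
  · push Not at h
    exact one_mem_facetConstantTerms_of_adj huw h

theorem SeriesParallel.facetConstantTerms_eq {V : Type*} [Fintype V] [Nonempty V]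
    {G : SimpleGraph V} [Fintype G.edgeSet] (hG : SeriesParallel G) (hbot : G ≠ ⊥) :
    facetConstantTerms G = (fun r : ℕ => (r : ℝ)) '' extremalRanks G := by
  rw [hG.extremalRanks_eq]
  ext b
  constructor
  · intro hb
    rcases hG.facetConstantTerms_subset hb with rfl | ⟨m, hm, rfl⟩
    · exact ⟨1, Or.inl rfl, Nat.cast_one⟩
    · exact ⟨m - 2, Or.inr ⟨m, hm, rfl⟩, rfl⟩
  · rintro ⟨r, rfl | ⟨m, hm, rfl⟩, rfl⟩
    · simpa using one_mem_facetConstantTerms hbot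
    · obtain ⟨f, hf⟩ := exists_isChordlessCycle hm
      have h3 := hf.three_le
      have := hf.mem_facetConstantTerms
      rw [show ((m : ℝ) - 2) = ((m - 2 : ℕ) : ℝ) by
        push_cast [show 2 ≤ m by omega]; ring] at this
      exact this

theorem le_card_of_mem_chordlessCycleLengths {V : Type*} [Fintype V] {G : SimpleGraph V} {m : ℕ}
    (hm : m ∈ chordlessCycleLengths G) : m ≤ Fintype.card V := by
  obtain ⟨-, ⟨e⟩⟩ := hm
  simpa using Fintype.card_le_of_injective e e.injective

theorem isGreatest_sSup_of_le {S : Set ℕ} (hne : S.Nonempty) {n : ℕ} (h : ∀ m ∈ S, m ≤ n) :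
    IsGreatest S (sSup S) :=
  ⟨Nat.sSup_mem hne ⟨n, h⟩, fun _ hm => le_csSup ⟨n, h⟩ hm⟩

theorem theorem1p3 {V : Type*} [Fintype V] [DecidableEq V] [Nonempty V]
    (G : SimpleGraph V) [DecidableRel G.Adj] (hG : SeriesParallel G) :
    -- the extremal ranks are `1` and `m - 2` for the chordless cycles `C_m` of `G`
    extremalRanks G = {1} ∪ {r | ∃ m ∈ chordlessCycleLengths G, r = m - 2} ∧
    -- they are the constant terms of the facets of the cut polytope (if there are edges)
    (G ≠ ⊥ → facetConstantTerms G = (fun r : ℕ => (r : ℝ)) '' extremalRanks G) ∧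
    -- the sparsity order is attained, and it is determined by the longest chordless cycle
    IsGreatest (extremalRanks G) (sparsityOrder G) ∧
    ((chordlessCycleLengths G).Nonempty →
      ∃ q, IsGreatest (chordlessCycleLengths G) q ∧ sparsityOrder G = q - 2) ∧
    (chordlessCycleLengths G = ∅ → sparsityOrder G = 1) := by
  have hranks := hG.extremalRanks_eq
  have hgreatest : IsGreatest (extremalRanks G) (sparsityOrder G) := by
    refine isGreatest_sSup_of_le ⟨1, one_mem_extremalRanks G⟩ (n := Fintype.card V) ?_
    rintro r ⟨X, -, rfl⟩
    exact X.rank_le_card_width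
  refine ⟨hranks, hG.facetConstantTerms_eq, hgreatest, fun hne => ?_, fun hempty => ?_⟩
  · have hq := isGreatest_sSup_of_le hne fun m hm => le_card_of_mem_chordlessCycleLengths hm
    refine ⟨_, hq, hgreatest.unique ⟨sub_two_mem_extremalRanks hq.1, fun r hr => ?_⟩⟩
    rw [hranks] at hr
    have h3 := hq.1.1
    rcases hr with rfl | ⟨m, hm, rfl⟩
    · omega
    · have := hq.2 hm
      omega
  · refine hgreatest.unique ⟨one_mem_extremalRanks G, fun r hr => ?_⟩
    rw [hranks] at hr
    rcases hr with rfl | ⟨m, hm, rfl⟩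
    · exact le_rfl
    · rw [hempty] at hm
      exact absurd hm (Set.notMem_empty m)
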